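/- Let $\mathcal X$ be an orbifold, i.e. a differentiable Deligne–Mumford stack (a stack over smooth manifolds presented by an étale proper groupoid). Maps between stacks are considered together with their 2-isomorphisms, and a diffeomorphism is an equivalence of stacks over manifolds. For $K$ a manifold or a product of closed intervals, a *smooth family of diffeomorphisms* of $\mathcal X$ parametrized by $K$ is a map $\Gamma:K\times\mathcal X\to\mathcal X$ such that $(k,x)\mapsto(k,\Gamma(k,x))$ is a diffeomorphism of $K\times\mathcal X$. **Smooth loops.** A *smooth loop of orbifold diffeomorphisms* of $\mathcal X$ is a map $\gamma:[0,1]\times\mathcal X\to\mathcal X$ together with a smooth family of diffeomorphisms $\tilde\gamma:S^1\times\mathcal X\to\mathcal X$ and a 2-isomorphism $\gamma\Rightarrow\tilde\gamma\circ(\exp,\mathrm{Id}_{\mathcal X})$, where $\exp(t)=e^{2\pi i t}$. **Homotopy equivalence.** For a parameter space $K$ (a point or a closed interval), a *$K$-family of piecewise smooth loops* is a partition $0=t_0<\dots<t_{n+1}=1$, smooth families of diffeomorphisms parametrized by $K\times[t_l,t_{l+1}]$ for $0\le l\le n$, 2-isomorphisms between consecutive pieces over $K\times\{t_l\}$ for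 $1\le l\le n$, and a 2-isomorphism between the restriction of the last piece to $K\times\{1\}$ and that of the first piece to $K\times\{0\}$. *Naturally related* is the equivalence relation on piecewise smooth loops generated by splitting a piece at finitely many points (with identity 2-isomorphisms at the new joints) and by replacing the pieces by 2-isomorphic ones, compatibly with the 2-isomorphisms at the joints and at the ends. A smooth loop $\gamma$ is a piecewise smooth loop with one piece, the 2-isomorphism between its ends being the one given by $\gamma\Rightarrow\tilde\gamma\circ(\exp,\mathrm{Id})$ and $\exp 0=\exp 1$. Two smooth loops $\gamma_0,\gamma_1$ are *homotopy equivalent* if there are a partition $0=s_0<\dots<s_{N+1}=1$ and, for each $0\le k\le N$, an $[s_k,s_{k+1}]$-family $\Gamma_k$ of piecewise smooth loops (each with its own partition of $[0,1]$) such that $\Gamma_{k-1}$ and $\Gamma_k$ are naturally related at $s_k$ for $1\le k\le N$, $\Gamma_0$ at $0$ is naturally related to $\gamma_0$, and $\Gamma_N$ at $1$ is naturally related to $\gamma_1$. **The bundle of a loop.** Let $\delta>0$. In $S^2=\mathbb{CP}^1$ put $D_+=\{[z,1]:|z|<1+\delta\}$, $D_-=\{[1,z]:|z|<1+\delta\}$,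 $Ann=D_+\cap D_-$, and $\Theta:Ann\to S^1$, $[re^{i\theta},1]\mapsto e^{i\theta}$. For a smooth loop $\gamma$ let $\pi_\gamma:\mathcal E_\gamma\to S^2$ be the stack over $S^2$ obtained by gluing $D_-\times\mathcal X$ and $D_+\times\mathcal X$ along the open embeddings $$em_-:Ann\times\mathcal X\to D_-\times\mathcal X,\ (z,x)\mapsto(z,x),\qquad em_+:Ann\times\mathcal X\to D_+\times\mathcal X,\ (z,x)\mapsto(z,\tilde\gamma(\Theta(z),x)),$$ with the projection to the first factor on each piece. **Proposition.** If two smooth loops $\gamma_0,\gamma_1$ of orbifold diffeomorphisms of $\mathcal X$ are homotopy equivalent, then there is an isomorphism of orbifiber bundles between $\mathcal E_{\gamma_0}\to S^2$ and $\mathcal E_{\gamma_1}\to S^2$: a diffeomorphism $\Psi:\mathcal E_{\gamma_0}\to\mathcal E_{\gamma_1}$ and a diffeomorphism of $S^2$, which can be taken to be the identity, that commute with the projections $\pi_{\gamma_0},\pi_{\gamma_1}$. -/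

import Mathlib

open CategoryTheory
open scoped Manifold ContDiff CategoryTheory.BasedFunctor

universe v u v' u' v'' u'' v''' u'''

noncomputable section

/-! # Manifolds -/

/-- A smooth manifold: Hausdorff, second countable, without boundary, modelled on a
finite-dimensional real vector space. -/
structure Mfd : Type 1 where
  carrier : Type
  model : Type
  [normed : NormedAddCommGroup model]
  [space : NormedSpace ℝ model]
  [finDim : FiniteDimensional ℝ model]
  [top : TopologicalSpace carrier]
  [t2 : T2Space carrier]
  [secondCountable : SecondCountableTopology carrier]
  [charted : ChartedSpace model carrier]
  [smooth : IsManifold 𝓘(ℝ, model) ∞ carrier]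

namespace Mfd

attribute [instance] normed space finDim top t2 secondCountable charted smooth

instance : CoeSort Mfd Type := ⟨carrier⟩

/-- The category of smooth manifolds and smooth maps. -/
instance : Category Mfd where
  Hom M N := {f : M → N // ContMDiff 𝓘(ℝ, M.model) 𝓘(ℝ, N.model) ∞ f}
  id _ := ⟨id, contMDiff_id⟩
  comp f g := ⟨g.1 ∘ f.1, g.2.comp f.2⟩

/-- The constant map. -/
def const (M : Mfd) {N : Mfd} (y : N) : M ⟶ N := ⟨fun _ => y, contMDiff_const⟩

/-- An open subset as a manifold. -/
def restr (M : Mfd) (U : TopologicalSpace.Opens M) : Mfd where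
  carrier := U
  model := M.model

/-- The restriction of a smooth map to open subsets of source and target. -/
def mapRestr {M N : Mfd} (f : M ⟶ N) (U : TopologicalSpace.Opens M)
    (V : TopologicalSpace.Opens N) (h : ∀ x ∈ U, f.1 x ∈ V) : M.restr U ⟶ N.restr V :=
  ⟨fun x => (⟨f.1 x.1, h x.1 x.2⟩ : V), fun x =>
    (ContMDiffAt.subtypeVal_comp_iff (I := 𝓘(ℝ, M.model)) (I' := 𝓘(ℝ, N.model)) V
      (fun x : U => (⟨f.1 x.1, h x.1 x.2⟩ : V)) x).1
      ((f.2.comp contMDiff_subtype_val) x)⟩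

/-- The preimage of an open set. -/
def preim {M N : Mfd} (f : M ⟶ N) (V : TopologicalSpace.Opens N) : TopologicalSpace.Opens M :=
  ⟨f.1 ⁻¹' V, V.isOpen.preimage f.2.continuous⟩

/-- The real line. -/
def line : Mfd where
  carrier := ℝ
  model := ℝ

/-- The circle `S¹`, the unit complex numbers. -/
def circle : Mfd where
  carrier := Circle
  model := EuclideanSpace ℝ (Fin 1)
  smooth := IsManifold.of_le (n := ω) le_top

instance finrankThree : Fact (Module.finrank ℝ (EuclideanSpace ℝ (Fin 3)) = 2 + 1) := ⟨by simp⟩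

/-- The sphere `S²`, the unit sphere of `ℝ³`. -/
def sphere : Mfd where
  carrier := Metric.sphere (0 : EuclideanSpace ℝ (Fin 3)) 1
  model := EuclideanSpace ℝ (Fin 2)
  charted := EuclideanSpace.instChartedSpaceSphere (n := 2)
  smooth := IsManifold.of_le (n := ω) le_top

end Mfd

/-! # Stacks over manifolds

Categories over `Mfd`, functors over `Mfd` and 2-morphisms are `BasedCategory Mfd`, `⥤ᵇ` and the
morphisms of `𝒳 ⥤ᵇ 𝒴` in Mathlib.  A 2-isomorphism is an isomorphism in the category `𝒳 ⥤ᵇ 𝒴`. -/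

namespace Stk

/-- A category fibered in groupoids over manifolds: arrows can be lifted, and every arrow has
the unique lifting property (is strongly cartesian). -/
structure IsCFG (𝒳 : BasedCategory.{v, u} Mfd) : Prop where
  exists_lift : ∀ (x : 𝒳.obj) {R : Mfd} (f : R ⟶ 𝒳.p.obj x),
    ∃ (y : 𝒳.obj) (g : y ⟶ x), 𝒳.p.IsHomLift f g
  cartesian : ∀ {y x : 𝒳.obj} (g : y ⟶ x), 𝒳.p.IsStronglyCartesian (𝒳.p.map g) g

/-! ## The stack of a manifold -/

/-- Smooth maps into `N` that satisfy the condition `P`. -/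
structure PlotObj (N : Mfd) (P : ∀ ⦃Z : Mfd⦄, (Z ⟶ N) → Prop) : Type 1 where
  dom : Mfd
  map : dom ⟶ N
  mem : P map

@[ext]
structure PlotHom {N : Mfd} {P : ∀ ⦃Z : Mfd⦄, (Z ⟶ N) → Prop} (a b : PlotObj N P) : Type where
  hom : a.dom ⟶ b.dom
  w : hom ≫ b.map = a.map

instance {N : Mfd} {P : ∀ ⦃Z : Mfd⦄, (Z ⟶ N) → Prop} : Category (PlotObj N P) where
  Hom a b := PlotHom a b
  id a := ⟨𝟙 _, rfl⟩
  comp f g := ⟨f.hom ≫ g.hom, by rw [Category.assoc, g.w, f.w]⟩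

/-- The category over manifolds whose objects are the smooth maps into `N` that satisfy `P`. -/
def plots (N : Mfd) (P : ∀ ⦃Z : Mfd⦄, (Z ⟶ N) → Prop) : BasedCategory.{0, 1} Mfd where
  obj := PlotObj N P
  p := { obj := fun a => a.dom, map := fun {a b} (f : PlotHom a b) => f.hom }

/-- A subset `A` of a manifold `N` as a category over manifolds: its objects are the smooth maps
into `N` with values in `A`.  For an embedded submanifold `A`, or a closed interval `A` in the
line, these are the smooth maps into `A`. -/
def sub (N : Mfd) (A : Set N) : BasedCategory.{0, 1} Mfd :=
  plots N fun _ f => ∀ z, f.1 z ∈ A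

/-- The stack of a manifold. -/
def ofMfd (N : Mfd) : BasedCategory.{0, 1} Mfd := sub N Set.univ

/-- The map of stacks given by a smooth map. -/
def subMap {N N' : Mfd} (f : N ⟶ N') (A : Set N) (A' : Set N') (h : ∀ x ∈ A, f.1 x ∈ A') :
    sub N A ⥤ᵇ sub N' A' where
  obj := fun (a : PlotObj N _) => PlotObj.mk a.dom (a.map ≫ f) fun z => h _ (a.mem z)
  map := fun {a b : PlotObj N _} (g : PlotHom a b) =>
    PlotHom.mk (a := ⟨a.dom, a.map ≫ f, fun z => h _ (a.mem z)⟩)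
      (b := ⟨b.dom, b.map ≫ f, fun z => h _ (b.mem z)⟩) g.hom
      (by rw [← Category.assoc, g.w])
  w := rfl

/-- The map of stacks of manifolds given by a smooth map. -/
def ofMfdMap {N N' : Mfd} (f : N ⟶ N') : ofMfd N ⥤ᵇ ofMfd N' :=
  subMap f _ _ fun _ _ => trivial

/-- The one-point stack. -/
def pt : BasedCategory.{0, 1} Mfd := .ofFunctor (𝟭 Mfd)

/-- The inclusion of a point. -/
def ptMap (N : Mfd) (A : Set N) (y : N) (hy : y ∈ A) : pt ⥤ᵇ sub N A where
  obj := fun (Z : Mfd) => (⟨Z, Mfd.const Z y, fun _ => hy⟩ : PlotObj N _)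
  map := fun {Z Z' : Mfd} (g : Z ⟶ Z') => (⟨g, rfl⟩ : PlotHom _ _)
  w := rfl

/-- The closed interval `[a, b]`. -/
def seg (a b : ℝ) : BasedCategory.{0, 1} Mfd := sub Mfd.line (Set.Icc (α := ℝ) a b)

/-- The inclusion of one closed interval into another. -/
def segIncl {a b a' b' : ℝ} (h : Set.Icc a' b' ⊆ Set.Icc a b) : seg a' b' ⥤ᵇ seg a b :=
  subMap (𝟙 Mfd.line) _ _ fun _ hx => h hx

/-- The circle. -/
def S1 : BasedCategory.{0, 1} Mfd := ofMfd Mfd.circle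

/-! ## The stack condition -/

/-- The sieve of an open cover: smooth maps into `M` with values in a member of the cover. -/
def coverSieve (M : Mfd) {ι : Type} (U : ι → TopologicalSpace.Opens M) :
    BasedCategory.{0, 1} Mfd :=
  plots M fun _ f => ∃ i, ∀ z, f.1 z ∈ U i

def coverIncl (M : Mfd) {ι : Type} (U : ι → TopologicalSpace.Opens M) :
    coverSieve M U ⥤ᵇ ofMfd M where
  obj := fun (a : PlotObj M _) => (⟨a.dom, a.map, fun _ => trivial⟩ : PlotObj M _)
  map := fun {a b : PlotObj M _} (g : PlotHom a b) =>
    PlotHom.mk (a := ⟨a.dom, a.map, fun _ => trivial⟩) (b := ⟨b.dom, b.map, fun _ => trivial⟩)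
      g.hom g.w
  w := rfl

/-- Precomposition with a functor over manifolds. -/
def precomp {𝒳 : BasedCategory.{v, u} Mfd} {𝒴 : BasedCategory.{v', u'} Mfd}
    (F : 𝒳 ⥤ᵇ 𝒴) (𝒵 : BasedCategory.{v'', u''} Mfd) : (𝒴 ⥤ᵇ 𝒵) ⥤ (𝒳 ⥤ᵇ 𝒵) where
  obj G := F.comp G
  map α := BasedCategory.whiskerLeft F α

def isoWhiskerLeft {𝒳 : BasedCategory.{v, u} Mfd} {𝒴 : BasedCategory.{v', u'} Mfd}
    {𝒵 : BasedCategory.{v'', u''} Mfd} (F : 𝒳 ⥤ᵇ 𝒴) {G H : 𝒴 ⥤ᵇ 𝒵} (α : G ≅ H) :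
    F.comp G ≅ F.comp H :=
  (precomp F 𝒵).mapIso α

/-- A stack over manifolds.  For a category `𝒳` fibered in groupoids, functors `M ⥤ᵇ 𝒳` are
the objects of `𝒳` over `M` (2-Yoneda lemma), and functors from the sieve of an open cover to `𝒳`
are the descent data of `𝒳` for that cover; descent says that restriction is an equivalence of
these categories for every open cover of every manifold. -/
structure IsStack (𝒳 : BasedCategory.{v, u} Mfd) : Prop extends IsCFG 𝒳 where
  descent : ∀ (M : Mfd) {ι : Type} (U : ι → TopologicalSpace.Opens M), (∀ x, ∃ i, x ∈ U i) →
    (precomp (coverIncl M U) 𝒳).IsEquivalence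

/-- A map of stacks is an isomorphism (for orbifolds: a diffeomorphism) if it is an equivalence
of categories. -/
def IsDiffeo {𝒳 : BasedCategory.{v, u} Mfd} {𝒴 : BasedCategory.{v', u'} Mfd} (F : 𝒳 ⥤ᵇ 𝒴) :
    Prop :=
  F.toFunctor.IsEquivalence

/-! ## Fiber products and orbifolds -/

section FiberProduct

variable {𝒜 : BasedCategory.{v, u} Mfd} {ℬ : BasedCategory.{v', u'} Mfd}
  {𝒳 : BasedCategory.{v'', u''} Mfd} {F : 𝒜 ⥤ᵇ 𝒳} {G : ℬ ⥤ᵇ 𝒳}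

structure FibObj (F : 𝒜 ⥤ᵇ 𝒳) (G : ℬ ⥤ᵇ 𝒳) where
  fst : 𝒜.obj
  snd : ℬ.obj
  eq : ℬ.p.obj snd = 𝒜.p.obj fst
  iso : F.obj fst ≅ G.obj snd
  lift : 𝒳.p.IsHomLift (𝟙 (𝒜.p.obj fst)) iso.hom

@[ext]
structure FibHom (a b : FibObj F G) where
  fst : a.fst ⟶ b.fst
  snd : a.snd ⟶ b.snd
  lift : ℬ.p.IsHomLift (𝒜.p.map fst) snd
  comm : F.map fst ≫ b.iso.hom = a.iso.hom ≫ G.map snd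

instance : Category (FibObj F G) where
  Hom a b := FibHom a b
  id a := ⟨𝟙 _, 𝟙 _, by rw [𝒜.p.map_id]; exact IsHomLift.id a.eq, by
    rw [F.map_id, G.map_id, Category.id_comp, Category.comp_id]⟩
  comp f g := ⟨f.fst ≫ g.fst, f.snd ≫ g.snd, by
    have := f.lift
    have := g.lift
    rw [𝒜.p.map_comp]; infer_instance, by
    rw [F.map_comp, G.map_comp, Category.assoc, g.comm, ← Category.assoc, f.comm,
      Category.assoc]⟩
  id_comp f := by apply FibHom.ext <;> exact Category.id_comp _
  comp_id f := by apply FibHom.ext <;> exact Category.comp_id _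
  assoc f g h := by apply FibHom.ext <;> exact Category.assoc _ _ _

/-- The 2-fiber product. -/
def fib (F : 𝒜 ⥤ᵇ 𝒳) (G : ℬ ⥤ᵇ 𝒳) : BasedCategory.{max v v', max u u' v''} Mfd where
  obj := FibObj F G
  p := { obj := fun (a : FibObj F G) => 𝒜.p.obj a.fst
         map := fun {a b} (f : FibHom a b) => 𝒜.p.map f.fst
         map_id := fun a => 𝒜.p.map_id _
         map_comp := fun f g => 𝒜.p.map_comp _ _ }

def fibFst (F : 𝒜 ⥤ᵇ 𝒳) (G : ℬ ⥤ᵇ 𝒳) : fib F G ⥤ᵇ 𝒜 where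
  obj := fun (a : FibObj F G) => a.fst
  map := fun {a b} (f : FibHom a b) => f.fst
  map_id _ := rfl
  map_comp _ _ := rfl
  w := rfl

def fibSnd (F : 𝒜 ⥤ᵇ 𝒳) (G : ℬ ⥤ᵇ 𝒳) : fib F G ⥤ᵇ ℬ where
  obj := fun (a : FibObj F G) => a.snd
  map := fun {a b} (f : FibHom a b) => f.snd
  map_id _ := rfl
  map_comp _ _ := rfl
  w := by
    refine CategoryTheory.Functor.ext (fun (a : FibObj F G) => a.eq)
      fun a b (f : FibHom a b) => ?_
    have := f.lift
    exact IsHomLift.fac' ℬ.p (𝒜.p.map f.fst) f.snd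

end FiberProduct

/-- `p : X₀ ⥤ᵇ 𝒳` is an atlas: for every map from a manifold `Y` to `𝒳` the fiber product
`X₀ ×_𝒳 Y` is a manifold `Z`, and the projection `Z ⟶ Y` is a surjective submersion. -/
def IsAtlas {𝒳 : BasedCategory.{v, u} Mfd} {X₀ : Mfd} (p : ofMfd X₀ ⥤ᵇ 𝒳) : Prop :=
  ∀ (Y : Mfd) (q : ofMfd Y ⥤ᵇ 𝒳), ∃ (Z : Mfd) (b : Z ⟶ Y) (e : ofMfd Z ⥤ᵇ fib p q),
    IsDiffeo e ∧ Nonempty (e.comp (fibSnd p q) ≅ ofMfdMap b) ∧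
    Manifold.IsSubmersion 𝓘(ℝ, Z.model) 𝓘(ℝ, Y.model) ∞ b.1 ∧ Function.Surjective b.1

/-- An orbifold, that is, a differentiable Deligne-Mumford stack: a stack with an atlas `X₀`
whose groupoid `X₁ = X₀ ×_𝒳 X₀ ⇉ X₀` is étale and proper. -/
structure IsOrbifold (𝒳 : BasedCategory.{v, u} Mfd) : Prop extends IsStack 𝒳 where
  exists_atlas : ∃ (X₀ : Mfd) (p : ofMfd X₀ ⥤ᵇ 𝒳), IsAtlas p ∧
    ∃ (X₁ : Mfd) (s t : X₁ ⟶ X₀) (e : ofMfd X₁ ⥤ᵇ fib p p), IsDiffeo e ∧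
      Nonempty (e.comp (fibFst p p) ≅ ofMfdMap s) ∧
      Nonempty (e.comp (fibSnd p p) ≅ ofMfdMap t) ∧
      IsLocalDiffeomorph 𝓘(ℝ, X₁.model) 𝓘(ℝ, X₀.model) ∞ s.1 ∧
      IsLocalDiffeomorph 𝓘(ℝ, X₁.model) 𝓘(ℝ, X₀.model) ∞ t.1 ∧
      IsProperMap fun g : X₁ => (s.1 g, t.1 g)

/-! ## Products -/

section Product

theorem isHomLift_map_of_isHomLift {𝒳 : BasedCategory.{v, u} Mfd} {𝒴 : BasedCategory.{v', u'} Mfd}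
    {R S : Mfd} (f : R ⟶ S) {a b : 𝒳.obj} (φ : a ⟶ b) {c d : 𝒴.obj} (ψ : c ⟶ d)
    (hφ : 𝒳.p.IsHomLift f φ) (hψ : 𝒴.p.IsHomLift f ψ) : 𝒴.p.IsHomLift (𝒳.p.map φ) ψ := by
  obtain ⟨⟩ := hφ
  exact hψ

variable {𝒜 : BasedCategory.{v, u} Mfd} {ℬ : BasedCategory.{v', u'} Mfd}

structure ProdObj (𝒜 : BasedCategory.{v, u} Mfd) (ℬ : BasedCategory.{v', u'} Mfd) where
  fst : 𝒜.obj
  snd : ℬ.obj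
  eq : ℬ.p.obj snd = 𝒜.p.obj fst

@[ext]
structure ProdHom (a b : ProdObj 𝒜 ℬ) where
  fst : a.fst ⟶ b.fst
  snd : a.snd ⟶ b.snd
  lift : ℬ.p.IsHomLift (𝒜.p.map fst) snd

instance : Category (ProdObj 𝒜 ℬ) where
  Hom a b := ProdHom a b
  id a := ⟨𝟙 _, 𝟙 _, by rw [𝒜.p.map_id]; exact IsHomLift.id a.eq⟩
  comp f g := ⟨f.fst ≫ g.fst, f.snd ≫ g.snd, by
    have := f.lift
    have := g.lift
    rw [𝒜.p.map_comp]; infer_instance⟩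
  id_comp f := by apply ProdHom.ext <;> exact Category.id_comp _
  comp_id f := by apply ProdHom.ext <;> exact Category.comp_id _
  assoc f g h := by apply ProdHom.ext <;> exact Category.assoc _ _ _

/-- The product of two stacks: pairs of objects over the same manifold. -/
def prod (𝒜 : BasedCategory.{v, u} Mfd) (ℬ : BasedCategory.{v', u'} Mfd) :
    BasedCategory.{max v v', max u u'} Mfd where
  obj := ProdObj 𝒜 ℬ
  p := { obj := fun (a : ProdObj 𝒜 ℬ) => 𝒜.p.obj a.fst
         map := fun {a b} (f : ProdHom a b) => 𝒜.p.map f.fst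
         map_id := fun a => 𝒜.p.map_id _
         map_comp := fun f g => 𝒜.p.map_comp _ _ }

def prodSnd (𝒜 : BasedCategory.{v, u} Mfd) (ℬ : BasedCategory.{v', u'} Mfd) :
    prod 𝒜 ℬ ⥤ᵇ ℬ where
  obj := fun (a : ProdObj 𝒜 ℬ) => a.snd
  map := fun {a b} (f : ProdHom a b) => f.snd
  map_id _ := rfl
  map_comp _ _ := rfl
  w := by
    refine CategoryTheory.Functor.ext (fun (a : ProdObj 𝒜 ℬ) => a.eq)
      fun a b (f : ProdHom a b) => ?_
    have := f.lift
    exact IsHomLift.fac' ℬ.p (𝒜.p.map f.fst) f.snd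

/-- The product `(F, G) : 𝒜 × ℬ ⥤ 𝒜' × ℬ'` of two maps of stacks. -/
def prodMap {𝒜' : BasedCategory.{v'', u''} Mfd} {ℬ' : BasedCategory.{v''', u'''} Mfd}
    (F : 𝒜 ⥤ᵇ 𝒜') (G : ℬ ⥤ᵇ ℬ') : prod 𝒜 ℬ ⥤ᵇ prod 𝒜' ℬ' where
  obj := fun (a : ProdObj 𝒜 ℬ) =>
    (⟨F.obj a.fst, G.obj a.snd, by rw [F.w_obj, G.w_obj, a.eq]⟩ : ProdObj 𝒜' ℬ')
  map := fun {a b} (f : ProdHom a b) => (⟨F.map f.fst, G.map f.snd, by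
    have := f.lift
    exact isHomLift_map_of_isHomLift (𝒜.p.map f.fst) _ _ inferInstance inferInstance⟩ :
    ProdHom _ _)
  map_id (a : ProdObj 𝒜 ℬ) := ProdHom.ext (F.map_id a.fst) (G.map_id a.snd)
  map_comp {a b c} (f : ProdHom a b) (g : ProdHom b c) :=
    ProdHom.ext (F.map_comp f.fst g.fst) (G.map_comp f.snd g.snd)
  w := by
    refine CategoryTheory.Functor.ext (fun (a : ProdObj 𝒜 ℬ) => F.w_obj a.fst)
      fun a b (f : ProdHom a b) => ?_
    exact IsHomLift.fac' 𝒜'.p (𝒜.p.map f.fst) (F.map f.fst)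

/-- The map `𝒜 × ℬ ⥤ 𝒜 × ℬ'`, `(a, x) ↦ (a, Γ (a, x))`, of a map `Γ : 𝒜 × ℬ ⥤ ℬ'`. -/
def graph {ℬ' : BasedCategory.{v'', u''} Mfd} (Γ : prod 𝒜 ℬ ⥤ᵇ ℬ') :
    prod 𝒜 ℬ ⥤ᵇ prod 𝒜 ℬ' where
  obj := fun (a : ProdObj 𝒜 ℬ) => (⟨a.fst, Γ.obj a, Γ.w_obj a⟩ : ProdObj 𝒜 ℬ')
  map := fun {a b : ProdObj 𝒜 ℬ} (f : ProdHom a b) =>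
    ProdHom.mk (a := ⟨a.fst, Γ.obj a, Γ.w_obj a⟩) (b := ⟨b.fst, Γ.obj b, Γ.w_obj b⟩) f.fst
      (Γ.map f) (by
        have := IsHomLift.map (p := (prod 𝒜 ℬ).p) f
        exact BasedFunctor.preserves_isHomLift Γ ((prod 𝒜 ℬ).p.map f) f)
  map_id (a : ProdObj 𝒜 ℬ) := ProdHom.ext rfl (Γ.map_id a)
  map_comp {a b c : ProdObj 𝒜 ℬ} (f : ProdHom a b) (g : ProdHom b c) :=
    ProdHom.ext rfl (Γ.map_comp f g)
  w := rfl

/-- The map `𝒜 ⥤ 𝒜 × [a, b]`, `x ↦ (x, τ)`. -/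
def insertAt (𝒜 : BasedCategory.{v, u} Mfd) (a b τ : ℝ) (h : τ ∈ Set.Icc a b) :
    𝒜 ⥤ᵇ prod 𝒜 (seg a b) where
  obj := fun x => ProdObj.mk (ℬ := seg a b) x
    (PlotObj.mk (𝒜.p.obj x) (Mfd.const (N := Mfd.line) _ τ) fun _ => h) rfl
  map := fun {x y} f => ProdHom.mk (𝒜 := 𝒜) (ℬ := seg a b)
    (a := ⟨x, PlotObj.mk (𝒜.p.obj x) (Mfd.const (N := Mfd.line) _ τ) fun _ => h, rfl⟩)
    (b := ⟨y, PlotObj.mk (𝒜.p.obj y) (Mfd.const (N := Mfd.line) _ τ) fun _ => h, rfl⟩)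
    f (PlotHom.mk (𝒜.p.map f) rfl)
    (IsHomLift.map (p := (seg a b).p)
      (a := PlotObj.mk (𝒜.p.obj x) (Mfd.const (N := Mfd.line) _ τ) fun _ => h)
      (b := PlotObj.mk (𝒜.p.obj y) (Mfd.const (N := Mfd.line) _ τ) fun _ => h)
      (PlotHom.mk (𝒜.p.map f) rfl))
  map_id x := ProdHom.ext rfl (PlotHom.ext (𝒜.p.map_id x))
  map_comp f g := ProdHom.ext rfl (PlotHom.ext (𝒜.p.map_comp f g))
  w := rfl

end Product

/-! ## Loops of diffeomorphisms and their homotopies -/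

section Loops

variable {K : BasedCategory.{0, 1} Mfd} {𝒳 : BasedCategory.{v, u} Mfd}

/-- A map `Γ : K × 𝒳 ⥤ 𝒳` is a smooth family of diffeomorphisms of `𝒳` parametrized by `K` if
`(k, x) ↦ (k, Γ (k, x))` is a diffeomorphism of `K × 𝒳`. -/
def IsDiffeoFamily (Γ : prod K 𝒳 ⥤ᵇ 𝒳) : Prop := IsDiffeo (graph Γ)

/-- The restriction of `γ : K × [a, b] × 𝒳 ⥤ 𝒳` to `K × {τ} × 𝒳`. -/
def evalAt {a b : ℝ} (γ : prod (prod K (seg a b)) 𝒳 ⥤ᵇ 𝒳) (τ : ℝ) (h : τ ∈ Set.Icc a b) :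
    prod K 𝒳 ⥤ᵇ 𝒳 :=
  (prodMap (insertAt K a b τ h) (BasedFunctor.id 𝒳)).comp γ

/-- The restriction of `γ : K × [a, b] × 𝒳 ⥤ 𝒳` to `K × [a', b'] × 𝒳`. -/
def shrink {a b a' b' : ℝ} (h : Set.Icc a' b' ⊆ Set.Icc a b)
    (γ : prod (prod K (seg a b)) 𝒳 ⥤ᵇ 𝒳) : prod (prod K (seg a' b')) 𝒳 ⥤ᵇ 𝒳 :=
  (prodMap (prodMap (BasedFunctor.id K) (segIncl h)) (BasedFunctor.id 𝒳)).comp γ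

/-- The restriction of a 2-isomorphism to `K × {τ} × 𝒳`. -/
def evalIso {a b a' b' : ℝ} {h : Set.Icc a' b' ⊆ Set.Icc a b}
    {γ' : prod (prod K (seg a' b')) 𝒳 ⥤ᵇ 𝒳} {γ : prod (prod K (seg a b)) 𝒳 ⥤ᵇ 𝒳}
    (β : γ' ≅ shrink h γ) (τ : ℝ) (hτ : τ ∈ Set.Icc a' b') :
    evalAt γ' τ hτ ≅ evalAt γ τ (h hτ) :=
  isoWhiskerLeft (prodMap (insertAt K a' b' τ hτ) (BasedFunctor.id 𝒳)) β

/-- A family, parametrized by `K`, of piecewise smooth loops of maps `𝒳 ⥤ 𝒳`: a partition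
`0 = t 0 < t 1 < ⋯ < t (n + 1) = 1`, a map `K × [t l, t (l + 1)] × 𝒳 ⥤ 𝒳` for each `l`, and
2-isomorphisms between consecutive pieces at the joints and between the two ends. -/
structure PiecewiseLoop (K : BasedCategory.{0, 1} Mfd) (𝒳 : BasedCategory.{v, u} Mfd) where
  n : ℕ
  t : Fin (n + 2) → ℝ
  strictMono : StrictMono t
  t_zero : t 0 = 0
  t_last : t (Fin.last (n + 1)) = 1
  piece : ∀ l : Fin (n + 1), prod (prod K (seg (t l.castSucc) (t l.succ))) 𝒳 ⥤ᵇ 𝒳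
  joint : ∀ l : Fin n,
    evalAt (piece l.castSucc) (t l.castSucc.succ)
        ⟨(strictMono Fin.castSucc_lt_succ).le, le_rfl⟩ ≅
      evalAt (piece l.succ) (t l.castSucc.succ)
        ⟨le_rfl, (strictMono (Fin.castSucc_lt_succ (i := l.succ))).le⟩
  close :
    evalAt (piece (Fin.last n)) (t (Fin.last (n + 1)))
        ⟨(strictMono (Fin.castSucc_lt_succ (i := Fin.last n))).le, le_rfl⟩ ≅
      evalAt (piece 0) (t 0) ⟨le_rfl, (strictMono (Fin.castSucc_lt_succ (i := 0))).le⟩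

namespace PiecewiseLoop

/-- The pieces of the loop are smooth families of diffeomorphisms. -/
def IsDiffeo (γ : PiecewiseLoop K 𝒳) : Prop := ∀ l, IsDiffeoFamily (γ.piece l)

/-- The 2-isomorphisms that a loop provides between the restrictions of its pieces to points
of the circle `[0, 1] / (0 ~ 1)`. -/
inductive Transition (γ : PiecewiseLoop K 𝒳) :
    ∀ (l : Fin (γ.n + 1)) (τ : ℝ) (h : τ ∈ Set.Icc (γ.t l.castSucc) (γ.t l.succ))
      (m : Fin (γ.n + 1)) (σ : ℝ) (h' : σ ∈ Set.Icc (γ.t m.castSucc) (γ.t m.succ)),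
      (evalAt (γ.piece l) τ h ≅ evalAt (γ.piece m) σ h') → Prop
  | refl (l : Fin (γ.n + 1)) (τ : ℝ) (h : τ ∈ Set.Icc (γ.t l.castSucc) (γ.t l.succ)) :
      Transition γ l τ h l τ h (Iso.refl _)
  | joint (l : Fin γ.n) : Transition γ l.castSucc _ _ l.succ _ _ (γ.joint l)
  | close : Transition γ (Fin.last γ.n) _ _ 0 _ _ γ.close

/-- `γ'` arises from `γ` by splitting pieces of `γ` at finitely many points (every piece `l` of
`γ'` is the restriction of the piece `r l` of `γ`, and at a splitting point the 2-isomorphism is the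
identity), followed by replacing each piece by a 2-isomorphic one, compatibly with the
2-isomorphisms at the joints and at the ends. -/
def Refines (γ' γ : PiecewiseLoop K 𝒳) : Prop :=
  ∃ (r : Fin (γ'.n + 1) → Fin (γ.n + 1))
    (h : ∀ l, Set.Icc (γ'.t l.castSucc) (γ'.t l.succ) ⊆
      Set.Icc (γ.t (r l).castSucc) (γ.t (r l).succ))
    (β : ∀ l, γ'.piece l ≅ shrink (h l) (γ.piece (r l))),
    ∀ l τ hl m σ hm θ, γ'.Transition l τ hl m σ hm θ →
      γ.Transition (r l) τ (h l hl) (r m) σ (h m hm)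
        ((evalIso (β l) τ hl).symm ≪≫ θ ≪≫ evalIso (β m) σ hm)

/-- The equivalence relation on loops of diffeomorphisms generated by splitting pieces and by
2-isomorphisms. -/
def NaturallyRelated : PiecewiseLoop K 𝒳 → PiecewiseLoop K 𝒳 → Prop :=
  Relation.EqvGen fun γ' γ => γ'.IsDiffeo ∧ γ.IsDiffeo ∧ γ'.Refines γ

/-- The member at `σ` of a family of loops parametrized by `[a, b]`. -/
def member {a b : ℝ} (Γ : PiecewiseLoop (seg a b) 𝒳) (σ : ℝ) (h : σ ∈ Set.Icc a b) :
    PiecewiseLoop pt 𝒳 where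
  n := Γ.n
  t := Γ.t
  strictMono := Γ.strictMono
  t_zero := Γ.t_zero
  t_last := Γ.t_last
  piece l := (prodMap (prodMap (ptMap Mfd.line _ σ h) (BasedFunctor.id _))
    (BasedFunctor.id 𝒳)).comp (Γ.piece l)
  joint l := isoWhiskerLeft (prodMap (ptMap Mfd.line _ σ h) (BasedFunctor.id 𝒳)) (Γ.joint l)
  close := isoWhiskerLeft (prodMap (ptMap Mfd.line _ σ h) (BasedFunctor.id 𝒳)) Γ.close

end PiecewiseLoop

theorem contMDiff_exp : ContMDiff 𝓘(ℝ, ℝ) 𝓘(ℝ, EuclideanSpace ℝ (Fin 1)) ∞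
    fun t : ℝ => Circle.exp (2 * Real.pi * t) :=
  contMDiff_circleExp.comp
    ((contDiff_const.mul contDiff_id).contMDiff : ContMDiff 𝓘(ℝ, ℝ) 𝓘(ℝ, ℝ) ∞ _)

/-- The map `exp : [0, 1] → S¹`, `t ↦ e^{2πit}`. -/
def expMap : seg 0 1 ⥤ᵇ S1 :=
  subMap (N := Mfd.line) (N' := Mfd.circle)
    ⟨fun t : ℝ => Circle.exp (2 * Real.pi * t), contMDiff_exp⟩ _ _ fun _ _ => trivial

/-- A smooth loop of diffeomorphisms of `𝒳`: a map `path : [0, 1] × 𝒳 ⥤ 𝒳` with a smooth family of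
diffeomorphisms `circle : S¹ × 𝒳 ⥤ 𝒳` and a 2-isomorphism from `path` to `circle ∘ (exp, id)`. -/
structure SmoothLoop (𝒳 : BasedCategory.{v, u} Mfd) where
  path : prod (seg 0 1) 𝒳 ⥤ᵇ 𝒳
  circle : prod S1 𝒳 ⥤ᵇ 𝒳
  comparison : path ≅ (prodMap expMap (BasedFunctor.id 𝒳)).comp circle
  isDiffeo : IsDiffeoFamily circle

namespace SmoothLoop

/-- The restriction of the loop to a subinterval. -/
def onSeg (γ : SmoothLoop 𝒳) {a b : ℝ} (h : Set.Icc a b ⊆ Set.Icc 0 1) :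
    prod (prod pt (seg a b)) 𝒳 ⥤ᵇ 𝒳 :=
  (prodMap ((prodSnd pt (seg a b)).comp (segIncl h)) (BasedFunctor.id 𝒳)).comp γ.path

/-- The 2-isomorphism between `path` at `τ` and `circle` at `exp τ`. -/
def evalComparison (γ : SmoothLoop 𝒳) {a b : ℝ} (h : Set.Icc a b ⊆ Set.Icc 0 1) (τ : ℝ)
    (hτ : τ ∈ Set.Icc a b) :
    evalAt (γ.onSeg h) τ hτ ≅
      (prodMap (ptMap Mfd.circle Set.univ (Circle.exp (2 * Real.pi * τ)) trivial)
        (BasedFunctor.id 𝒳)).comp γ.circle :=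
  isoWhiskerLeft ((prodMap (insertAt pt a b τ hτ) (BasedFunctor.id 𝒳)).comp
    (prodMap ((prodSnd pt (seg a b)).comp (segIncl h)) (BasedFunctor.id 𝒳))) γ.comparison

/-- A smooth loop as a piecewise smooth loop with one piece; the 2-isomorphism between its ends
comes from `exp 0 = exp 1`. -/
def toPiecewise (γ : SmoothLoop 𝒳) : PiecewiseLoop pt 𝒳 where
  n := 0
  t := ![0, 1]
  strictMono := by
    intro i j hij
    fin_cases i <;> fin_cases j <;> simp_all
  t_zero := rfl
  t_last := rfl
  piece l := γ.onSeg (by fin_cases l; exact subset_rfl)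
  joint l := l.elim0
  close := γ.evalComparison _ _ _ ≪≫
    eqToIso (by
      have : Circle.exp (2 * Real.pi * (![0, 1] : Fin 2 → ℝ) (Fin.last 1)) =
          Circle.exp (2 * Real.pi * (![0, 1] : Fin 2 → ℝ) 0) := by simp
      simp only [this]) ≪≫
    (γ.evalComparison _ _ _).symm

/-- Homotopy equivalence of smooth loops: there are a partition `0 = s 0 < ⋯ < s (N + 1) = 1`
and for each `k` a family of piecewise smooth loops of diffeomorphisms parametrized by
`[s k, s (k + 1)]` (with its own partition of the loop parameter), such that successive families
are naturally related at the common parameter, and the first and the last loop are naturally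
related to `γ₀` and `γ₁`. -/
def HomotopyEquivalent (γ₀ γ₁ : SmoothLoop 𝒳) : Prop :=
  ∃ (N : ℕ) (s : Fin (N + 2) → ℝ) (hs : StrictMono s)
    (Γ : ∀ k : Fin (N + 1), PiecewiseLoop (seg (s k.castSucc) (s k.succ)) 𝒳),
    s 0 = 0 ∧ s (Fin.last (N + 1)) = 1 ∧ (∀ k, (Γ k).IsDiffeo) ∧
    (∀ k : Fin N, PiecewiseLoop.NaturallyRelated
      ((Γ k.castSucc).member (s k.castSucc.succ) ⟨(hs Fin.castSucc_lt_succ).le, le_rfl⟩)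
      ((Γ k.succ).member (s k.castSucc.succ)
        ⟨le_rfl, (hs (Fin.castSucc_lt_succ (i := k.succ))).le⟩)) ∧
    PiecewiseLoop.NaturallyRelated
      ((Γ 0).member (s 0) ⟨le_rfl, (hs (Fin.castSucc_lt_succ (i := 0))).le⟩) γ₀.toPiecewise ∧
    PiecewiseLoop.NaturallyRelated
      ((Γ (Fin.last N)).member (s (Fin.last (N + 1)))
        ⟨(hs (Fin.castSucc_lt_succ (i := Fin.last N))).le, le_rfl⟩) γ₁.toPiecewise

end SmoothLoop

end Loops

/-! ## The bundle over the sphere defined by a loop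

The sphere is identified with the complex projective line by the coordinate
`z = (x₀ + i x₁) / (1 + x₂)`: the point with coordinate `z` is `[z, 1]`, and `(0, 0, -1)` is
`[1, 0]`.  Then `|z| < r` if and only if `|x₀ + i x₁| < r (1 + x₂)`, and `|1 / z| < r` if and only if
`|x₀ + i x₁| < r (1 - x₂)`. -/

section Clutching

/-- The complex number `x₀ + i x₁`. -/
def rho (x : Mfd.sphere) : ℂ := x.1 0 + x.1 1 * Complex.I

theorem continuous_rho : Continuous rho := by
  have h : Continuous fun x : Mfd.sphere => x.1 := continuous_subtype_val
  unfold rho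
  fun_prop

theorem continuous_coord (i : Fin 3) : Continuous fun x : Mfd.sphere => x.1 i := by
  have h : Continuous fun x : Mfd.sphere => x.1 := continuous_subtype_val
  fun_prop

/-- The disc `D₊ (1 + δ)`, `|z| < 1 + δ`. -/
def discPlus (δ : ℝ) : TopologicalSpace.Opens Mfd.sphere :=
  ⟨{x | ‖rho x‖ < (1 + δ) * (1 + x.1 2)}, isOpen_lt continuous_rho.norm
    (continuous_const.mul (continuous_const.add (continuous_coord 2)))⟩

/-- The disc `D₋ (1 + δ)`, `|1 / z| < 1 + δ`. -/
def discMinus (δ : ℝ) : TopologicalSpace.Opens Mfd.sphere :=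
  ⟨{x | ‖rho x‖ < (1 + δ) * (1 - x.1 2)}, isOpen_lt continuous_rho.norm
    (continuous_const.mul (continuous_const.sub (continuous_coord 2)))⟩

/-- The annulus `Ann = D₊ (1 + δ) ∩ D₋ (1 + δ)`. -/
def ann (δ : ℝ) : TopologicalSpace.Opens Mfd.sphere := discPlus δ ⊓ discMinus δ

theorem rho_ne_zero {δ : ℝ} (x : ann δ) : rho x.1 ≠ 0 := by
  intro h
  obtain ⟨h₁, h₂⟩ := x.2
  replace h₁ : ‖rho x.1‖ < (1 + δ) * (1 + x.1.1 2) := h₁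
  replace h₂ : ‖rho x.1‖ < (1 + δ) * (1 - x.1.1 2) := h₂
  have h₀ : ‖x.1.1‖ = 1 := mem_sphere_zero_iff_norm.1 x.1.2
  have hr : x.1.1 0 = 0 := by simpa [rho] using congrArg Complex.re h
  have hi : x.1.1 1 = 0 := by simpa [rho] using congrArg Complex.im h
  have h₃ : (x.1.1 2) ^ 2 = 1 := by
    have := EuclideanSpace.real_norm_sq_eq x.1.1
    rw [h₀, Fin.sum_univ_three, hr, hi] at this
    linarith
  rw [h, norm_zero] at h₁ h₂
  nlinarith [mul_pos h₁ h₂, sq_nonneg (1 + δ)]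

theorem contMDiff_rho : ContMDiff 𝓘(ℝ, Mfd.sphere.model) 𝓘(ℝ, ℂ) ∞ rho := by
  have h : ContMDiff 𝓘(ℝ, Mfd.sphere.model) 𝓘(ℝ, EuclideanSpace ℝ (Fin 3)) ∞
      fun x : Mfd.sphere => x.1 := contMDiff_coe_sphere (n := 2)
  have h' : ContDiff ℝ ∞ fun y : EuclideanSpace ℝ (Fin 3) => (y 0 : ℂ) + y 1 * Complex.I := by
    have (i : Fin 3) : ContDiff ℝ ∞ fun y : EuclideanSpace ℝ (Fin 3) => (y i : ℂ) :=
      Complex.ofRealCLM.contDiff.comp (EuclideanSpace.proj i : _ →L[ℝ] ℝ).contDiff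
    exact (this 0).add ((this 1).mul contDiff_const)
  exact h'.contMDiff.comp h

/-- The argument `z / |z|` of a point of the annulus. -/
def thetaFun (δ : ℝ) (x : ann δ) : Circle :=
  ⟨rho x.1 / ‖rho x.1‖, mem_sphere_zero_iff_norm.2 (by
    rw [norm_div, Complex.norm_real, norm_norm, div_self (norm_ne_zero_iff.2 (rho_ne_zero x))])⟩

theorem contMDiff_thetaFun (δ : ℝ) :
    ContMDiff 𝓘(ℝ, Mfd.sphere.model) 𝓘(ℝ, EuclideanSpace ℝ (Fin 1)) ∞ (thetaFun δ) := by
  have := finrank_real_complex_fact'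
  have h : ContMDiff 𝓘(ℝ, Mfd.sphere.model) 𝓘(ℝ, ℂ) ∞
      fun x : ann δ => rho x.1 / ‖rho x.1‖ := by
    intro x
    have h₁ : ContDiffAt ℝ ∞ (fun z : ℂ => z / ((‖z‖ : ℝ) : ℂ)) (rho x.1) := by
      have hx := rho_ne_zero x
      have h₂ : ContDiffAt ℝ ∞ (fun z : ℂ => ((‖z‖ : ℝ) : ℂ)) (rho x.1) :=
        Complex.ofRealCLM.contDiff.contDiffAt.comp _ (contDiffAt_norm ℝ hx)
      simp only [div_eq_mul_inv]
      exact contDiffAt_id.mul (h₂.inv (by simpa using hx))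
    exact h₁.contMDiffAt.comp x
      ((contMDiff_rho.comp contMDiff_subtype_val : ContMDiff _ _ ∞ fun x : ann δ => rho x.1) x)
  exact h.codRestrict_sphere (n := 1) fun x => (thetaFun δ x).2

/-- The map `Θ` from the annulus to the circle. -/
def theta (δ : ℝ) : Mfd.sphere.restr (ann δ) ⟶ Mfd.circle := ⟨thetaFun δ, contMDiff_thetaFun δ⟩

variable {𝒳 : BasedCategory.{v, u} Mfd}

/-- For a map `f : Z → S²` and an object `x` of `𝒳` over `f⁻¹ Ann`, the object `(Θ ∘ f, x)` of
`S¹ × 𝒳`. -/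
def annObj (δ : ℝ) {Z : Mfd} (f : Z ⟶ Mfd.sphere) (x : 𝒳.obj)
    (hx : 𝒳.p.obj x = Z.restr (Mfd.preim f (ann δ))) : ProdObj S1 𝒳 :=
  ProdObj.mk (𝒜 := S1) (PlotObj.mk (Z.restr (Mfd.preim f (ann δ)))
    (Mfd.mapRestr f (Mfd.preim f (ann δ)) (ann δ) (fun _ h => h) ≫ theta δ) fun _ => trivial) x hx

/-- For a map `h` over the sphere, the induced map of preimages of an open set of the sphere. -/
def overSphere {Z Z' : Mfd} {f : Z ⟶ Mfd.sphere} {f' : Z' ⟶ Mfd.sphere} (h : Z ⟶ Z')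
    (w : h ≫ f' = f) (U : TopologicalSpace.Opens Mfd.sphere) :
    Z.restr (Mfd.preim f U) ⟶ Z'.restr (Mfd.preim f' U) :=
  Mfd.mapRestr h _ _ fun x hx => by subst w; exact hx

/-- The arrow of `S¹ × 𝒳` given by a map `h` over the sphere and an arrow of `𝒳` over it. -/
def annHom (δ : ℝ) {Z Z' : Mfd} {f : Z ⟶ Mfd.sphere} {f' : Z' ⟶ Mfd.sphere} (h : Z ⟶ Z')
    (w : h ≫ f' = f) {x x' : 𝒳.obj} (hx : 𝒳.p.obj x = Z.restr (Mfd.preim f (ann δ)))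
    (hx' : 𝒳.p.obj x' = Z'.restr (Mfd.preim f' (ann δ))) (a : x ⟶ x')
    (ha : 𝒳.p.IsHomLift (overSphere h w (ann δ)) a) : annObj δ f x hx ⟶ annObj δ f' x' hx' :=
  ProdHom.mk (a := annObj δ f x hx) (b := annObj δ f' x' hx')
    (PlotHom.mk (a := (annObj δ f x hx).fst) (b := (annObj δ f' x' hx').fst)
      (overSphere h w (ann δ)) (by subst w; rfl)) a ha

/-- Objects over a manifold `Z = base` of the stack glued from `D₋ × 𝒳` and `D₊ × 𝒳` along the
open embeddings `em₋ (z, x) = (z, x)` and `em₊ (z, x) = (z, γ (Θ z, x))` of `Ann × 𝒳`: a smooth map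
`f : Z → S²`, objects `xm`, `xp`, `xa` of `𝒳` over the open sets `f⁻¹ D₋`, `f⁻¹ D₊`, `f⁻¹ Ann` of `Z`
(that is, together with the restrictions of `f`, objects of `D₋ × 𝒳`, `D₊ × 𝒳`, `Ann × 𝒳`) and
arrows `xa ⟶ xm`, `γ (Θ ∘ f, xa) ⟶ xp` over the inclusions of `f⁻¹ Ann`, which identify the images
of `xa` under `em₋` and `em₊` with the restrictions of `xm` and `xp`. -/
structure ClutchObj (δ : ℝ) (γ : prod S1 𝒳 ⥤ᵇ 𝒳) where
  base : Mfd
  f : base ⟶ Mfd.sphere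
  xm : 𝒳.obj
  xp : 𝒳.obj
  xa : 𝒳.obj
  xa_over : 𝒳.p.obj xa = base.restr (Mfd.preim f (ann δ))
  um : xa ⟶ xm
  um_lift : 𝒳.p.IsHomLift (Mfd.mapRestr (𝟙 base) (Mfd.preim f (ann δ))
    (Mfd.preim f (discMinus δ)) fun _ h => h.2) um
  up : γ.obj (annObj δ f xa xa_over) ⟶ xp
  up_lift : 𝒳.p.IsHomLift (Mfd.mapRestr (𝟙 base) (Mfd.preim f (ann δ))
    (Mfd.preim f (discPlus δ)) fun _ h => h.1) up

/-- Arrows of the glued stack: arrows of the base over the sphere and arrows between the three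
pieces over them that commute with the identifications. -/
@[ext]
structure ClutchHom {δ : ℝ} {γ : prod S1 𝒳 ⥤ᵇ 𝒳} (A B : ClutchObj δ γ) where
  base : A.base ⟶ B.base
  w : base ≫ B.f = A.f
  m : A.xm ⟶ B.xm
  p : A.xp ⟶ B.xp
  a : A.xa ⟶ B.xa
  m_lift : 𝒳.p.IsHomLift (overSphere base w (discMinus δ)) m
  p_lift : 𝒳.p.IsHomLift (overSphere base w (discPlus δ)) p
  a_lift : 𝒳.p.IsHomLift (overSphere base w (ann δ)) a
  comm_m : a ≫ B.um = A.um ≫ m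
  comm_p : γ.map (annHom δ base w A.xa_over B.xa_over a a_lift) ≫ B.up = A.up ≫ p

instance {δ : ℝ} {γ : prod S1 𝒳 ⥤ᵇ 𝒳} : Category (ClutchObj δ γ) where
  Hom A B := ClutchHom A B
  id A :=
    { base := 𝟙 _
      w := rfl
      m := 𝟙 _
      p := 𝟙 _
      a := 𝟙 _
      m_lift := by
        have := A.um_lift
        exact IsHomLift.id (IsHomLift.codomain_eq 𝒳.p
          (Mfd.mapRestr (𝟙 A.base) (Mfd.preim A.f (ann δ)) (Mfd.preim A.f (discMinus δ))
            fun _ h => h.2) A.um)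
      p_lift := by
        have := A.up_lift
        exact IsHomLift.id (IsHomLift.codomain_eq 𝒳.p
          (Mfd.mapRestr (𝟙 A.base) (Mfd.preim A.f (ann δ)) (Mfd.preim A.f (discPlus δ))
            fun _ h => h.1) A.up)
      a_lift := IsHomLift.id A.xa_over
      comm_m := by rw [Category.id_comp, Category.comp_id]
      comm_p := by
        rw [Category.comp_id]
        exact (congrArg (· ≫ A.up) (γ.map_id (annObj δ A.f A.xa A.xa_over))).trans
          (Category.id_comp _) }
  comp {A B C} F G :=
    { base := F.base ≫ G.base
      w := by rw [Category.assoc, G.w, F.w]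
      m := F.m ≫ G.m
      p := F.p ≫ G.p
      a := F.a ≫ G.a
      m_lift := by
        have := F.m_lift
        have := G.m_lift
        exact (inferInstance : 𝒳.p.IsHomLift (overSphere F.base F.w (discMinus δ) ≫
          overSphere G.base G.w (discMinus δ)) (F.m ≫ G.m))
      p_lift := by
        have := F.p_lift
        have := G.p_lift
        exact (inferInstance : 𝒳.p.IsHomLift (overSphere F.base F.w (discPlus δ) ≫
          overSphere G.base G.w (discPlus δ)) (F.p ≫ G.p))
      a_lift := by
        have := F.a_lift
        have := G.a_lift
        exact (inferInstance : 𝒳.p.IsHomLift (overSphere F.base F.w (ann δ) ≫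
          overSphere G.base G.w (ann δ)) (F.a ≫ G.a))
      comm_m := by rw [Category.assoc, G.comm_m, ← Category.assoc, F.comm_m, Category.assoc]
      comm_p := by
        have h := γ.map_comp (annHom δ F.base F.w A.xa_over B.xa_over F.a F.a_lift)
          (annHom δ G.base G.w B.xa_over C.xa_over G.a G.a_lift)
        refine (congrArg (· ≫ C.up) h).trans ?_
        rw [Category.assoc, G.comm_p, ← Category.assoc, F.comm_p, Category.assoc] }
  id_comp f := by apply ClutchHom.ext <;> exact Category.id_comp _
  comp_id f := by apply ClutchHom.ext <;> exact Category.comp_id _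
  assoc f g h := by apply ClutchHom.ext <;> exact Category.assoc _ _ _

/-- The total stack `ℰ_γ`. -/
def clutch (δ : ℝ) (γ : prod S1 𝒳 ⥤ᵇ 𝒳) : BasedCategory.{v, max 1 u v} Mfd where
  obj := ClutchObj δ γ
  p := { obj := fun (A : ClutchObj δ γ) => A.base
         map := fun {A B} (F : ClutchHom A B) => F.base }

/-- The projection `ℰ_γ ⥤ S²`. -/
def clutchProj (δ : ℝ) (γ : prod S1 𝒳 ⥤ᵇ 𝒳) : clutch δ γ ⥤ᵇ ofMfd Mfd.sphere where
  obj := fun (A : ClutchObj δ γ) => PlotObj.mk A.base A.f fun _ => trivial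
  map := fun {A B : ClutchObj δ γ} (F : ClutchHom A B) =>
    PlotHom.mk (a := PlotObj.mk A.base A.f fun _ => trivial)
      (b := PlotObj.mk B.base B.f fun _ => trivial) F.base F.w
  map_id _ := rfl
  map_comp _ _ := rfl
  w := rfl

end Clutching

/-- An isomorphism of orbifiber bundles: diffeomorphisms of the total spaces and of the bases that
commute with the projections (up to a 2-isomorphism). -/
structure BundleIso {ℰ₀ : BasedCategory.{v, u} Mfd} {ℬ₀ : BasedCategory.{v', u'} Mfd}
    {ℰ₁ : BasedCategory.{v'', u''} Mfd} {ℬ₁ : BasedCategory.{v''', u'''} Mfd}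
    (π₀ : ℰ₀ ⥤ᵇ ℬ₀) (π₁ : ℰ₁ ⥤ᵇ ℬ₁) where
  total : ℰ₀ ⥤ᵇ ℰ₁
  base : ℬ₀ ⥤ᵇ ℬ₁
  total_isDiffeo : IsDiffeo total
  base_isDiffeo : IsDiffeo base
  comm : total.comp π₁ ≅ π₀.comp base

end Stk

end

/-!
Two ideas carry the proof: bundles given by homotopic clutching maps are isomorphic, and piecewise
smooth loops become smooth after a reparametrization that stops at the partition points.

*Clutching.*  If the clutching maps `γ₀` and `γ₁` differ on the annulus by an automorphism of
`D₊ × 𝒳` over `D₊`, applying this automorphism over `D₊` and the identity over `D₋` is an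
isomorphism of bundles over the identity of the sphere (`bundleEquivalent_of_plus`).  For a smooth
family `F` of diffeomorphisms parametrized by `[a, b] × S¹` such an automorphism between the members
at `s` and `t` is `F (κ, Θ) ∘ F (s, Θ)⁻¹`, where `κ` is a cutoff function that is `t` on the annulus
and `s` near the centre of `D₊`.  At the centre the angle `Θ` is not defined, but where `κ = s` the
composite is isomorphic to the identity, so the two local definitions glue
(`bundleEquivalent_atParam`).

*Reparametrization.*  The pieces of a piecewise smooth loop do not fit together smoothly.  Let
`σ : S¹ ⟶ S¹` be a map that is the identity away from the partition points and that stops at each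
of them.  Near every point it stays on one side of each partition point, so that locally
`σ = exp ∘ τ` where `τ` has values in one closed interval of the partition (`exists_adapted`,
`hasCharts_of_adapted`).  Hence the composite of the loop with `σ` is defined on small plots.  Two
choices of `τ` agree or are constant at the two sides of a joint (`chart_cases`), where the
2-isomorphism of the loop compares the values.  These comparisons satisfy the cocycle condition,
since each passes through a common normal form (`exists_comparison`).  By descent the local values
glue to a smooth family of diffeomorphisms over `S¹`, a realization of the loop
(`IsStack.exists_of_charts`, `exists_realizes`, `Realizes.goodAt`).

Realizations of the same loop are isomorphic (`Realizes.nonempty_iso`), a realization of a loop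
realizes its refinements (`Realizes.of_refines`), realizations of a family of loops restrict to its
members (`Realizes.member`), and a smooth loop composed with `σ` realizes the loop
(`realizes_toPiecewise`).  Therefore naturally related loops have isomorphic realizations
(`NaturallyRelated.exists_iso`).

Given a homotopy, take one `σ` for the finitely many partition points of all loops involved.  It is
homotopic to the identity, so `γ₀` and `γ₀ ∘ σ` define isomorphic bundles, and so do the two ends of
the realization of each of the families of the homotopy; at the parameters where two families meet
the realizations are isomorphic (`bundleEquivalent_of_homotopyEquivalent`).

The fibers of `𝒳` are groupoids, so equalities of maps are replaced throughout by isomorphisms with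
explicit components.  A *vertical* arrow is one over an identity of the base; an arrow or plot is
*small* with respect to an open cover if it has values in a member of the cover.
-/

-- Objects of stacks of plots and of products are compared with their components up to definitional
-- unfolding, also in instance arguments.
attribute [reducible] Stk.plots Stk.sub Stk.ofMfd Stk.seg Stk.S1 Stk.pt Stk.coverSieve Stk.prod
  Stk.clutch Stk.annObj

noncomputable section

namespace Stk

/-! ### Fibered categories -/

section CFG

variable {𝒳 : BasedCategory.{v, u} Mfd}

theorem isHomLift_congr {R S : Mfd} {f g : R ⟶ S} (h : f = g) {a b : 𝒳.obj} {φ : a ⟶ b}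
    (hφ : 𝒳.p.IsHomLift f φ) : 𝒳.p.IsHomLift g φ := h ▸ hφ

theorem IsCFG.cart (h : IsCFG 𝒳) {R S : Mfd} (f : R ⟶ S) {y x : 𝒳.obj} (g : y ⟶ x)
    [hg : 𝒳.p.IsHomLift f g] : 𝒳.p.IsStronglyCartesian f g := by
  obtain ⟨⟩ := hg
  exact h.cartesian g

/-- Arrows of a category fibered in groupoids factor uniquely through every arrow with the same
target, over any given factorization in the base. -/
theorem IsCFG.exists_fac (h : IsCFG 𝒳) {Q R S : Mfd} (k : Q ⟶ R) (f : R ⟶ S) {z y x : 𝒳.obj}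
    (g : y ⟶ x) (hg : 𝒳.p.IsHomLift f g) (φ : z ⟶ x) (hφ : 𝒳.p.IsHomLift (k ≫ f) φ) :
    ∃ χ : z ⟶ y, 𝒳.p.IsHomLift k χ ∧ χ ≫ g = φ := by
  have := h.cart f g
  obtain ⟨χ, hχ, -⟩ := Functor.IsStronglyCartesian.universal_property 𝒳.p f g k (k ≫ f) rfl φ
  exact ⟨χ, hχ.1, hχ.2⟩

theorem IsCFG.hom_ext (h : IsCFG 𝒳) {Q R S : Mfd} (k : Q ⟶ R) (f : R ⟶ S) {z y x : 𝒳.obj}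
    (g : y ⟶ x) (hg : 𝒳.p.IsHomLift f g) {χ χ' : z ⟶ y} (hχ : 𝒳.p.IsHomLift k χ)
    (hχ' : 𝒳.p.IsHomLift k χ') (w : χ ≫ g = χ' ≫ g) : χ = χ' := by
  have := h.cart f g
  exact Functor.IsStronglyCartesian.ext 𝒳.p f g k w

theorem IsCFG.isIso (h : IsCFG 𝒳) {R : Mfd} {y x : 𝒳.obj} (g : y ⟶ x)
    (hg : 𝒳.p.IsHomLift (𝟙 R) g) : IsIso g := by
  have := h.cart (𝟙 R) g
  exact Functor.IsStronglyCartesian.isIso_of_base_isIso 𝒳.p (𝟙 R) g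

/-- Existence of pullbacks, with the base of the target given by an equation. -/
theorem IsCFG.exists_lift' (h : IsCFG 𝒳) {R S : Mfd} {x : 𝒳.obj} (hx : 𝒳.p.obj x = S)
    (f : R ⟶ S) : ∃ (y : 𝒳.obj) (g : y ⟶ x), 𝒳.p.IsHomLift f g := by
  subst hx
  exact h.exists_lift x f

theorem isHomLift_comp {R S T : Mfd} {f : R ⟶ S} {g : S ⟶ T} {a b c : 𝒳.obj} {φ : a ⟶ b}
    {ψ : b ⟶ c} (hφ : 𝒳.p.IsHomLift f φ) (hψ : 𝒳.p.IsHomLift g ψ) :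
    𝒳.p.IsHomLift (f ≫ g) (φ ≫ ψ) := inferInstance

theorem isHomLift_comp_right {R S : Mfd} {f : R ⟶ S} {a b c : 𝒳.obj} {φ : a ⟶ b}
    {ψ : b ⟶ c} (hφ : 𝒳.p.IsHomLift f φ) (hψ : 𝒳.p.IsHomLift (𝟙 S) ψ) :
    𝒳.p.IsHomLift f (φ ≫ ψ) := inferInstance

theorem isHomLift_comp_left {R S : Mfd} {f : R ⟶ S} {a b c : 𝒳.obj} {φ : a ⟶ b}
    {ψ : b ⟶ c} (hφ : 𝒳.p.IsHomLift (𝟙 R) φ) (hψ : 𝒳.p.IsHomLift f ψ) :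
    𝒳.p.IsHomLift f (φ ≫ ψ) := inferInstance

theorem isHomLift_of_eq {R S : Mfd} {f : R ⟶ S} {a b : 𝒳.obj} {φ ψ : a ⟶ b}
    (hφ : 𝒳.p.IsHomLift f φ) (h : φ = ψ) : 𝒳.p.IsHomLift f ψ := h ▸ hφ

theorem domain_eq' {R S : Mfd} {f : R ⟶ S} {a b : 𝒳.obj} {φ : a ⟶ b}
    (hf : 𝒳.p.IsHomLift f φ) : 𝒳.p.obj a = R := IsHomLift.domain_eq 𝒳.p f φ

theorem codomain_eq' {R S : Mfd} {f : R ⟶ S} {a b : 𝒳.obj} {φ : a ⟶ b}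
    (hf : 𝒳.p.IsHomLift f φ) : 𝒳.p.obj b = S := IsHomLift.codomain_eq 𝒳.p f φ

theorem base_unique {R S : Mfd} {f g : R ⟶ S} {a b : 𝒳.obj} {φ : a ⟶ b}
    (hf : 𝒳.p.IsHomLift f φ) (hg : 𝒳.p.IsHomLift g φ) : f = g := by
  rw [IsHomLift.fac 𝒳.p f φ, IsHomLift.fac 𝒳.p g φ]

theorem isHomLift_self {a b : 𝒳.obj} (φ : a ⟶ b) : 𝒳.p.IsHomLift (𝒳.p.map φ) φ := inferInstance

theorem isHomLift_map {𝒴 : BasedCategory.{v', u'} Mfd} (F : 𝒳 ⥤ᵇ 𝒴) {R S : Mfd} {f : R ⟶ S}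
    {a b : 𝒳.obj} {φ : a ⟶ b} (hφ : 𝒳.p.IsHomLift f φ) : 𝒴.p.IsHomLift f (F.map φ) :=
  inferInstance

/-- A based functor from its values on objects and arrows. -/
def mkFunctor {𝒴 : BasedCategory.{v', u'} Mfd} (obj : 𝒳.obj → 𝒴.obj)
    (map : ∀ {a b : 𝒳.obj}, (a ⟶ b) → (obj a ⟶ obj b)) (map_id : ∀ a, map (𝟙 a) = 𝟙 (obj a))
    (map_comp : ∀ {a b c : 𝒳.obj} (φ : a ⟶ b) (ψ : b ⟶ c), map (φ ≫ ψ) = map φ ≫ map ψ)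
    (lift : ∀ {a b : 𝒳.obj} (φ : a ⟶ b), 𝒴.p.IsHomLift (𝒳.p.map φ) (map φ)) : 𝒳 ⥤ᵇ 𝒴 where
  obj := obj
  map := map
  map_id := map_id
  map_comp := map_comp
  w := by
    refine CategoryTheory.Functor.ext (fun a => ?_) fun a b φ => ?_
    · exact domain_eq' (lift (𝟙 a))
    · have := lift φ
      exact IsHomLift.fac' 𝒴.p (𝒳.p.map φ) (map φ)

/-- Vertical arrows that commute with all arrows form an isomorphism of based functors. -/
theorem IsCFG.nonempty_iso {𝒴 : BasedCategory.{v', u'} Mfd} (h : IsCFG 𝒴) {F G : 𝒳 ⥤ᵇ 𝒴}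
    (η : ∀ a, F.obj a ⟶ G.obj a) (hη : ∀ a, 𝒴.p.IsHomLift (𝟙 (𝒳.p.obj a)) (η a))
    (nat : ∀ {a b : 𝒳.obj} (φ : a ⟶ b), F.map φ ≫ η b = η a ≫ G.map φ) :
    ∃ e : F ≅ G, ∀ a, e.hom.app a = η a := by
  have (a : 𝒳.obj) : IsIso (η a) := h.isIso _ (hη a)
  exact ⟨BasedNatIso.mkNatIso (NatIso.ofComponents (fun a => asIso (η a)) nat) hη, fun a => rfl⟩

end CFG

/-! ### Gluing of arrows and of objects in a stack -/

section Gluing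

variable {𝒳 : BasedCategory.{v, u} Mfd}

/-- A choice of pullbacks of an object `y` along the smooth maps into `M`, composed with
`k : M ⟶ N`, is a map of stacks `M ⥤ 𝒳`. -/
theorem IsCFG.exists_pull (h : IsCFG 𝒳) {M N : Mfd} (k : M ⟶ N) {y : 𝒳.obj}
    (hy : 𝒳.p.obj y = N) :
    ∃ (Y : ofMfd M ⥤ᵇ 𝒳) (e : ∀ a, Y.obj a ⟶ y), (∀ a, 𝒳.p.IsHomLift (a.map ≫ k) (e a)) ∧
      ∀ {a b : (ofMfd M).obj} (φ : a ⟶ b), Y.map φ ≫ e b = e a := by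
  choose Y e he using fun a : (ofMfd M).obj => h.exists_lift' hy (a.map ≫ k)
  have ex {a b : (ofMfd M).obj} (φ : a ⟶ b) : ∃ χ : Y a ⟶ Y b,
      𝒳.p.IsHomLift φ.hom χ ∧ χ ≫ e b = e a :=
    h.exists_fac φ.hom (b.map ≫ k) _ (he b) _
      (isHomLift_congr (by rw [← Category.assoc, φ.w]) (he a))
  choose χ hχ hχ' using @ex
  refine ⟨mkFunctor Y χ (fun a => ?_) (fun {a b c} φ ψ => ?_) hχ, e, he, hχ'⟩
  · exact h.hom_ext (𝟙 _) _ _ (he a) (hχ (𝟙 a)) (IsHomLift.id (domain_eq' (he a)))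
      (by rw [hχ', Category.id_comp])
  · exact h.hom_ext _ _ _ (he c) (hχ (φ ≫ ψ)) (isHomLift_comp (hχ φ) (hχ ψ))
      (by rw [hχ', Category.assoc, hχ', hχ'])

/-- An open cover of a manifold. -/
def IsCover {M : Mfd} {ι : Type} (U : ι → TopologicalSpace.Opens M) : Prop := ∀ x, ∃ i, x ∈ U i

/-- A smooth map has values in a member of the family of open sets. -/
def Small {M : Mfd} {ι : Type} (U : ι → TopologicalSpace.Opens M) {R : Mfd} (g : R ⟶ M) : Prop :=
  ∃ i, ∀ z, g.1 z ∈ U i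

/-- Descent for arrows, uniqueness: two arrows out of `x` over the same smooth map agree if their
restrictions along the small maps into the base of `x` agree. -/
theorem IsStack.hom_ext (h : IsStack 𝒳) {M N : Mfd} {x y : 𝒳.obj} (k : M ⟶ N) {ι : Type}
    {U : ι → TopologicalSpace.Opens M} (hU : IsCover U) {ψ ψ' : x ⟶ y}
    (hψ : 𝒳.p.IsHomLift k ψ) (hψ' : 𝒳.p.IsHomLift k ψ')
    (H : ∀ {R : Mfd} (g : R ⟶ M), Small U g →
      ∃ (x' : 𝒳.obj) (c : x' ⟶ x), 𝒳.p.IsHomLift g c ∧ c ≫ ψ = c ≫ ψ') : ψ = ψ' := by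
  have hx : 𝒳.p.obj x = M := IsHomLift.domain_eq 𝒳.p k ψ
  have hy : 𝒳.p.obj y = N := IsHomLift.codomain_eq 𝒳.p k ψ
  have h₀ := h.toIsCFG
  obtain ⟨X, e, he, hX⟩ := h₀.exists_pull (𝟙 M) hx
  obtain ⟨Y, e', he', hY⟩ := h₀.exists_pull k hy
  -- the natural transformation between the functors of pullbacks that an arrow induces
  have key (ψ : x ⟶ y) (hψ : 𝒳.p.IsHomLift k ψ) : ∃ η : X ⟶ Y,
      ∀ a, η.app a ≫ e' a = e a ≫ ψ := by
    have ex (a : (ofMfd M).obj) : ∃ χ : X.obj a ⟶ Y.obj a,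
        𝒳.p.IsHomLift (𝟙 a.dom) χ ∧ χ ≫ e' a = e a ≫ ψ :=
      h₀.exists_fac (𝟙 _) _ _ (he' a) _
        (isHomLift_congr (by simp) (isHomLift_comp (he a) hψ))
    choose χ hχ hχ' using ex
    refine ⟨⟨⟨χ, fun a b φ => ?_⟩, hχ⟩, hχ'⟩
    have h₁ : 𝒳.p.IsHomLift φ.hom (X.map φ) := isHomLift_map X (isHomLift_self φ)
    have h₂ : 𝒳.p.IsHomLift φ.hom (Y.map φ) := isHomLift_map Y (isHomLift_self φ)
    refine h₀.hom_ext φ.hom _ _ (he' b)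
      (isHomLift_comp_right h₁ (hχ b)) (isHomLift_comp_left (hχ a) h₂) ?_
    rw [Category.assoc, Category.assoc, hχ' b, hY, hχ' a, ← Category.assoc, hX]
  obtain ⟨η, hη⟩ := key ψ hψ
  obtain ⟨η', hη'⟩ := key ψ' hψ'
  have := h.descent M U hU
  have w : η = η' := by
    apply (precomp (coverIncl M U) 𝒳).map_injective
    apply BasedNatTrans.homCategory.ext
    apply NatTrans.ext
    funext a
    obtain ⟨x', c, hc, hcc⟩ := H a.map a.mem
    obtain ⟨b, hb⟩ : ∃ b : (ofMfd M).obj, b = (coverIncl M U).obj a := ⟨_, rfl⟩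
    have hab : (⟨a.dom, a.map, fun _ => trivial⟩ : (ofMfd M).obj) = b := hb.symm
    show η.app ((coverIncl M U).obj a) = η'.app ((coverIncl M U).obj a)
    rw [← hb]
    refine h₀.hom_ext (𝟙 b.dom) _ _ (he' b) (η.isHomLift' b) (η'.isHomLift' b) ?_
    rw [hη, hη']
    subst hab
    obtain ⟨d, -, hd'⟩ := h₀.exists_fac (𝟙 _) a.map c hc (e ⟨a.dom, a.map, fun _ => trivial⟩)
      (isHomLift_congr (f := a.map ≫ 𝟙 M) (by simp) (he ⟨a.dom, a.map, fun _ => trivial⟩))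
    rw [← hd', Category.assoc, Category.assoc, hcc]
  -- the plot given by the identity
  let o : (ofMfd M).obj := ⟨M, 𝟙 M, fun _ => trivial⟩
  have : IsIso (e o) := h₀.isIso _ (he o)
  rw [← cancel_epi (e o), ← hη, ← hη', w]

/-- Gluing of arrows.  Let `c i : X i ⟶ x` be arrows such that every sufficiently small arrow
into the base of `x` underlies one of them.  Compatible arrows `s i : X i ⟶ y` come from an arrow
`x ⟶ y`. -/
theorem IsStack.glue_hom (h : IsStack 𝒳) {M N : Mfd} {x y : 𝒳.obj} (hx : 𝒳.p.obj x = M)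
    (hy : 𝒳.p.obj y = N) (k : M ⟶ N) {ι : Type} {U : ι → TopologicalSpace.Opens M}
    (hU : IsCover U) {I : Type*} (X : I → 𝒳.obj) (R : I → Mfd) (g : ∀ i, R i ⟶ M)
    (c : ∀ i, X i ⟶ x) (hc : ∀ i, 𝒳.p.IsHomLift (g i) (c i)) (s : ∀ i, X i ⟶ y)
    (hs : ∀ i, 𝒳.p.IsHomLift (g i ≫ k) (s i))
    (nat : ∀ i j (q : R i ⟶ R j) (d : X i ⟶ X j), 𝒳.p.IsHomLift q d → d ≫ c j = c i →
      d ≫ s j = s i)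
    (H : ∀ {R' : Mfd} (g' : R' ⟶ M), Small U g' → ∃ i, 𝒳.p.IsHomLift g' (c i)) :
    ∃ ψ : x ⟶ y, 𝒳.p.IsHomLift k ψ ∧ ∀ i, Small U (g i) → c i ≫ ψ = s i := by
  have h₀ := h.toIsCFG
  have hs' {R' : Mfd} {g' : R' ⟶ M} {i} (hi : 𝒳.p.IsHomLift g' (c i)) :
      𝒳.p.IsHomLift (g' ≫ k) (s i) := by
    have e₁ : 𝒳.p.obj (X i) = R' := IsHomLift.domain_eq 𝒳.p g' (c i)
    have := hc i
    have e₂ : 𝒳.p.obj (X i) = R i := IsHomLift.domain_eq 𝒳.p (g i) (c i)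
    obtain rfl : R i = R' := e₂.symm.trans e₁
    rw [base_unique hi (hc i)]
    exact hs i
  obtain ⟨A, e, he, hA⟩ := h₀.exists_pull (𝟙 M) hx
  obtain ⟨B, e', he', hB⟩ := h₀.exists_pull k hy
  choose i hi using @H
  have ex (a : (coverSieve M U).obj) : ∃ t : A.obj ((coverIncl M U).obj a) ⟶ X (i a.map a.mem),
      𝒳.p.IsHomLift (𝟙 a.dom) t ∧
        t ≫ c (i a.map a.mem) = e ((coverIncl M U).obj a) :=
    h₀.exists_fac (𝟙 _) a.map _ (hi a.map a.mem) _ (isHomLift_congr (by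
      rw [Category.id_comp]; exact Category.comp_id _) (he ((coverIncl M U).obj a)))
  choose t ht ht' using ex
  have ex' (a : (coverSieve M U).obj) :
      ∃ η : A.obj ((coverIncl M U).obj a) ⟶ B.obj ((coverIncl M U).obj a),
        𝒳.p.IsHomLift (𝟙 a.dom) η ∧
        η ≫ e' ((coverIncl M U).obj a) = t a ≫ s (i a.map a.mem) :=
    h₀.exists_fac (𝟙 a.dom) (a.map ≫ k) _ (he' ((coverIncl M U).obj a)) _
      (isHomLift_comp (ht a) (hs' (hi a.map a.mem)))
  choose η hη hη' using ex'
  have hn {a b : (coverSieve M U).obj} (φ : a ⟶ b) :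
      A.map ((coverIncl M U).map φ) ≫ η b = η a ≫ B.map ((coverIncl M U).map φ) := by
    have h₁ : 𝒳.p.IsHomLift φ.hom (A.map ((coverIncl M U).map φ)) :=
      isHomLift_map A (isHomLift_self ((coverIncl M U).map φ))
    have h₂ : 𝒳.p.IsHomLift φ.hom (B.map ((coverIncl M U).map φ)) :=
      isHomLift_map B (isHomLift_self ((coverIncl M U).map φ))
    refine h₀.hom_ext φ.hom _ _ (he' ((coverIncl M U).obj b))
      (isHomLift_comp_right h₁ (hη b)) (isHomLift_comp_left (hη a) h₂) ?_
    rw [Category.assoc, Category.assoc, hη' b, hB, hη' a]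
    have := h₀.isIso _ (ht a)
    have := ht a
    rw [← IsIso.inv_comp_eq, ← Category.assoc, ← Category.assoc]
    have l : 𝒳.p.IsHomLift φ.hom ((inv (t a) ≫ A.map ((coverIncl M U).map φ)) ≫ t b) :=
      isHomLift_comp_right (isHomLift_comp_left inferInstance h₁) (ht b)
    have e₁ : R (i a.map a.mem) = a.dom :=
      (domain_eq' (hc (i a.map a.mem))).symm.trans (domain_eq' (hi a.map a.mem))
    have e₂ : R (i b.map b.mem) = b.dom :=
      (domain_eq' (hc (i b.map b.mem))).symm.trans (domain_eq' (hi b.map b.mem))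
    refine nat _ _ (eqToHom e₁ ≫ φ.hom ≫ eqToHom e₂.symm) _ inferInstance ?_
    rw [Category.assoc, ht' b, Category.assoc, hA, ← ht' a, IsIso.inv_hom_id_assoc]
  have := h.descent M U hU
  obtain ⟨ρ, hρ⟩ := (precomp (coverIncl M U) 𝒳).map_surjective
    (X := A) (Y := B) ⟨⟨η, fun a b φ => hn φ⟩, hη⟩
  have hρ' (a : (coverSieve M U).obj) : ρ.app ((coverIncl M U).obj a) = η a := by
    have := congrArg (fun θ => BasedNatTrans.toNatTrans θ) hρ
    exact congrArg (fun θ => NatTrans.app θ a) this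
  let o : (ofMfd M).obj := ⟨M, 𝟙 M, fun _ => trivial⟩
  have : IsIso (e o) := h₀.isIso _ (he o)
  have l₁ : 𝒳.p.IsHomLift (𝟙 M) (e o) := isHomLift_congr (by exact Category.comp_id _) (he o)
  have l₂ : 𝒳.p.IsHomLift (𝟙 M) (ρ.app o) := ρ.isHomLift' o
  have l₃ : 𝒳.p.IsHomLift k (e' o) := isHomLift_congr (by exact Category.id_comp _) (he' o)
  refine ⟨inv (e o) ≫ ρ.app o ≫ e' o, inferInstance, fun j hj => ?_⟩
  let a : (coverSieve M U).obj := ⟨R j, g j, hj⟩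
  let φ : (coverIncl M U).obj a ⟶ o := (⟨g j, rfl⟩ : PlotHom _ _)
  obtain ⟨u, hu, hu'⟩ := h₀.exists_fac (𝟙 _) (g j ≫ 𝟙 M) _ (he ((coverIncl M U).obj a)) (c j)
    (isHomLift_congr (by simp) (hc j))
  rw [← hu', ← hA φ]
  simp only [Category.assoc, IsIso.hom_inv_id_assoc]
  have n : A.map φ ≫ ρ.app o = ρ.app ((coverIncl M U).obj a) ≫ B.map φ := ρ.naturality φ
  rw [reassoc_of% n, hB φ, hρ', hη', ← Category.assoc]
  have e₁ : R j = R (i a.map a.mem) :=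
    (domain_eq' (hi a.map a.mem)).symm.trans (domain_eq' (hc (i a.map a.mem)))
  have := ht a
  refine nat j _ (eqToHom e₁) _ ?_ ?_
  · exact isHomLift_congr (f := (𝟙 (R j) ≫ 𝟙 _) ≫ eqToHom e₁) (by simp) inferInstance
  · rw [Category.assoc, ht', hu']

/-- Gluing of objects: a functor on the sieve of an open cover has a cocone. -/
theorem IsStack.glue_obj (h : IsStack 𝒳) {M : Mfd} {ι : Type} {U : ι → TopologicalSpace.Opens M}
    (hU : IsCover U) (D : coverSieve M U ⥤ᵇ 𝒳) :
    ∃ (y : 𝒳.obj) (s : ∀ a, D.obj a ⟶ y), 𝒳.p.obj y = M ∧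
      (∀ a : (coverSieve M U).obj, 𝒳.p.IsHomLift a.map (s a)) ∧
      ∀ {a b : (coverSieve M U).obj} (φ : a ⟶ b), D.map φ ≫ s b = s a := by
  have := h.descent M U hU
  let X := (precomp (coverIncl M U) 𝒳).objPreimage D
  let e : (coverIncl M U).comp X ≅ D := (precomp (coverIncl M U) 𝒳).objObjPreimageIso D
  let o : (ofMfd M).obj := ⟨M, 𝟙 M, fun _ => trivial⟩
  let φ (a) : (coverIncl M U).obj a ⟶ o := (⟨a.map, rfl⟩ : PlotHom _ _)
  have hφ (a) : (ofMfd M).p.IsHomLift a.map (φ a) :=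
    IsHomLift.map (p := (ofMfd M).p) (φ a)
  obtain ⟨t, ht, hn⟩ : ∃ t : ∀ a, D.obj a ⟶ X.obj ((coverIncl M U).obj a),
      (∀ a : (coverSieve M U).obj, 𝒳.p.IsHomLift (𝟙 a.dom) (t a)) ∧
      ∀ {a b : (coverSieve M U).obj} (ψ : a ⟶ b),
        D.map ψ ≫ t b = t a ≫ X.map ((coverIncl M U).map ψ) :=
    ⟨fun a => e.inv.app a, e.inv.isHomLift', fun ψ => e.inv.naturality ψ⟩
  refine ⟨X.obj o, fun a => t a ≫ X.map (φ a), X.w_obj o, fun a => ?_, fun {a b} ψ => ?_⟩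
  · exact isHomLift_comp_left (ht a) (isHomLift_map X (hφ a))
  · have : (coverIncl M U).map ψ ≫ φ b = φ a := PlotHom.ext ψ.w
    rw [← Category.assoc, hn, Category.assoc, ← X.map_comp, this]

/-- Over the empty manifold, which the empty family covers, every two objects are joined by an
arrow. -/
theorem IsStack.exists_of_isEmpty (h : IsStack 𝒳) {M N : Mfd} [IsEmpty M] {x y : 𝒳.obj}
    (hx : 𝒳.p.obj x = M) (hy : 𝒳.p.obj y = N) (k : M ⟶ N) :
    ∃ ψ : x ⟶ y, 𝒳.p.IsHomLift k ψ := by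
  obtain ⟨ψ, hψ, -⟩ := h.glue_hom hx hy k (U := fun i : Empty => i.elim)
    (fun x : M => isEmptyElim x) (I := Empty) (fun i => i.elim) (fun i => i.elim)
    (fun i => i.elim) (fun i => i.elim) (fun i => i.elim) (fun i => i.elim) (fun i => i.elim)
    (fun i => i.elim) (fun _ h => h.choose.elim)
  exact ⟨ψ, hψ⟩

theorem IsStack.eq_of_isEmpty (h : IsStack 𝒳) {M N : Mfd} [IsEmpty M] {x y : 𝒳.obj}
    {k : M ⟶ N} {ψ ψ' : x ⟶ y} (hψ : 𝒳.p.IsHomLift k ψ) (hψ' : 𝒳.p.IsHomLift k ψ') : ψ = ψ' :=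
  h.hom_ext k (U := fun i : Empty => i.elim) (fun x : M => isEmptyElim x) hψ hψ'
    fun _ h => h.choose.elim

end Gluing

/-! ### Functors and isomorphisms defined locally -/

section Dense

variable {𝒜 : BasedCategory.{v', u'} Mfd} {𝒳 : BasedCategory.{v, u} Mfd}

theorem Small.of_eq {M : Mfd} {ι : Type} {U : ι → TopologicalSpace.Opens M} {R : Mfd}
    {f g : R ⟶ M} (hf : Small U f) (h : f = g) : Small U g := h ▸ hf

/-- The common refinement of a cover of `M` and of the preimage of a cover of `N`. -/
def interCover {M N : Mfd} {ι κ : Type} (U : ι → TopologicalSpace.Opens M) (k : M ⟶ N)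
    (V : κ → TopologicalSpace.Opens N) : ι × κ → TopologicalSpace.Opens M :=
  fun i => U i.1 ⊓ Mfd.preim k (V i.2)

theorem IsCover.inter {M N : Mfd} {ι κ : Type} {U : ι → TopologicalSpace.Opens M}
    (hU : IsCover U) (k : M ⟶ N) {V : κ → TopologicalSpace.Opens N} (hV : IsCover V) :
    IsCover (interCover U k V) := fun x =>
  ⟨((hU x).choose, (hV (k.1 x)).choose), (hU x).choose_spec, (hV (k.1 x)).choose_spec⟩

theorem Small.left {M N : Mfd} {ι κ : Type} {U : ι → TopologicalSpace.Opens M} {k : M ⟶ N}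
    {V : κ → TopologicalSpace.Opens N} {R : Mfd} {g : R ⟶ M} (h : Small (interCover U k V) g) :
    Small U g := ⟨h.choose.1, fun z => (h.choose_spec z).1⟩

theorem Small.right {M N : Mfd} {ι κ : Type} {U : ι → TopologicalSpace.Opens M} {k : M ⟶ N}
    {V : κ → TopologicalSpace.Opens N} {R : Mfd} {g : R ⟶ M} (h : Small (interCover U k V) g) :
    Small V (g ≫ k) := ⟨h.choose.2, fun z => (h.choose_spec z).2⟩

/-- A family of objects `J w` is dense if every object is covered by members of the family. -/
def IsDense {W : Type*} (J : W → 𝒜.obj) : Prop :=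
  ∀ a, ∃ (ι : Type) (U : ι → TopologicalSpace.Opens (𝒜.p.obj a)), IsCover U ∧
    ∀ {R : Mfd} (g : R ⟶ 𝒜.p.obj a), Small U g → ∃ (w : W) (e : J w ⟶ a), 𝒜.p.IsHomLift g e

theorem small_map {a b : 𝒜.obj} {R : Mfd} {g : R ⟶ 𝒜.p.obj b} {e : a ⟶ b}
    {ι : Type} {U : ι → TopologicalSpace.Opens (𝒜.p.obj b)}
    (he : 𝒜.p.IsHomLift g e) (hg : Small U g) : Small U (𝒜.p.map e) := by
  obtain rfl : 𝒜.p.obj a = R := domain_eq' he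
  rwa [base_unique (isHomLift_self e) he]

variable {W : Type*} {J : W → 𝒜.obj}

/-- A vertical isomorphism of functors into a stack may be given on a dense family of objects. -/
theorem IsStack.nonempty_iso_of_dense (h : IsStack 𝒳) (h' : IsCFG 𝒜) (hJ : IsDense J)
    {F F' : 𝒜 ⥤ᵇ 𝒳} (η : ∀ w, F.obj (J w) ⟶ F'.obj (J w))
    (hη : ∀ w, 𝒳.p.IsHomLift (𝟙 (𝒜.p.obj (J w))) (η w))
    (nat : ∀ {w w'} (φ : J w ⟶ J w'), F.map φ ≫ η w' = η w ≫ F'.map φ) : Nonempty (F ≅ F') := by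
  have h₀ := h.toIsCFG
  choose ι U hU H using hJ
  -- the component at `a`, glued from the components at the members of the family over `a`
  have ex (a : 𝒜.obj) : ∃ τ : F.obj a ⟶ F'.obj a, 𝒳.p.IsHomLift (𝟙 (𝒜.p.obj a)) τ ∧
      ∀ i : (Σ w, J w ⟶ a), Small (U a) (𝒜.p.map i.2) →
        F.map i.2 ≫ τ = η i.1 ≫ F'.map i.2 := by
    refine h.glue_hom (F.w_obj a) (F'.w_obj a) (𝟙 _) (hU a)
      (fun i : (Σ w, J w ⟶ a) => F.obj (J i.1))
      (fun i => 𝒜.p.obj (J i.1)) (fun i => 𝒜.p.map i.2) (fun i => F.map i.2)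
      (fun i => isHomLift_map F (isHomLift_self _)) (fun i => η i.1 ≫ F'.map i.2)
      (fun i => isHomLift_congr (by simp)
        (isHomLift_comp_left (hη i.1) (isHomLift_map F' (isHomLift_self i.2)))) ?_ ?_
    · rintro ⟨w, e⟩ ⟨w', e'⟩ q d hq hd
      have e₁ : 𝒜.p.map e = q ≫ 𝒜.p.map e' :=
        base_unique (isHomLift_map F (isHomLift_self e))
          (isHomLift_of_eq (isHomLift_comp hq (isHomLift_map F (isHomLift_self e'))) hd)
      obtain ⟨u, hu, hu'⟩ := h'.exists_fac q _ e' (isHomLift_self e') e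
        (isHomLift_congr e₁ (isHomLift_self e))
      obtain rfl : d = F.map u := h₀.hom_ext q _ _ (isHomLift_map F (isHomLift_self e')) hq
        (isHomLift_map F hu) (by rw [← F.map_comp, hu']; exact hd)
      dsimp only
      rw [← Category.assoc, nat, Category.assoc, ← F'.map_comp, hu']
    · intro R g hg
      obtain ⟨w, e, he⟩ := H a g hg
      exact ⟨⟨w, e⟩, isHomLift_map F he⟩
  choose τ hτ hτ' using ex
  refine ⟨(h₀.nonempty_iso τ hτ fun {a b} φ => ?_).choose⟩
  refine h.hom_ext (𝒜.p.map φ) ((hU a).inter (𝒜.p.map φ) (hU b))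
    (isHomLift_comp_right (isHomLift_map F (isHomLift_self φ)) (hτ b))
    (isHomLift_comp_left (hτ a) (isHomLift_map F' (isHomLift_self φ))) fun {R} g hg => ?_
  obtain ⟨w, e, he⟩ := H a g hg.left
  refine ⟨_, F.map e, isHomLift_map F he, ?_⟩
  have h₁ := hτ' b ⟨w, e ≫ φ⟩ (by
    rw [𝒜.p.map_comp]
    exact (small_map he hg).right)
  have h₂ := hτ' a ⟨w, e⟩ (small_map he hg.left)
  dsimp only at h₁ h₂
  rw [← Category.assoc, ← F.map_comp, h₁, ← Category.assoc, h₂, Category.assoc, F'.map_comp]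

/-- A functor into a stack may be given on a dense family of objects and all arrows between
them. -/
theorem IsStack.exists_extension (h : IsStack 𝒳) (h' : IsCFG 𝒜) (hJ : IsDense J)
    (obj : W → 𝒳.obj) (map : ∀ {w w'}, (J w ⟶ J w') → (obj w ⟶ obj w'))
    (lift : ∀ {w w'} (φ : J w ⟶ J w'), 𝒳.p.IsHomLift (𝒜.p.map φ) (map φ))
    (map_id : ∀ w, map (𝟙 (J w)) = 𝟙 _)
    (map_comp : ∀ {w w' w''} (φ : J w ⟶ J w') (ψ : J w' ⟶ J w''),
      map (φ ≫ ψ) = map φ ≫ map ψ) :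
    ∃ (F : 𝒜 ⥤ᵇ 𝒳) (η : ∀ w, F.obj (J w) ⟶ obj w),
      (∀ w, 𝒳.p.IsHomLift (𝟙 (𝒜.p.obj (J w))) (η w)) ∧
      ∀ {w w'} (φ : J w ⟶ J w'), F.map φ ≫ η w' = η w ≫ map φ := by
  have h₀ := h.toIsCFG
  have lift' {w w'} (φ : J w ⟶ J w') {R S : Mfd} {f : R ⟶ S} (hφ : 𝒜.p.IsHomLift f φ) :
      𝒳.p.IsHomLift f (map φ) := by
    obtain ⟨⟩ := hφ
    exact lift φ
  choose ι U hU H using hJ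
  -- every object is, locally, the vertex of a cocone on the dense family
  have cocone (a : 𝒜.obj) : ∃ (y : 𝒳.obj) (S : ∀ w (e : J w ⟶ a), Small (U a) (𝒜.p.map e) →
      (obj w ⟶ y)), 𝒳.p.obj y = 𝒜.p.obj a ∧
      (∀ w e he, 𝒳.p.IsHomLift (𝒜.p.map e) (S w e he)) ∧
      ∀ w w' (u : J w ⟶ J w') (e : J w ⟶ a) (e' : J w' ⟶ a) he he', u ≫ e' = e →
        map u ≫ S w' e' he' = S w e he := by
    -- Choose for each small plot an arrow from a member of the family over it; the prescribed
    -- values on the chosen members form a functor on the sieve.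
    choose w e he using fun b : (coverSieve _ (U a)).obj => H a b.map b.mem
    have ex {b c : (coverSieve _ (U a)).obj} (φ : b ⟶ c) : ∃ u : J (w b) ⟶ J (w c),
        𝒜.p.IsHomLift φ.hom u ∧ u ≫ e c = e b :=
      h'.exists_fac φ.hom _ _ (he c) _ (isHomLift_congr φ.w.symm (he b))
    choose u hu hu' using @ex
    obtain ⟨y, s, hy, hs, hs'⟩ := h.glue_obj (hU a) (mkFunctor (fun b => obj (w b))
      (fun {b c} φ => map (u φ))
      (fun b => by
        rw [← map_id]
        congr 1
        exact h'.hom_ext (𝟙 _) _ _ (he b) (hu (𝟙 b)) (IsHomLift.id (domain_eq' (he b)))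
          (by rw [hu', Category.id_comp]))
      (fun {b c d} φ ψ => by
        rw [← map_comp]
        congr 1
        exact h'.hom_ext (φ.hom ≫ ψ.hom) _ _ (he d) (hu (φ ≫ ψ)) (isHomLift_comp (hu φ) (hu ψ))
          (by rw [hu', Category.assoc, hu', hu']))
      (fun {b c} φ => lift' _ (hu φ)))
    let pl (w' : W) (e' : J w' ⟶ a) (h : Small (U a) (𝒜.p.map e')) :
      (coverSieve _ (U a)).obj := ⟨𝒜.p.obj (J w'), 𝒜.p.map e', h⟩
    have ex' (w' : W) (e' : J w' ⟶ a) (h : Small (U a) (𝒜.p.map e')) :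
        ∃ v : J w' ⟶ J (w (pl w' e' h)), 𝒜.p.IsHomLift (𝟙 _) v ∧ v ≫ e (pl w' e' h) = e' :=
      h'.exists_fac (𝟙 _) _ _ (he (pl w' e' h)) e' (isHomLift_congr (by
        exact (Category.id_comp _).symm) (isHomLift_self e'))
    choose v hv hv' using ex'
    replace hs : ∀ b : (coverSieve _ (U a)).obj, ∃ t : obj (w b) ⟶ y, t = s b ∧
      𝒳.p.IsHomLift b.map t := fun b => ⟨s b, rfl, hs b⟩
    choose t ht ht' using hs
    replace hs' {b c : (coverSieve _ (U a)).obj} (φ : b ⟶ c) : map (u φ) ≫ t c = t b := by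
      rw [ht b, ht c]
      exact hs' φ
    refine ⟨y, fun w' e' h => map (v w' e' h) ≫ t (pl w' e' h), hy, fun w' e' h => ?_, ?_⟩
    · exact isHomLift_comp_left (lift' _ (hv w' e' h)) (ht' (pl w' e' h))
    · rintro w₁ w₂ k e₁ e₂ h₁ h₂ rfl
      let φ : pl w₁ _ h₁ ⟶ pl w₂ e₂ h₂ :=
        (⟨𝒜.p.map k, (𝒜.p.map_comp _ _).symm⟩ : PlotHom _ _)
      dsimp only
      rw [← hs' φ, ← Category.assoc, ← Category.assoc, ← map_comp, ← map_comp]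
      congr 2
      refine h'.hom_ext (𝒜.p.map k) _ _ (he (pl w₂ e₂ h₂))
        (isHomLift_comp_right (isHomLift_self k) (hv _ _ _))
        (isHomLift_comp_left (hv _ _ _) (hu φ)) ?_
      rw [Category.assoc, Category.assoc, hv', hu', hv']
  choose y S hy hS hS' using cocone
  have hSc {a : 𝒜.obj} {w : W} {e e' : J w ⟶ a} (he : Small (U a) (𝒜.p.map e))
      (he' : Small (U a) (𝒜.p.map e')) (hee : e = e') : S a w e he = S a w e' he' := by
    subst hee
    rfl
  -- the arrows between the vertices, determined by the cocones
  have exMap {a b : 𝒜.obj} (φ : a ⟶ b) : ∃ ψ : y a ⟶ y b, 𝒳.p.IsHomLift (𝒜.p.map φ) ψ ∧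
      ∀ w (e : J w ⟶ a) (h₁ : Small (U a) (𝒜.p.map e)) (h₂ : Small (U b) (𝒜.p.map (e ≫ φ))),
        S a w e h₁ ≫ ψ = S b w (e ≫ φ) h₂ := by
    refine Exists.imp (fun ψ hψ => ?_) (h.glue_hom (hy a) (hy b) (𝒜.p.map φ)
      ((hU a).inter (𝒜.p.map φ) (hU b))
      (fun i : { i : (Σ w, J w ⟶ a) // Small (U a) (𝒜.p.map i.2) ∧
        Small (U b) (𝒜.p.map (i.2 ≫ φ)) } => obj i.1.1)
      (fun i => 𝒜.p.obj (J i.1.1)) (fun i => 𝒜.p.map i.1.2) (fun i => S a _ i.1.2 i.2.1)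
      (fun i => hS a _ _ _) (fun i => S b _ (i.1.2 ≫ φ) i.2.2)
      (fun i => isHomLift_congr (𝒜.p.map_comp _ _) (hS b _ (i.1.2 ≫ φ) i.2.2)) ?_ ?_)
    · refine ⟨hψ.1, fun w e h₁ h₂ => hψ.2 ⟨⟨w, e⟩, h₁, h₂⟩ ?_⟩
      obtain ⟨i, hi⟩ := h₁
      rw [𝒜.p.map_comp] at h₂
      obtain ⟨j, hj⟩ := h₂
      exact ⟨(i, j), fun z => ⟨hi z, hj z⟩⟩
    · rintro ⟨⟨w, e⟩, h₁, h₂⟩ ⟨⟨w', e'⟩, h₁', h₂'⟩ q d hq hd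
      have e₁ : 𝒜.p.map e = q ≫ 𝒜.p.map e' :=
        base_unique (hS a w e h₁) (isHomLift_of_eq (isHomLift_comp hq (hS a w' e' h₁')) hd)
      obtain ⟨u, hu, hu'⟩ := h'.exists_fac q _ e' (isHomLift_self e') e
        (isHomLift_congr e₁ (isHomLift_self e))
      obtain rfl : d = map u := h₀.hom_ext q _ _ (hS a w' e' h₁') hq
        (lift' u hu) (by rw [hd, hS' a _ _ u e e' h₁ h₁' hu'])
      exact hS' b _ _ u _ _ _ _ ((Category.assoc _ _ _).symm.trans (congrArg (· ≫ φ) hu'))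
    · intro R g hg
      obtain ⟨w, e, he⟩ := H a g hg.left
      have hs := small_map he hg
      refine ⟨⟨⟨w, e⟩, hs.left, ?_⟩, ?_⟩
      · rw [𝒜.p.map_comp]
        exact hs.right
      · obtain rfl : 𝒜.p.obj (J w) = R := domain_eq' he
        obtain rfl : 𝒜.p.map e = g := base_unique (isHomLift_self e) he
        exact hS a _ _ _
  choose ψ hψ hψ' using @exMap
  -- arrows out of a vertex are determined by their composites with the cocone
  have uniq {a b : 𝒜.obj} {k : 𝒜.p.obj a ⟶ 𝒜.p.obj b} {f g : y a ⟶ y b}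
      (hf : 𝒳.p.IsHomLift k f) (hg : 𝒳.p.IsHomLift k g) {κ : Type}
      {V : κ → TopologicalSpace.Opens (𝒜.p.obj a)} (hV : IsCover V)
      (e : ∀ w (e : J w ⟶ a) (h₁ : Small (U a) (𝒜.p.map e)), Small V (𝒜.p.map e) →
        S a w e h₁ ≫ f = S a w e h₁ ≫ g) : f = g := by
    refine h.hom_ext k ((hU a).inter (𝟙 _) hV) hf hg fun {R} i hi => ?_
    obtain ⟨w, c, hc⟩ := H a i hi.left
    have hs := small_map hc hi
    refine ⟨_, S a w c hs.left, ?_, e w c hs.left (hs.right.of_eq (Category.comp_id _))⟩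
    obtain rfl : 𝒜.p.obj (J w) = R := domain_eq' hc
    obtain rfl : 𝒜.p.map c = i := base_unique (isHomLift_self c) hc
    exact hS a _ _ _
  let F : 𝒜 ⥤ᵇ 𝒳 := mkFunctor y ψ
    (fun a => uniq (k := 𝟙 _) (isHomLift_congr (𝒜.p.map_id a) (hψ (𝟙 a))) (IsHomLift.id (hy a))
      (hU a) fun w e h₁ h₂ => by
        rw [hψ' (𝟙 a) w e h₁ (h₁.of_eq (by rw [Category.comp_id])),
          hSc _ h₁ (Category.comp_id e)]
        exact (Category.comp_id _).symm)
    (fun {a b c} φ χ => uniq (k := 𝒜.p.map φ ≫ 𝒜.p.map χ)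
      (isHomLift_congr (𝒜.p.map_comp φ χ) (hψ (φ ≫ χ))) (isHomLift_comp (hψ φ) (hψ χ))
      (((hU a).inter (𝒜.p.map φ) (hU b)).inter (𝒜.p.map φ ≫ 𝒜.p.map χ) (hU c))
      fun w e h₁ h₂ => by
        have s₁ : Small (U b) (𝒜.p.map (e ≫ φ)) := by
          rw [𝒜.p.map_comp]
          exact h₂.left.right
        have s₂ : Small (U c) (𝒜.p.map (e ≫ φ ≫ χ)) := by
          rw [𝒜.p.map_comp, 𝒜.p.map_comp]
          exact h₂.right
        have s₃ : Small (U c) (𝒜.p.map ((e ≫ φ) ≫ χ)) := by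
          rw [Category.assoc]
          exact s₂
        rw [hψ' (φ ≫ χ) w e h₁ s₂, ← Category.assoc (S a w e h₁), hψ' φ w e h₁ s₁,
          hψ' χ w _ s₁ s₃]
        exact hSc s₂ s₃ (Category.assoc _ _ _).symm) hψ
  -- on members of the dense family, the vertex is the prescribed value
  have exη (w : W) : ∃ t : y (J w) ⟶ obj w, 𝒳.p.IsHomLift (𝟙 (𝒜.p.obj (J w))) t ∧
      ∀ i : { i : (Σ w', J w' ⟶ J w) // Small (U (J w)) (𝒜.p.map i.2) },
        S (J w) _ i.1.2 i.2 ≫ t = map i.1.2 := by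
    refine Exists.imp (fun t ht => ?_) (h.glue_hom (hy (J w))
      (domain_eq' (lift' (𝟙 (J w)) (IsHomLift.id rfl))) (𝟙 _) (hU (J w))
      (fun i : { i : (Σ w', J w' ⟶ J w) // Small (U (J w)) (𝒜.p.map i.2) } => obj i.1.1)
      (fun i => 𝒜.p.obj (J i.1.1)) (fun i => 𝒜.p.map i.1.2) (fun i => S (J w) _ i.1.2 i.2)
      (fun i => hS _ _ _ _) (fun i => map i.1.2)
      (fun i => isHomLift_congr (Category.comp_id _).symm (lift i.1.2)) ?_ ?_)
    · exact ⟨ht.1, fun i => ht.2 i i.2⟩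
    · rintro ⟨⟨w₁, e⟩, h₁⟩ ⟨⟨w₂, e'⟩, h₂⟩ q d hq hd
      have e₁ : 𝒜.p.map e = q ≫ 𝒜.p.map e' :=
        base_unique (hS _ w₁ e h₁) (isHomLift_of_eq (isHomLift_comp hq (hS _ w₂ e' h₂)) hd)
      obtain ⟨u, hu, hu'⟩ := h'.exists_fac q _ e' (isHomLift_self e') e
        (isHomLift_congr e₁ (isHomLift_self e))
      obtain rfl : d = map u := h₀.hom_ext q _ _ (hS _ w₂ e' h₂) hq
        (lift' u hu) (by rw [hd, hS' _ _ _ u e e' h₁ h₂ hu'])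
      rw [← map_comp, hu']
    · intro R g hg
      obtain ⟨w', e, he⟩ := H _ g hg
      refine ⟨⟨⟨w', e⟩, small_map he hg⟩, ?_⟩
      obtain rfl : 𝒜.p.obj (J w') = R := domain_eq' he
      obtain rfl : 𝒜.p.map e = g := base_unique (isHomLift_self e) he
      exact hS _ _ _ _
  choose η hη hη' using exη
  refine ⟨F, η, hη, fun {w w'} φ => ?_⟩
  refine h.hom_ext (𝒜.p.map φ) ((hU (J w)).inter (𝒜.p.map φ) (hU (J w')))
    (isHomLift_comp_right (hψ φ) (hη w')) (isHomLift_comp_left (hη w) (lift φ)) fun {R} g hg => ?_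
  obtain ⟨w₁, e, he⟩ := H _ g hg.left
  have hs := small_map he hg
  have s₁ : Small (U (J w')) (𝒜.p.map (e ≫ φ)) := by
    rw [𝒜.p.map_comp]
    exact hs.right
  refine ⟨_, S _ w₁ e hs.left, ?_, ?_⟩
  · obtain rfl : 𝒜.p.obj (J w₁) = R := domain_eq' he
    obtain rfl : 𝒜.p.map e = g := base_unique (isHomLift_self e) he
    exact hS _ _ _ _
  · have h₁ : S (J w) w₁ e hs.left ≫ η w = map e := hη' w ⟨⟨w₁, e⟩, hs.left⟩
    have h₂ : S (J w') w₁ (e ≫ φ) s₁ ≫ η w' = map (e ≫ φ) := hη' w' ⟨⟨w₁, e ≫ φ⟩, s₁⟩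
    have h₃ : S (J w) w₁ e hs.left ≫ ψ φ = S (J w') w₁ (e ≫ φ) s₁ := hψ' φ w₁ e hs.left s₁
    calc _ = (S (J w) w₁ e hs.left ≫ ψ φ) ≫ η w' := (Category.assoc _ _ _).symm
      _ = (S (J w) w₁ e hs.left ≫ η w) ≫ map φ := by rw [h₃, h₂, map_comp, h₁]
      _ = _ := Category.assoc _ _ _

end Dense

/-! ### Products and plots as fibered categories -/

section Products

variable {K : BasedCategory.{v', u'} Mfd} {𝒳 : BasedCategory.{v, u} Mfd}

theorem plots_isCFG {N : Mfd} {P : ∀ ⦃Z : Mfd⦄, (Z ⟶ N) → Prop}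
    (hP : ∀ {Z Z' : Mfd} (g : Z' ⟶ Z) (f : Z ⟶ N), P f → P (g ≫ f)) : IsCFG (plots N P) where
  exists_lift x {R} f := by
    let y : (plots N P).obj := ⟨R, f ≫ x.map, hP f x.map x.mem⟩
    let g : y ⟶ x := (⟨f, rfl⟩ : PlotHom _ _)
    exact ⟨y, g, isHomLift_self g⟩
  cartesian {y x} g :=
    { toIsHomLift := isHomLift_self g
      universal_property' := fun {z} k φ hφ => by
        have e : φ.hom = k ≫ g.hom := base_unique (isHomLift_self φ) hφ
        let χ : z ⟶ y := (⟨k, by rw [← g.w, ← Category.assoc, ← φ.w, e]⟩ : PlotHom _ _)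
        refine ⟨χ, ⟨isHomLift_self χ, PlotHom.ext e.symm⟩, fun χ' hχ' => ?_⟩
        have := hχ'.1
        exact PlotHom.ext (base_unique (isHomLift_self χ') hχ'.1) }

theorem sub_isCFG (N : Mfd) (A : Set N) : IsCFG (sub N A) :=
  plots_isCFG fun g _ h z => h (g.1 z)

theorem pt_isCFG : IsCFG pt where
  exists_lift x {R} f := ⟨R, f, isHomLift_self (𝒳 := pt) f⟩
  cartesian {y x} g :=
    { toIsHomLift := isHomLift_self g
      universal_property' := fun {z} k φ hφ => by
        have e : φ = k ≫ g := base_unique (isHomLift_self (𝒳 := pt) φ) hφ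
        refine ⟨k, ⟨isHomLift_self (𝒳 := pt) k, e.symm⟩, fun χ' hχ' => ?_⟩
        exact base_unique (isHomLift_self (𝒳 := pt) χ') hχ'.1 }

theorem isHomLift_id_congr {R R' : Mfd} (e : R = R') {a b : 𝒳.obj} {φ : a ⟶ b}
    (h : 𝒳.p.IsHomLift (𝟙 R) φ) : 𝒳.p.IsHomLift (𝟙 R') φ := e ▸ h

/-- The arrow of a product with given components. -/
def pairHom {A B : (prod K 𝒳).obj} (f : A.fst ⟶ B.fst) (g : A.snd ⟶ B.snd)
    (h : 𝒳.p.IsHomLift (K.p.map f) g) : A ⟶ B := ProdHom.mk f g h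

theorem pairHom_ext {A B : (prod K 𝒳).obj} {φ ψ : A ⟶ B} (h₁ : φ.fst = ψ.fst)
    (h₂ : φ.snd = ψ.snd) : φ = ψ := ProdHom.ext h₁ h₂

theorem isHomLift_of_fst {A B : (prod K 𝒳).obj} {R S : Mfd} {f : R ⟶ S} {φ : A ⟶ B}
    (h : K.p.IsHomLift f φ.fst) : (prod K 𝒳).p.IsHomLift f φ := by
  have e₁ : K.p.obj A.fst = R := domain_eq' (𝒳 := K) h
  have e₂ : K.p.obj B.fst = S := codomain_eq' (𝒳 := K) h
  subst e₁ e₂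
  exact isHomLift_congr (base_unique (isHomLift_self φ.fst) h) (isHomLift_self φ)

theorem prod_isCFG (hK : IsCFG K) (h : IsCFG 𝒳) : IsCFG (prod K 𝒳) where
  exists_lift A {R} f := by
    obtain ⟨k, c, hc⟩ := hK.exists_lift A.fst f
    obtain ⟨x, d, hd⟩ := h.exists_lift' A.eq f
    let B : (prod K 𝒳).obj := ⟨k, x, (domain_eq' hd).trans (domain_eq' hc).symm⟩
    let g : B ⟶ A := pairHom c d (isHomLift_map_of_isHomLift f c d hc hd)
    refine ⟨B, g, ?_⟩
    exact isHomLift_of_fst (φ := g) hc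
  cartesian {B A} g :=
    { toIsHomLift := isHomLift_self g
      universal_property' := fun {C} k φ hφ => by
        have e : K.p.map φ.fst = k ≫ K.p.map g.fst := base_unique (isHomLift_self φ) hφ
        obtain ⟨χ₁, h₁, h₁'⟩ := hK.exists_fac k _ g.fst (isHomLift_self _) φ.fst
          (isHomLift_congr e (isHomLift_self φ.fst))
        obtain ⟨χ₂, h₂, h₂'⟩ := h.exists_fac k _ g.snd g.lift φ.snd
          (isHomLift_congr e φ.lift)
        let χ : C ⟶ B := pairHom χ₁ χ₂ (isHomLift_map_of_isHomLift k χ₁ χ₂ h₁ h₂)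
        have hχ : K.p.map χ₁ = k := base_unique (isHomLift_self χ₁) h₁
        refine ⟨χ, ⟨isHomLift_congr hχ (isHomLift_self χ), pairHom_ext h₁' h₂'⟩,
          fun ψ hψ => ?_⟩
        have e₁ : K.p.map ψ.fst = k := base_unique (isHomLift_self ψ) hψ.1
        refine pairHom_ext (hK.hom_ext k _ g.fst (isHomLift_self _)
          (isHomLift_congr e₁ (isHomLift_self _)) h₁ ?_)
          (h.hom_ext k _ g.snd g.lift (isHomLift_congr e₁ ψ.lift) h₂ ?_)
        · exact (congrArg ProdHom.fst hψ.2).trans h₁'.symm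
        · exact (congrArg ProdHom.snd hψ.2).trans h₂'.symm }

theorem isHomLift_fst {A B : (prod K 𝒳).obj} {R S : Mfd} {f : R ⟶ S} {φ : A ⟶ B}
    (h : (prod K 𝒳).p.IsHomLift f φ) : K.p.IsHomLift f φ.fst := by
  have e₁ : K.p.obj A.fst = R := domain_eq' (𝒳 := prod K 𝒳) h
  have e₂ : K.p.obj B.fst = S := codomain_eq' (𝒳 := prod K 𝒳) h
  subst e₁ e₂
  exact isHomLift_congr (base_unique (isHomLift_self φ) h) (isHomLift_self φ.fst)

theorem isHomLift_snd {A B : (prod K 𝒳).obj} {R S : Mfd} {f : R ⟶ S} {φ : A ⟶ B}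
    (h : (prod K 𝒳).p.IsHomLift f φ) : 𝒳.p.IsHomLift f φ.snd := by
  have e₁ : K.p.obj A.fst = R := domain_eq' (𝒳 := prod K 𝒳) h
  have e₂ : K.p.obj B.fst = S := codomain_eq' (𝒳 := prod K 𝒳) h
  subst e₁ e₂
  exact isHomLift_congr (base_unique (isHomLift_self φ) h) φ.lift

end Products

/-! ### Families of diffeomorphisms -/

section Families

variable {K : BasedCategory.{v', u'} Mfd} {𝒳 : BasedCategory.{v, u} Mfd}

/-- The object of a product with given components. -/
abbrev pair (k : K.obj) (x : 𝒳.obj) (hx : 𝒳.p.obj x = K.p.obj k) : (prod K 𝒳).obj := ⟨k, x, hx⟩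

/-- A family `F` of maps `𝒳 ⥤ 𝒳` is an equivalence at the object `k` of the parameter stack if
`F (k, -)` is fully faithful and essentially surjective on the fiber of `𝒳` over the base of `k`. -/
structure GoodAt (F : prod K 𝒳 ⥤ᵇ 𝒳) (k : K.obj) : Prop where
  existsUnique : ∀ {x x' : 𝒳.obj} (hx : 𝒳.p.obj x = K.p.obj k) (hx' : 𝒳.p.obj x' = K.p.obj k)
    (ψ : F.obj (pair k x hx) ⟶ F.obj (pair k x' hx')), 𝒳.p.IsHomLift (𝟙 (K.p.obj k)) ψ →
      ∃! φ : pair k x hx ⟶ pair k x' hx', φ.fst = 𝟙 k ∧ F.map φ = ψ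
  essSurj : ∀ y : 𝒳.obj, 𝒳.p.obj y = K.p.obj k → ∃ (x : 𝒳.obj) (hx : 𝒳.p.obj x = K.p.obj k)
    (ν : F.obj (pair k x hx) ⟶ y), 𝒳.p.IsHomLift (𝟙 (K.p.obj k)) ν

/-- A family that is an equivalence at `A.fst` is full on the arrows out of `A`, also on those that
are not vertical. -/
theorem GoodAt.exists_hom (h : IsCFG 𝒳) {F : prod K 𝒳 ⥤ᵇ 𝒳} {A B : (prod K 𝒳).obj}
    (hF : GoodAt F A.fst) (f : A.fst ⟶ B.fst) (ψ : F.obj A ⟶ F.obj B)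
    (hψ : 𝒳.p.IsHomLift (K.p.map f) ψ) : ∃ φ : A ⟶ B, φ.fst = f ∧ F.map φ = ψ := by
  obtain ⟨x, c, hc⟩ := h.exists_lift' B.eq (K.p.map f)
  let g : pair A.fst x (domain_eq' hc) ⟶ B := pairHom f c hc
  have hg : (prod K 𝒳).p.IsHomLift (K.p.map f) g := isHomLift_self g
  obtain ⟨χ, hχ, hχ'⟩ := h.exists_fac (𝟙 _) (K.p.map f) (F.map g) (isHomLift_map F hg) ψ
    (isHomLift_congr (Category.id_comp _).symm hψ)
  obtain ⟨φ, ⟨hφ, hφ'⟩, -⟩ := hF.existsUnique A.eq (domain_eq' hc) χ hχ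
  refine ⟨φ ≫ g, ?_, ?_⟩
  · show φ.fst ≫ f = f
    rw [hφ, Category.id_comp]
  · rw [F.map_comp, hφ', hχ']

/-- A family that is an equivalence at `A.fst` is faithful on the arrows out of `A`. -/
theorem GoodAt.hom_ext (h : IsCFG 𝒳) {F : prod K 𝒳 ⥤ᵇ 𝒳} {A B : (prod K 𝒳).obj}
    (hF : GoodAt F A.fst) {φ φ' : A ⟶ B} (e : φ.fst = φ'.fst) (e' : F.map φ = F.map φ') :
    φ = φ' := by
  obtain ⟨x, c, hc⟩ := h.exists_lift' B.eq (K.p.map φ.fst)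
  let g : pair A.fst x (domain_eq' hc) ⟶ B := pairHom φ.fst c hc
  have hg : (prod K 𝒳).p.IsHomLift (K.p.map φ.fst) g := isHomLift_self g
  have ex (θ : A ⟶ B) (hθ : θ.fst = φ.fst) : ∃ θ' : A ⟶ pair A.fst x (domain_eq' hc),
      θ'.fst = 𝟙 _ ∧ θ' ≫ g = θ := by
    obtain ⟨d, hd, hd'⟩ := h.exists_fac (𝟙 _) _ c hc θ.snd
      (isHomLift_congr (by rw [hθ, Category.id_comp]) θ.lift)
    exact ⟨pairHom (𝟙 A.fst) d (isHomLift_congr (K.p.map_id _).symm hd), rfl,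
      pairHom_ext ((Category.id_comp _).trans hθ.symm) hd'⟩
  obtain ⟨θ, h₁, hθ⟩ := ex φ rfl
  obtain ⟨θ', h₂, hθ'⟩ := ex φ' e.symm
  have vert (θ : A ⟶ pair A.fst x (domain_eq' hc)) (hθ : θ.fst = 𝟙 _) :
      𝒳.p.IsHomLift (𝟙 _) (F.map θ) :=
    isHomLift_map F (isHomLift_of_fst (by rw [hθ]; exact IsHomLift.id rfl))
  have e₃ : F.map θ = F.map θ' := h.hom_ext (𝟙 _) _ (F.map g) (isHomLift_map F hg)
    (vert θ h₁) (vert θ' h₂) (by rw [← F.map_comp, ← F.map_comp, hθ, hθ', e'])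
  obtain ⟨_, -, hu⟩ := hF.existsUnique A.eq (domain_eq' hc) (F.map θ') (vert θ' h₂)
  rw [← hθ, ← hθ', hu θ ⟨h₁, e₃⟩, hu θ' ⟨h₂, rfl⟩]

/-- A family that is, over a fixed parameter object, vertically isomorphic to an equivalence is an
equivalence there.  The parameter stacks of the two families may differ: only the base of the
parameter objects `k` and `l` has to be the same. -/
theorem GoodAt.of_isIso (h : IsCFG 𝒳) {L : BasedCategory.{v'', u''} Mfd} {F : prod K 𝒳 ⥤ᵇ 𝒳}
    {G : prod L 𝒳 ⥤ᵇ 𝒳} {k : K.obj} {l : L.obj} (e : L.p.obj l = K.p.obj k)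
    (α : ∀ (x : 𝒳.obj) (hx : 𝒳.p.obj x = K.p.obj k),
      F.obj (pair k x hx) ⟶ G.obj (pair l x (hx.trans e.symm)))
    (hα : ∀ x hx, 𝒳.p.IsHomLift (𝟙 (K.p.obj k)) (α x hx))
    (nat : ∀ {x x'} hx hx' (φ : pair k x hx ⟶ pair k x' hx')
      (φ' : pair l x (hx.trans e.symm) ⟶ pair l x' (hx'.trans e.symm)), φ.fst = 𝟙 k →
        φ'.fst = 𝟙 l → φ.snd = φ'.snd → F.map φ ≫ α x' hx' = α x hx ≫ G.map φ')
    (hG : GoodAt G l) : GoodAt F k := by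
  have iso (x hx) : IsIso (α x hx) := h.isIso _ (hα x hx)
  -- vertical arrows of the two products correspond
  have toL {x x'} (hx : 𝒳.p.obj x = K.p.obj k) (hx' : 𝒳.p.obj x' = K.p.obj k)
      (φ : pair k x hx ⟶ pair k x' hx') (hφ : φ.fst = 𝟙 k) :
      ∃ φ' : pair l x (hx.trans e.symm) ⟶ pair l x' (hx'.trans e.symm),
        φ'.fst = 𝟙 l ∧ φ.snd = φ'.snd := by
    refine ⟨pairHom (𝟙 l) φ.snd ?_, rfl, rfl⟩
    rw [L.p.map_id]
    have := φ.lift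
    rw [hφ, K.p.map_id] at this
    exact isHomLift_id_congr e.symm this
  have toK {x x'} (hx : 𝒳.p.obj x = K.p.obj k) (hx' : 𝒳.p.obj x' = K.p.obj k)
      (φ' : pair l x (hx.trans e.symm) ⟶ pair l x' (hx'.trans e.symm)) (hφ : φ'.fst = 𝟙 l) :
      ∃ φ : pair k x hx ⟶ pair k x' hx', φ.fst = 𝟙 k ∧ φ.snd = φ'.snd := by
    refine ⟨pairHom (𝟙 k) φ'.snd ?_, rfl, rfl⟩
    rw [K.p.map_id]
    have := φ'.lift
    rw [hφ, L.p.map_id] at this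
    exact isHomLift_id_congr e this
  refine ⟨fun {x x'} hx hx' ψ hψ => ?_, fun y hy => ?_⟩
  · have := hα x hx
    have hψ' : 𝒳.p.IsHomLift (𝟙 (K.p.obj k)) (inv (α x hx) ≫ ψ ≫ α x' hx') :=
      isHomLift_comp_left inferInstance (isHomLift_comp_right hψ (hα x' hx'))
    obtain ⟨φ', ⟨h₁, h₂⟩, hu⟩ := hG.existsUnique (hx.trans e.symm) (hx'.trans e.symm)
      (inv (α x hx) ≫ ψ ≫ α x' hx') (isHomLift_id_congr e.symm hψ')
    obtain ⟨φ, h₃, h₄⟩ := toK hx hx' φ' h₁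
    refine ⟨φ, ⟨h₃, ?_⟩, ?_⟩
    · rw [← cancel_mono (α x' hx'), nat hx hx' φ φ' h₃ h₁ h₄, h₂, IsIso.hom_inv_id_assoc]
    · rintro ρ ⟨h₅, h₆⟩
      obtain ⟨ρ', h₇, h₈⟩ := toL hx hx' ρ h₅
      have := hu ρ' ⟨h₇, by
        rw [IsIso.eq_inv_comp, ← nat hx hx' ρ ρ' h₅ h₇ h₈, h₆]⟩
      exact pairHom_ext (h₅.trans h₃.symm) (by rw [h₈, this, h₄])
  · obtain ⟨x, hx, ν, hν⟩ := hG.essSurj y (hy.trans e.symm)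
    exact ⟨x, hx.trans e, α x (hx.trans e) ≫ ν,
      isHomLift_comp_left (hα _ _) (isHomLift_id_congr e hν)⟩

/-- Equivalences at objects are stable under base change of the parameter. -/
theorem GoodAt.baseChange (h : IsCFG 𝒳) {L : BasedCategory.{v'', u''} Mfd} {F : prod K 𝒳 ⥤ᵇ 𝒳}
    (u : L ⥤ᵇ K) {l : L.obj} (hF : GoodAt F (u.obj l)) :
    GoodAt ((prodMap u (BasedFunctor.id 𝒳)).comp F) l := by
  refine GoodAt.of_isIso h (u.w_obj l) (fun x hx => 𝟙 _) (fun x hx => ?_)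
    (fun {x x'} hx hx' φ φ' h₁ h₂ h₃ => ?_) hF
  · exact IsHomLift.id (BasedFunctor.w_obj _ _)
  · refine (Category.comp_id _).trans (.trans ?_ (Category.id_comp _).symm)
    refine congrArg F.map (pairHom_ext ?_ h₃)
    show u.map φ.fst = φ'.fst
    rw [h₁, h₂]
    exact u.map_id l

/-- Composition, at a fixed parameter, of two families of equivalences. -/
theorem GoodAt.comp {F G : prod K 𝒳 ⥤ᵇ 𝒳} {k : K.obj} (hF : GoodAt F k)
    (hG : GoodAt G k) : GoodAt ((graph F).comp G) k := by
  refine ⟨fun {x x'} hx hx' ψ hψ => ?_, fun y hy => ?_⟩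
  · obtain ⟨θ, ⟨h₁, h₂⟩, hu⟩ := hG.existsUnique (x := F.obj (pair k x hx))
      (x' := F.obj (pair k x' hx')) (F.w_obj _) (F.w_obj _) ψ hψ
    have hθ := θ.lift
    rw [h₁, K.p.map_id] at hθ
    obtain ⟨φ, ⟨h₃, h₄⟩, hu'⟩ := hF.existsUnique hx hx' θ.snd hθ
    refine ⟨φ, ⟨h₃, ?_⟩, ?_⟩
    · rw [← h₂]
      exact congrArg G.map (pairHom_ext (h₃.trans h₁.symm) h₄)
    · rintro ρ ⟨h₅, h₆⟩
      refine hu' ρ ⟨h₅, ?_⟩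
      have := hu ((graph F).map ρ) ⟨h₅, h₆⟩
      exact congrArg ProdHom.snd this
  · obtain ⟨x, hx, ν, hν⟩ := hG.essSurj y hy
    obtain ⟨x', hx', μ, hμ⟩ := hF.essSurj x hx
    let m : (graph F).obj (pair k x' hx') ⟶ pair k x hx :=
      pairHom (𝟙 k) μ (isHomLift_congr (K.p.map_id k).symm hμ)
    refine ⟨x', hx', G.map m ≫ ν, isHomLift_comp_right (isHomLift_map G ?_) hν⟩
    exact isHomLift_of_fst (IsHomLift.id rfl)

theorem goodAt_prodSnd (k : K.obj) : GoodAt (prodSnd K 𝒳) k := by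
  refine ⟨fun {x x'} hx hx' ψ hψ => ?_, fun y hy => ?_⟩
  · refine ⟨pairHom (𝟙 k) ψ (isHomLift_congr (K.p.map_id k).symm hψ), ⟨rfl, rfl⟩, ?_⟩
    rintro ρ ⟨h₁, h₂⟩
    exact pairHom_ext h₁ h₂
  · exact ⟨y, hy, 𝟙 y, IsHomLift.id hy⟩

/-- A map `K × 𝒳 ⥤ 𝒳` is a smooth family of diffeomorphisms if and only if it is an equivalence on
the fibers over every parameter object.  In the second form, the condition is local in the parameter
and needs no global inverse. -/
theorem isDiffeoFamily_iff {K : BasedCategory.{0, 1} Mfd} (h : IsCFG 𝒳) {F : prod K 𝒳 ⥤ᵇ 𝒳} :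
    IsDiffeoFamily F ↔ ∀ k, GoodAt F k := by
  constructor
  · intro hF k
    have : (graph F).toFunctor.IsEquivalence := hF
    refine ⟨fun {x x'} hx hx' ψ hψ => ?_, fun y hy => ?_⟩
    · let θ : (graph F).obj (pair k x hx) ⟶ (graph F).obj (pair k x' hx') :=
        pairHom (𝟙 k) ψ (isHomLift_congr (K.p.map_id k).symm hψ)
      obtain ⟨φ, hφ⟩ := (graph F).map_surjective θ
      refine ⟨φ, ⟨congrArg ProdHom.fst hφ, congrArg ProdHom.snd hφ⟩, ?_⟩
      rintro ρ ⟨h₁, h₂⟩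
      apply (graph F).map_injective
      rw [hφ]
      exact pairHom_ext h₁ h₂
    · let B := (graph F).toFunctor.objPreimage (pair k y hy)
      let e : (graph F).obj B ≅ pair k y hy := (graph F).toFunctor.objObjPreimageIso (pair k y hy)
      obtain ⟨x, c, hc⟩ := h.exists_lift' B.eq (K.p.map e.inv.fst)
      let g : pair k x (domain_eq' hc) ⟶ B := pairHom e.inv.fst c hc
      refine ⟨x, domain_eq' hc, F.map g ≫ e.hom.snd, ?_⟩
      have h₁ : 𝒳.p.IsHomLift (K.p.map e.inv.fst) (F.map g) := isHomLift_map F (isHomLift_self g)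
      refine isHomLift_congr ?_ (isHomLift_comp h₁ e.hom.lift)
      rw [← K.p.map_comp, ← K.p.map_id]
      exact congrArg (fun t : pair k y hy ⟶ pair k y hy => K.p.map t.fst) e.inv_hom_id
  · intro hF
    have f₁ : (graph F).toFunctor.Faithful := ⟨fun {A B φ φ'} e => by
      have e' : (graph F).map φ = (graph F).map φ' := e
      exact (hF A.fst).hom_ext h
        (congrArg (fun t : (graph F).obj A ⟶ (graph F).obj B => t.fst) e')
        (congrArg (fun t : (graph F).obj A ⟶ (graph F).obj B => t.snd) e')⟩
    have f₂ : (graph F).toFunctor.Full := ⟨fun {A B} θ => by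
      obtain ⟨φ, h₁, h₂⟩ := (hF A.fst).exists_hom h (B := B) θ.fst θ.snd θ.lift
      exact ⟨φ, pairHom_ext h₁ h₂⟩⟩
    have f₃ : (graph F).toFunctor.EssSurj := ⟨fun B => by
      obtain ⟨x, hx, ν, hν⟩ := (hF B.fst).essSurj B.snd B.eq
      let m : (graph F).obj (pair B.fst x hx) ⟶ B :=
        pairHom (𝟙 _) ν (isHomLift_congr (K.p.map_id _).symm hν)
      have i : IsIso ν := h.isIso ν hν
      obtain ⟨ν', h₁, h₂⟩ := i.out
      have l : 𝒳.p.IsHomLift (𝟙 (K.p.obj B.fst)) ν' := by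
        obtain rfl : ν' = inv ν := IsIso.eq_inv_of_hom_inv_id h₁
        infer_instance
      let m' : B ⟶ (graph F).obj (pair B.fst x hx) :=
        pairHom (𝟙 _) ν' (isHomLift_congr (K.p.map_id _).symm l)
      exact ⟨pair B.fst x hx, ⟨⟨m, m', pairHom_ext (Category.comp_id _) h₁,
        pairHom_ext (Category.comp_id _) h₂⟩⟩⟩⟩
    exact { }

/-- Objects of a product can be pulled back along smooth maps into their base. -/
theorem pair_exists (hK : IsCFG K) (h : IsCFG 𝒳) (A : (prod K 𝒳).obj) {R : Mfd}
    (g : R ⟶ K.p.obj A.fst) : ∃ (B : (prod K 𝒳).obj) (e : B ⟶ A), K.p.IsHomLift g e.fst ∧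
      𝒳.p.IsHomLift g e.snd := by
  obtain ⟨B, e, he⟩ := (prod_isCFG hK h).exists_lift A g
  exact ⟨B, e, isHomLift_fst he, isHomLift_snd he⟩

/-- Being an equivalence is a local property of the parameter. -/
theorem GoodAt.of_local (h : IsStack 𝒳) (hK : IsCFG K) {F : prod K 𝒳 ⥤ᵇ 𝒳} {k : K.obj} {ι : Type}
    {U : ι → TopologicalSpace.Opens (K.p.obj k)} (hU : IsCover U)
    (H : ∀ (k' : K.obj) (c : k' ⟶ k), Small U (K.p.map c) → GoodAt F k') : GoodAt F k := by
  have h₀ := h.toIsCFG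
  refine ⟨fun {x x'} hx hx' ψ hψ => ?_, fun y hy => ?_⟩
  · -- the restriction of the required arrow along a small arrow `e`
    have ex (i : { i : (Σ z : (prod K 𝒳).obj, z ⟶ pair k x hx) // Small U (K.p.map i.2.fst) }) :
        ∃ φ : i.1.1 ⟶ pair k x' hx', φ.fst = i.1.2.fst ∧
          F.map φ = F.map i.1.2 ≫ ψ :=
      (H _ _ i.2).exists_hom h₀ (B := pair k x' hx') i.1.2.fst (F.map i.1.2 ≫ ψ)
        (isHomLift_comp_right (isHomLift_map F (isHomLift_self i.1.2)) hψ)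
    choose s hs hs' using ex
    have hsl (i) : 𝒳.p.IsHomLift (K.p.map i.1.2.fst) (s i).snd := by
      rw [← hs]
      exact (s i).lift
    obtain ⟨φ, hφ, hφ'⟩ := h.glue_hom hx hx' (𝟙 _) hU (fun i => i.1.1.snd)
      (fun i : { i : (Σ z : (prod K 𝒳).obj, z ⟶ pair k x hx) // Small U (K.p.map i.2.fst) } =>
        K.p.obj i.1.1.fst)
      (fun i => K.p.map i.1.2.fst) (fun i => i.1.2.snd) (fun i => i.1.2.lift)
      (fun i => (s i).snd) (fun i => isHomLift_congr (Category.comp_id _).symm (hsl i))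
      (fun i j q d hq hd => by
        have e₁ : K.p.map i.1.2.fst = q ≫ K.p.map j.1.2.fst :=
          base_unique i.1.2.lift (isHomLift_of_eq (isHomLift_comp hq j.1.2.lift) hd)
        obtain ⟨κ, hκ, hκ'⟩ := hK.exists_fac q _ j.1.2.fst (isHomLift_self _) i.1.2.fst
          (isHomLift_congr e₁ (isHomLift_self _))
        let D : i.1.1 ⟶ j.1.1 := pairHom κ d (isHomLift_map_of_isHomLift q κ d hκ hq)
        have hD : D ≫ j.1.2 = i.1.2 := pairHom_ext hκ' hd
        have : D ≫ s j = s i := (H _ _ i.2).hom_ext h₀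
          (by
            show κ ≫ (s j).fst = (s i).fst
            rw [hs, hs, hκ'])
          (by rw [F.map_comp, hs', hs', ← hD, F.map_comp, Category.assoc])
        exact congrArg ProdHom.snd this)
      (fun {R} g hg => by
        obtain ⟨B, e, he, he'⟩ := pair_exists hK h₀ (pair k x hx) g
        exact ⟨⟨⟨B, e⟩, small_map he hg⟩, he'⟩)
    refine ⟨pairHom (𝟙 k) φ (isHomLift_congr (K.p.map_id k).symm hφ), ⟨rfl, ?_⟩, ?_⟩
    · refine h.hom_ext (𝟙 _) hU (isHomLift_map F (isHomLift_of_fst (IsHomLift.id rfl))) hψ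
        fun {R} g hg => ?_
      obtain ⟨B, e, he, he'⟩ := pair_exists hK h₀ (pair k x hx) g
      refine ⟨_, F.map e, isHomLift_map F (isHomLift_of_fst he), ?_⟩
      rw [← F.map_comp, ← hs' ⟨⟨B, e⟩, small_map he hg⟩]
      refine congrArg F.map (pairHom_ext ?_ ?_)
      · exact (Category.comp_id _).trans (hs ⟨⟨B, e⟩, small_map he hg⟩).symm
      · exact hφ' ⟨⟨B, e⟩, small_map he hg⟩ (small_map he hg)
    · rintro ρ ⟨h₁, h₂⟩
      have hρ := ρ.lift
      rw [h₁, K.p.map_id] at hρ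
      refine pairHom_ext h₁ (h.hom_ext (𝟙 _) hU hρ hφ fun {R} g hg => ?_)
      obtain ⟨B, e, he, he'⟩ := pair_exists hK h₀ (pair k x hx) g
      refine ⟨_, e.snd, he', ?_⟩
      have h₃ : e ≫ ρ = s ⟨⟨B, e⟩, small_map he hg⟩ :=
        (H _ e.fst (small_map he hg)).hom_ext h₀
          (by
            rw [hs]
            show e.fst ≫ ρ.fst = e.fst
            rw [h₁]
            exact Category.comp_id _)
          (by rw [hs', F.map_comp, h₂])
      exact (congrArg ProdHom.snd h₃).trans
        (hφ' ⟨⟨B, e⟩, small_map he hg⟩ (small_map he hg)).symm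
  -- local preimages of `y`
  · have ex (b : (coverSieve _ U).obj) : ∃ (z : (prod K 𝒳).obj) (c : z.fst ⟶ k)
        (μ : F.obj z ⟶ y), K.p.IsHomLift b.map c ∧ 𝒳.p.IsHomLift b.map μ ∧ GoodAt F z.fst := by
      obtain ⟨k', c, hc⟩ := hK.exists_lift k b.map
      have hg := H k' c (small_map hc b.mem)
      obtain ⟨y', d, hd⟩ := h₀.exists_lift' hy b.map
      have e : K.p.obj k' = b.dom := domain_eq' hc
      obtain ⟨x, hx, ν, hν⟩ := hg.essSurj y' ((domain_eq' hd).trans e.symm)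
      exact ⟨pair k' x hx, c, ν ≫ d, hc,
        isHomLift_comp_left (isHomLift_id_congr e hν) hd, hg⟩
    choose z c μ hc hμ hz using ex
    have ex {a b : (coverSieve _ U).obj} (φ : a ⟶ b) : ∃ v : z a ⟶ z b,
        K.p.IsHomLift φ.hom v.fst ∧ v.fst ≫ c b = c a ∧ F.map v ≫ μ b = μ a := by
      obtain ⟨κ, hκ, hκ'⟩ := hK.exists_fac φ.hom _ (c b) (hc b) (c a)
        (isHomLift_congr φ.w.symm (hc a))
      obtain ⟨t, ht, ht'⟩ := h₀.exists_fac φ.hom _ (μ b) (hμ b) (μ a)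
        (isHomLift_congr φ.w.symm (hμ a))
      obtain ⟨v, hv, hv'⟩ := (hz a).exists_hom h₀ κ t (isHomLift_map_of_isHomLift φ.hom κ t hκ ht)
      exact ⟨v, by rwa [hv], by rwa [hv], by rwa [hv']⟩
    -- full faithfulness makes the comparison of local preimages unique, hence functorial
    have uniq {a b : (coverSieve _ U).obj} {q : a.dom ⟶ b.dom} {v v' : z a ⟶ z b}
        (hv : K.p.IsHomLift q v.fst) (hv' : K.p.IsHomLift q v'.fst)
        (e : v.fst ≫ c b = v'.fst ≫ c b) (e' : F.map v ≫ μ b = F.map v' ≫ μ b) : v = v' :=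
      (hz a).hom_ext h₀ (hK.hom_ext q _ _ (hc b) hv hv' e) (h₀.hom_ext q _ _ (hμ b)
        (isHomLift_map F (isHomLift_of_fst hv)) (isHomLift_map F (isHomLift_of_fst hv')) e')
    choose v hv hv₁ hv₂ using @ex
    have hv_id (a) : v (𝟙 a) = 𝟙 (z a) := uniq (hv (𝟙 a))
      (isHomLift_fst (𝒳 := 𝒳) (φ := 𝟙 (z a)) (IsHomLift.id (domain_eq' (𝒳 := K) (hc a))))
      ((hv₁ _).trans (Category.id_comp _).symm) (by rw [hv₂, F.map_id, Category.id_comp])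
    have hv_comp {a b d : (coverSieve _ U).obj} (φ : a ⟶ b) (ψ : b ⟶ d) :
        v (φ ≫ ψ) = v φ ≫ v ψ := uniq (hv (φ ≫ ψ))
      (isHomLift_comp (hv φ) (hv ψ)) (by
        rw [hv₁]
        exact ((Category.assoc _ _ _).trans (by rw [hv₁, hv₁])).symm)
      (by rw [hv₂, F.map_comp, Category.assoc, hv₂, hv₂])
    -- glue the local preimages of `y` to an object `x`, and the comparisons with `y` to an arrow
    obtain ⟨x, s, hx, hs, hs'⟩ := h.glue_obj hU (mkFunctor (fun a => (z a).snd)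
      (fun φ => (v φ).snd) (fun a => congrArg ProdHom.snd (hv_id a))
      (fun φ ψ => congrArg ProdHom.snd (hv_comp φ ψ))
      (fun φ => isHomLift_snd (isHomLift_of_fst (hv φ))))
    let e (a : (coverSieve _ U).obj) : z a ⟶ pair k x hx :=
      pairHom (c a) (s a) (isHomLift_map_of_isHomLift _ _ _ (hc a) (hs a))
    have he (a) : (prod K 𝒳).p.IsHomLift a.map (e a) := isHomLift_of_fst (φ := e a) (hc a)
    obtain ⟨ν, hν, -⟩ := h.glue_hom (F.w_obj (pair k x hx)) hy (𝟙 _) hU (fun a => F.obj (z a))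
      (fun a => a.dom) (fun a => a.map) (fun a => F.map (e a)) (fun a => isHomLift_map F (he a))
      (fun a => μ a) (fun a => isHomLift_congr (Category.comp_id _).symm (hμ a))
      (fun a b q d hq hd => by
        have e₁ : q ≫ b.map = a.map := base_unique
          (isHomLift_of_eq (isHomLift_comp hq (isHomLift_map F (he b))) hd)
          (isHomLift_map F (he a))
        let φ : a ⟶ b := (⟨q, e₁⟩ : PlotHom _ _)
        have e₂ : v φ ≫ e b = e a := pairHom_ext (hv₁ φ) (hs' φ)
        have e₃ : d = F.map (v φ) := h₀.hom_ext q _ _ (isHomLift_map F (he b)) hq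
          (isHomLift_map F (isHomLift_of_fst (hv φ))) (by rw [hd, ← F.map_comp, e₂])
        rw [e₃, hv₂])
      (fun {R} g hg => ⟨⟨R, g, hg⟩, isHomLift_map F (he ⟨R, g, hg⟩)⟩)
    exact ⟨x, hx, ν, hν⟩

/-- The family `G` of inverses of a family `F` of equivalences.  The natural isomorphisms
`F (k, G (k, x)) ≅ x` and `G (k, F (k, x)) ≅ x` are given by their components and by their
naturality with respect to all arrows of `K × 𝒳`. -/
theorem exists_inverse (h : IsCFG 𝒳) {F : prod K 𝒳 ⥤ᵇ 𝒳} (hF : ∀ k, GoodAt F k) :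
    ∃ G : prod K 𝒳 ⥤ᵇ 𝒳, (∀ k, GoodAt G k) ∧
      (∃ ε : ∀ A : (prod K 𝒳).obj, F.obj (pair A.fst (G.obj A) (G.w_obj A)) ⟶ A.snd,
        (∀ A : (prod K 𝒳).obj, 𝒳.p.IsHomLift (𝟙 (K.p.obj A.fst)) (ε A)) ∧
        ∀ {A B : (prod K 𝒳).obj} (φ : A ⟶ B)
          (θ : pair A.fst (G.obj A) (G.w_obj A) ⟶ pair B.fst (G.obj B) (G.w_obj B)),
          θ.fst = φ.fst → θ.snd = G.map φ → F.map θ ≫ ε B = ε A ≫ φ.snd) ∧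
      ∃ η : ∀ A : (prod K 𝒳).obj, G.obj (pair A.fst (F.obj A) (F.w_obj A)) ⟶ A.snd,
        (∀ A : (prod K 𝒳).obj, 𝒳.p.IsHomLift (𝟙 (K.p.obj A.fst)) (η A)) ∧
        ∀ {A B : (prod K 𝒳).obj} (φ : A ⟶ B)
          (θ : pair A.fst (F.obj A) (F.w_obj A) ⟶ pair B.fst (F.obj B) (F.w_obj B)),
          θ.fst = φ.fst → θ.snd = F.map φ → G.map θ ≫ η B = η A ≫ φ.snd := by
  have ex (A : (prod K 𝒳).obj) := (hF A.fst).essSurj A.snd A.eq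
  choose x hx ν hν using ex
  -- the value of the inverse on an arrow
  have ex {A B : (prod K 𝒳).obj} (φ : A ⟶ B) :
      ∃ w : pair A.fst (x A) (hx A) ⟶ pair B.fst (x B) (hx B),
        w.fst = φ.fst ∧ F.map w ≫ ν B = ν A ≫ φ.snd := by
    obtain ⟨t, ht, ht'⟩ := h.exists_fac (K.p.map φ.fst) _ (ν B) (hν B) (ν A ≫ φ.snd)
      (isHomLift_congr (Category.comp_id _).symm (isHomLift_comp_left (hν A) φ.lift))
    obtain ⟨w, hw, hw'⟩ := (hF A.fst).exists_hom (A := pair A.fst (x A) (hx A))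
      (B := pair B.fst (x B) (hx B)) h φ.fst t ht
    exact ⟨w, hw, by rw [hw', ht']⟩
  have uniq {A B : (prod K 𝒳).obj} {w w' : pair A.fst (x A) (hx A) ⟶ pair B.fst (x B) (hx B)}
      (e : w.fst = w'.fst) (e' : F.map w ≫ ν B = F.map w' ≫ ν B) : w = w' := by
    have := h.isIso _ (hν B)
    exact (hF A.fst).hom_ext (A := pair A.fst (x A) (hx A)) h e ((cancel_mono (ν B)).1 e')
  choose w hw hw' using @ex
  let G : prod K 𝒳 ⥤ᵇ 𝒳 := mkFunctor x (fun φ => (w φ).snd)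
    (fun A => congrArg ProdHom.snd (uniq (w := w (𝟙 A)) (w' := 𝟙 _) (hw (𝟙 A))
      (by rw [hw', F.map_id, Category.id_comp]; exact Category.comp_id _)))
    (fun φ ψ => congrArg ProdHom.snd (uniq (w := w (φ ≫ ψ)) (w' := w φ ≫ w ψ)
      (by
        show (w (φ ≫ ψ)).fst = (w φ).fst ≫ (w ψ).fst
        rw [hw, hw, hw]
        rfl)
      (by
        rw [hw', F.map_comp, Category.assoc, hw', ← Category.assoc, hw', Category.assoc]
        rfl)))
    (fun φ => by
      have := (w φ).lift
      rw [hw] at this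
      exact this)
  have hθ {A B : (prod K 𝒳).obj} (φ : A ⟶ B)
      (θ : pair A.fst (x A) (hx A) ⟶ pair B.fst (x B) (hx B)) (h₁ : θ.fst = φ.fst)
      (h₂ : θ.snd = (w φ).snd) : F.map θ ≫ ν B = ν A ≫ φ.snd := by
    rw [← hw' φ, pairHom_ext (φ := θ) (ψ := w φ) (h₁.trans (hw φ).symm) h₂]
  -- the other composition
  let GF (A : (prod K 𝒳).obj) : (prod K 𝒳).obj := pair A.fst (F.obj A) (F.w_obj A)
  have ex (A : (prod K 𝒳).obj) : ∃ η : pair A.fst (x (GF A)) (hx (GF A)) ⟶ A, η.fst = 𝟙 _ ∧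
      F.map η = ν (GF A) :=
    (hF A.fst).exists_hom (A := pair A.fst (x (GF A)) (hx (GF A))) h (𝟙 A.fst) (ν (GF A))
      (isHomLift_congr (K.p.map_id _).symm (hν (GF A)))
  choose η hη hη' using ex
  have hηl (A : (prod K 𝒳).obj) : 𝒳.p.IsHomLift (𝟙 (K.p.obj A.fst)) (η A).snd := by
    have := (η A).lift
    rw [hη, K.p.map_id] at this
    exact this
  refine ⟨G, fun k => ⟨fun {y y'} hy hy' ψ hψ => ?_, fun y hy => ?_⟩, ⟨ν, hν, hθ⟩,
    fun A => (η A).snd, hηl, fun {A B} φ θ h₁ h₂ => ?_⟩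
  · let u : pair k (x (pair k y hy)) (hx (pair k y hy)) ⟶
        pair k (x (pair k y' hy')) (hx (pair k y' hy')) :=
      pairHom (𝟙 k) ψ (isHomLift_congr (K.p.map_id k).symm hψ)
    have i := h.isIso _ (hν (pair k y hy))
    have l := hν (pair k y hy)
    obtain ⟨t, ht, ht'⟩ : ∃ t : y ⟶ y', 𝒳.p.IsHomLift (𝟙 (K.p.obj k)) t ∧
        ν (pair k y hy) ≫ t = F.map u ≫ ν (pair k y' hy') :=
      ⟨inv (ν (pair k y hy)) ≫ F.map u ≫ ν (pair k y' hy'),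
        isHomLift_comp_left inferInstance (isHomLift_comp_right
          (isHomLift_map F (isHomLift_of_fst (φ := u) (IsHomLift.id rfl))) (hν (pair k y' hy'))),
        IsIso.hom_inv_id_assoc _ _⟩
    let φ : pair k y hy ⟶ pair k y' hy' :=
      pairHom (𝟙 k) t (isHomLift_congr (K.p.map_id k).symm ht)
    refine ⟨φ, ⟨rfl, ?_⟩, ?_⟩
    · exact congrArg ProdHom.snd (uniq (w := w φ) (w' := u) (hw φ) ((hw' φ).trans ht'))
    · rintro ρ ⟨h₁, h₂⟩
      refine pairHom_ext h₁ ?_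
      have h₃ : w ρ = u := pairHom_ext ((hw ρ).trans h₁) h₂
      have h₄ := hw' ρ
      rw [h₃, ← ht'] at h₄
      exact ((cancel_epi (ν (pair k y hy))).1 h₄).symm
  · exact ⟨F.obj (pair k y hy), F.w_obj _, (η (pair k y hy)).snd, hηl (pair k y hy)⟩
  · have e : w θ ≫ η B = η A ≫ φ := (hF A.fst).hom_ext
      (A := pair A.fst (x (GF A)) (hx (GF A))) h
      (by
        show (w θ).fst ≫ (η B).fst = (η A).fst ≫ φ.fst
        rw [hw, hη, hη, h₁]
        exact (Category.comp_id _).trans (Category.id_comp _).symm)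
      (by
        rw [F.map_comp, F.map_comp, hη', hη', ← h₂]
        exact hw' θ)
    exact congrArg ProdHom.snd e

end Families

/-! ### Comparison of clutched bundles -/

section Clutch

variable {𝒳 : BasedCategory.{v, u} Mfd}

theorem isHomLift_inverse {R : Mfd} {x y : 𝒳.obj} {ν : x ⟶ y} {ν' : y ⟶ x} [IsIso ν]
    (hν : 𝒳.p.IsHomLift (𝟙 R) ν) (e : ν ≫ ν' = 𝟙 x) : 𝒳.p.IsHomLift (𝟙 R) ν' := by
  obtain rfl : ν' = inv ν := IsIso.eq_inv_of_hom_inv_id e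
  exact (inferInstance : 𝒳.p.IsHomLift (𝟙 R) (inv ν))

/-- The inclusion of an open subset. -/
def inclOpen (Z : Mfd) (U : TopologicalSpace.Opens Z) : Z.restr U ⟶ Z :=
  ⟨fun z => z.1, (contMDiff_subtype_val :
    ContMDiff 𝓘(ℝ, Z.model) 𝓘(ℝ, Z.model) ∞ (Subtype.val : U → Z))⟩

/-- The plot of the disc `D₊` given by a plot of the annulus. -/
abbrev plusOfAnn (δ : ℝ) (q : (ofMfd (Mfd.sphere.restr (ann δ))).obj) :
    (sub Mfd.sphere (discPlus δ)).obj :=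
  ⟨q.dom, q.map ≫ inclOpen _ _, fun z => (q.map.1 z).2.1⟩

/-- The plot of the disc `D₊` that a plot of the sphere restricts to. -/
abbrev plusPlot (δ : ℝ) {Z : Mfd} (f : Z ⟶ Mfd.sphere) : (sub Mfd.sphere (discPlus δ)).obj :=
  ⟨Z.restr (Mfd.preim f (discPlus δ)), inclOpen _ _ ≫ f, fun z => z.2⟩

/-- The plot of the annulus that a plot of the sphere restricts to. -/
abbrev annPlot (δ : ℝ) {Z : Mfd} (f : Z ⟶ Mfd.sphere) :
    (ofMfd (Mfd.sphere.restr (ann δ))).obj :=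
  ⟨Z.restr (Mfd.preim f (ann δ)), Mfd.mapRestr f (Mfd.preim f (ann δ)) (ann δ) (fun _ h => h),
    fun _ => trivial⟩

/-- The plot of the circle given by a plot of the annulus. -/
abbrev thetaPlot (δ : ℝ) (q : (ofMfd (Mfd.sphere.restr (ann δ))).obj) : S1.obj :=
  ⟨q.dom, q.map ≫ theta δ, fun _ => trivial⟩

/-- The bundles of two clutching maps are isomorphic over the identity of the sphere. -/
def BundleEquivalent (δ : ℝ) (γ₀ γ₁ : prod S1 𝒳 ⥤ᵇ 𝒳) : Prop :=
  ∃ Φ : BundleIso (clutchProj δ γ₀) (clutchProj δ γ₁),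
    Φ.base = BasedFunctor.id (ofMfd Mfd.sphere)

theorem BundleEquivalent.trans {δ : ℝ} {γ₀ γ₁ γ₂ : prod S1 𝒳 ⥤ᵇ 𝒳}
    (h : BundleEquivalent δ γ₀ γ₁) (h' : BundleEquivalent δ γ₁ γ₂) :
    BundleEquivalent δ γ₀ γ₂ := by
  obtain ⟨⟨T, B, hT, hB, c⟩, rfl : B = _⟩ := h
  obtain ⟨⟨T', B', hT', hB', c'⟩, rfl : B' = _⟩ := h'
  have : T.toFunctor.IsEquivalence := hT
  have : T'.toFunctor.IsEquivalence := hT'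
  refine ⟨⟨T.comp T', BasedFunctor.id _, ?_, hB, ?_⟩, rfl⟩
  · exact (inferInstance : (T.toFunctor ⋙ T'.toFunctor).IsEquivalence)
  · let i : (T.comp T').comp (clutchProj δ γ₂) ≅ T.comp (clutchProj δ γ₁) := isoWhiskerLeft T c'
    exact i ≪≫ c

/-- Two clutching maps that differ on the annulus by an automorphism `b` of `D₊ × 𝒳` over `D₊`
define isomorphic bundles: apply `b` over `D₊` and the identity over `D₋`. -/
theorem bundleEquivalent_of_plus (h : IsCFG 𝒳) (δ : ℝ) {γ₀ γ₁ : prod S1 𝒳 ⥤ᵇ 𝒳}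
    (b : prod (sub Mfd.sphere (discPlus δ)) 𝒳 ⥤ᵇ 𝒳) (hb : ∀ k, GoodAt b k)
    (Λ : ∀ (q : (ofMfd (Mfd.sphere.restr (ann δ))).obj) (x : 𝒳.obj) (hx : 𝒳.p.obj x = q.dom),
      γ₁.obj (pair (thetaPlot δ q) x hx) ⟶
        b.obj (pair (plusOfAnn δ q) (γ₀.obj (pair (thetaPlot δ q) x hx)) (γ₀.w_obj _)))
    (hΛ : ∀ q x hx, 𝒳.p.IsHomLift (𝟙 q.dom) (Λ q x hx))
    (nat : ∀ {q q' : (ofMfd (Mfd.sphere.restr (ann δ))).obj} {x x' : 𝒳.obj} (hx hx')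
      (φ : pair (thetaPlot δ q) x hx ⟶ pair (thetaPlot δ q') x' hx')
      (θ : pair (plusOfAnn δ q) (γ₀.obj (pair (thetaPlot δ q) x hx)) (γ₀.w_obj _) ⟶
        pair (plusOfAnn δ q') (γ₀.obj (pair (thetaPlot δ q') x' hx')) (γ₀.w_obj _)),
      φ.fst.hom ≫ q'.map = q.map → θ.fst.hom = φ.fst.hom → θ.snd = γ₀.map φ →
        γ₁.map φ ≫ Λ q' x' hx' = Λ q x hx ≫ b.map θ) : BundleEquivalent δ γ₀ γ₁ := by
  have ov {γ : prod S1 𝒳 ⥤ᵇ 𝒳} (A : ClutchObj δ γ) :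
      𝒳.p.obj A.xp = A.base.restr (Mfd.preim A.f (discPlus δ)) := codomain_eq' A.up_lift
  -- an arrow of plots over the annulus and its values
  let θ {Z Z' : Mfd} {f : Z ⟶ Mfd.sphere} {f' : Z' ⟶ Mfd.sphere} (k : Z ⟶ Z')
      (w : k ≫ f' = f) {x x' : 𝒳.obj} (hx : 𝒳.p.obj x = Z.restr (Mfd.preim f (ann δ)))
      (hx' : 𝒳.p.obj x' = Z'.restr (Mfd.preim f' (ann δ))) (a : x ⟶ x')
      (ha : 𝒳.p.IsHomLift (overSphere k w (ann δ)) a) :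
      pair (plusOfAnn δ (annPlot δ f)) (γ₀.obj (annObj δ f x hx)) (γ₀.w_obj _) ⟶
        pair (plusOfAnn δ (annPlot δ f')) (γ₀.obj (annObj δ f' x' hx')) (γ₀.w_obj _) :=
    pairHom (⟨overSphere k w (ann δ), by subst w; rfl⟩ : PlotHom _ _)
      (γ₀.map (annHom δ k w hx hx' a ha))
      (isHomLift_map (𝒳 := prod S1 𝒳) (f := overSphere k w (ann δ)) γ₀
        (isHomLift_self (𝒳 := prod S1 𝒳) (annHom δ k w hx hx' a ha)))
  have nat' {Z Z' : Mfd} {f : Z ⟶ Mfd.sphere} {f' : Z' ⟶ Mfd.sphere} (k : Z ⟶ Z')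
      (w : k ≫ f' = f) {x x' : 𝒳.obj} (hx : 𝒳.p.obj x = Z.restr (Mfd.preim f (ann δ)))
      (hx' : 𝒳.p.obj x' = Z'.restr (Mfd.preim f' (ann δ))) (a : x ⟶ x')
      (ha : 𝒳.p.IsHomLift (overSphere k w (ann δ)) a) :
      γ₁.map (annHom δ k w hx hx' a ha) ≫ Λ (annPlot δ f') x' hx' =
        Λ (annPlot δ f) x hx ≫ b.map (θ k w hx hx' a ha) :=
    nat hx hx' (annHom δ k w hx hx' a ha) (θ k w hx hx' a ha) (by subst w; rfl) rfl rfl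
  -- the plots of `D₊`
  let ιp {Z : Mfd} (f : Z ⟶ Mfd.sphere) : plusOfAnn δ (annPlot δ f) ⟶ plusPlot δ f :=
    (⟨Mfd.mapRestr (𝟙 Z) (Mfd.preim f (ann δ)) (Mfd.preim f (discPlus δ)) fun _ h => h.1, rfl⟩ :
      PlotHom _ _)
  let πp {Z Z' : Mfd} {f : Z ⟶ Mfd.sphere} {f' : Z' ⟶ Mfd.sphere} (k : Z ⟶ Z')
      (w : k ≫ f' = f) : plusPlot δ f ⟶ plusPlot δ f' :=
    (⟨overSphere k w (discPlus δ), by subst w; rfl⟩ : PlotHom _ _)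
  have sq {Z Z' : Mfd} {f : Z ⟶ Mfd.sphere} {f' : Z' ⟶ Mfd.sphere} (k : Z ⟶ Z')
      (w : k ≫ f' = f) : overSphere k w (ann δ) ≫ (ιp f').hom = (ιp f).hom ≫ (πp k w).hom := rfl
  let up (A : ClutchObj δ γ₀) :
      pair (plusOfAnn δ (annPlot δ A.f)) (γ₀.obj (annObj δ A.f A.xa A.xa_over)) (γ₀.w_obj _) ⟶
        pair (plusPlot δ A.f) A.xp (ov A) := pairHom (ιp A.f) A.up A.up_lift
  let P {A B : ClutchObj δ γ₀} (k : A.base ⟶ B.base) (w : k ≫ B.f = A.f) (p : A.xp ⟶ B.xp)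
      (hp : 𝒳.p.IsHomLift (overSphere k w (discPlus δ)) p) :
      pair (plusPlot δ A.f) A.xp (ov A) ⟶ pair (plusPlot δ B.f) B.xp (ov B) :=
    pairHom (πp k w) p hp
  have hP {A B : ClutchObj δ γ₀} {k : A.base ⟶ B.base} {w : k ≫ B.f = A.f} {p : A.xp ⟶ B.xp}
      {hp : 𝒳.p.IsHomLift (overSphere k w (discPlus δ)) p} :
      (prod (sub Mfd.sphere (discPlus δ)) 𝒳).p.IsHomLift (overSphere k w (discPlus δ))
        (P k w p hp) := isHomLift_self (P k w p hp)
  -- compatibility with the gluing arrows is equivalent for the two clutching maps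
  have comm {A B : ClutchObj δ γ₀} (k : A.base ⟶ B.base) (w : k ≫ B.f = A.f) (p : A.xp ⟶ B.xp)
      (hp : 𝒳.p.IsHomLift (overSphere k w (discPlus δ)) p) (a : A.xa ⟶ B.xa)
      (ha : 𝒳.p.IsHomLift (overSphere k w (ann δ)) a) :
      γ₀.map (annHom δ k w A.xa_over B.xa_over a ha) ≫ B.up = A.up ≫ p ↔
      γ₁.map (annHom δ k w A.xa_over B.xa_over a ha) ≫
        Λ (annPlot δ B.f) B.xa B.xa_over ≫ b.map (up B) =
        (Λ (annPlot δ A.f) A.xa A.xa_over ≫ b.map (up A)) ≫ b.map (P k w p hp) := by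
    have e₁ : γ₁.map (annHom δ k w A.xa_over B.xa_over a ha) ≫
        Λ (annPlot δ B.f) B.xa B.xa_over ≫ b.map (up B) =
        Λ (annPlot δ A.f) A.xa A.xa_over ≫ b.map (θ k w A.xa_over B.xa_over a ha ≫ up B) := by
      rw [← Category.assoc, nat', b.map_comp, Category.assoc]
    have e₂ : (Λ (annPlot δ A.f) A.xa A.xa_over ≫ b.map (up A)) ≫ b.map (P k w p hp) =
        Λ (annPlot δ A.f) A.xa A.xa_over ≫ b.map (up A ≫ P k w p hp) := by
      rw [b.map_comp, Category.assoc]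
    rw [e₁, e₂]
    have i := h.isIso _ (hΛ (annPlot δ A.f) A.xa A.xa_over)
    constructor
    · intro e
      exact congrArg (fun t => Λ (annPlot δ A.f) A.xa A.xa_over ≫ b.map t) (pairHom_ext rfl e)
    · intro e
      have e₃ := (hb _).hom_ext h
        (φ := θ k w A.xa_over B.xa_over a ha ≫ up B) (φ' := up A ≫ P k w p hp) rfl
        ((cancel_epi (Λ (annPlot δ A.f) A.xa A.xa_over)).1 e)
      exact congrArg (fun t : pair (plusOfAnn δ (annPlot δ A.f))
        (γ₀.obj (annObj δ A.f A.xa A.xa_over)) (γ₀.w_obj _) ⟶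
        pair (plusPlot δ B.f) B.xp (ov B) => t.snd) e₃
  -- Only the component over `D₊` changes, and its gluing arrow accordingly.
  let obj (A : ClutchObj δ γ₀) : ClutchObj δ γ₁ :=
    ⟨A.base, A.f, A.xm, b.obj (pair (plusPlot δ A.f) A.xp (ov A)), A.xa, A.xa_over, A.um,
      A.um_lift, Λ (annPlot δ A.f) A.xa A.xa_over ≫ b.map (up A),
      isHomLift_comp_left (hΛ (annPlot δ A.f) A.xa A.xa_over)
        (isHomLift_map b (isHomLift_self (up A)))⟩
  let map {A B : ClutchObj δ γ₀} (F : ClutchHom A B) : ClutchHom (obj A) (obj B) :=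
    ⟨F.base, F.w, F.m, b.map (P F.base F.w F.p F.p_lift), F.a, F.m_lift,
      isHomLift_map b hP, F.a_lift, F.comm_m,
      (comm F.base F.w F.p F.p_lift F.a F.a_lift).1 F.comm_p⟩
  let T : clutch δ γ₀ ⥤ᵇ clutch δ γ₁ := mkFunctor obj map
    (fun A => ClutchHom.ext rfl rfl (b.map_id _) rfl)
    (fun {A B C} (F : ClutchHom A B) (G : ClutchHom B C) => ClutchHom.ext rfl rfl
      (b.map_comp (P F.base F.w F.p F.p_lift) (P G.base G.w G.p G.p_lift)) rfl)
    (fun {A B} F => isHomLift_self (𝒳 := clutch δ γ₁) (map F))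
  have f₁ : T.toFunctor.Faithful := ⟨fun {A B} F F' e => by
    have e₀ : F.base = F'.base := congrArg (fun t : ClutchHom (obj A) (obj B) => t.base) e
    have e₁ : F.m = F'.m := congrArg (fun t : ClutchHom (obj A) (obj B) => t.m) e
    have e₂ : F.a = F'.a := congrArg (fun t : ClutchHom (obj A) (obj B) => t.a) e
    have e₃ : b.map (P F.base F.w F.p F.p_lift) = b.map (P F'.base F'.w F'.p F'.p_lift) :=
      congrArg (fun t : ClutchHom (obj A) (obj B) => t.p) e
    obtain ⟨k, w, m, p, a, l₁, l₂, l₃, c₁, c₂⟩ := F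
    obtain ⟨k', w', m', p', a', l₁', l₂', l₃', c₁', c₂'⟩ := F'
    obtain rfl : k = k' := e₀
    have e₄ := (hb _).hom_ext h (φ := P k w p l₂) (φ' := P k w' p' l₂') rfl e₃
    exact ClutchHom.ext rfl e₁ (congrArg (fun t : pair (plusPlot δ A.f) A.xp (ov A) ⟶
      pair (plusPlot δ B.f) B.xp (ov B) => t.snd) e₄) e₂⟩
  have f₂ : T.toFunctor.Full := ⟨fun {A B} G => by
    obtain ⟨k, w, m, p, a, l₁, l₂, l₃, c₁, c₂⟩ := G
    obtain ⟨φ, h₁, h₂⟩ := (hb (plusPlot δ A.f)).exists_hom h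
      (A := pair (plusPlot δ A.f) A.xp (ov A)) (B := pair (plusPlot δ B.f) B.xp (ov B))
      (πp k w) p l₂
    have l : 𝒳.p.IsHomLift (overSphere k w (discPlus δ)) φ.snd := by
      have := φ.lift
      rw [h₁] at this
      exact this
    have e : φ = P k w φ.snd l := pairHom_ext h₁ rfl
    rw [e] at h₂
    subst h₂
    exact ⟨⟨k, w, m, φ.snd, a, l₁, l, l₃, c₁, (comm k w φ.snd l a l₃).2 c₂⟩, rfl⟩⟩
  have f₃ : T.toFunctor.EssSurj := ⟨fun B => by
    obtain ⟨Z, f, xm, xp, xa, hxa, um, hum, vp, hvp⟩ := B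
    have o := codomain_eq' hvp
    obtain ⟨x, hx, ν, hν⟩ := (hb (plusPlot δ f)).essSurj xp o
    have i := h.isIso _ hν
    have i' := h.isIso _ (hΛ (annPlot δ f) xa hxa)
    have l := hΛ (annPlot δ f) xa hxa
    obtain ⟨φ, h₁, h₂⟩ := (hb (plusOfAnn δ (annPlot δ f))).exists_hom h
      (A := pair (plusOfAnn δ (annPlot δ f)) (γ₀.obj (annObj δ f xa hxa)) (γ₀.w_obj _))
      (B := pair (plusPlot δ f) x hx) (ιp f) (inv (Λ (annPlot δ f) xa hxa) ≫ vp ≫ inv ν)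
      (isHomLift_comp_left (inferInstance : 𝒳.p.IsHomLift (𝟙 _)
        (inv (Λ (annPlot δ f) xa hxa))) (isHomLift_comp_right hvp inferInstance))
    have hφ := φ.lift
    rw [h₁] at hφ
    let A : ClutchObj δ γ₀ := ⟨Z, f, xm, x, xa, hxa, um, hum, φ.snd, hφ⟩
    have e : up A = φ := pairHom_ext h₁.symm rfl
    have e' : (Λ (annPlot δ f) xa hxa ≫ b.map (up A)) ≫ ν = vp := by
      rw [e, h₂, IsIso.hom_inv_id_assoc, Category.assoc, IsIso.inv_hom_id, Category.comp_id]
    obtain ⟨ν', h₃, h₄⟩ := i.out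
    have e'' : Λ (annPlot δ f) xa hxa ≫ b.map (up A) = vp ≫ ν' := by
      refine Eq.symm (((congrArg (· ≫ ν') e').symm.trans (Category.assoc _ _ _)).trans ?_)
      rw [h₃]
      exact Category.comp_id _
    have hid : γ₁.map (annHom δ (𝟙 Z) (Category.id_comp f) hxa hxa (𝟙 xa) (IsHomLift.id hxa)) =
        𝟙 _ := γ₁.map_id (annObj δ f xa hxa)
    have om : 𝒳.p.obj xm = Z.restr (Mfd.preim f (discMinus δ)) := codomain_eq' hum
    have hν' : 𝒳.p.IsHomLift (𝟙 (Z.restr (Mfd.preim f (discPlus δ)))) ν' :=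
      isHomLift_inverse hν h₃
    let m : ClutchHom (T.obj A) ⟨Z, f, xm, xp, xa, hxa, um, hum, vp, hvp⟩ :=
      ⟨𝟙 Z, Category.id_comp f, 𝟙 xm, ν, 𝟙 xa, IsHomLift.id om, hν, IsHomLift.id hxa,
        (Category.id_comp _).trans (Category.comp_id _).symm,
        ((congrArg (· ≫ vp) hid).trans (Category.id_comp _)).trans e'.symm⟩
    let m' : ClutchHom ⟨Z, f, xm, xp, xa, hxa, um, hum, vp, hvp⟩ (T.obj A) :=
      ⟨𝟙 Z, Category.id_comp f, 𝟙 xm, ν', 𝟙 xa, IsHomLift.id om, hν', IsHomLift.id hxa,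
        (Category.id_comp _).trans (Category.comp_id _).symm,
        ((congrArg (· ≫ (T.obj A).up) hid).trans (Category.id_comp _)).trans e''⟩
    exact ⟨A, ⟨⟨m, m', ClutchHom.ext (Category.comp_id _) (Category.comp_id _) h₃
      (Category.comp_id _), ClutchHom.ext (Category.comp_id _) (Category.comp_id _) h₄
      (Category.comp_id _)⟩⟩⟩⟩
  have f₄ : T.toFunctor.IsEquivalence := { }
  have f₅ : (𝟭 (ofMfd Mfd.sphere).obj).IsEquivalence := inferInstance
  let c : T.comp (clutchProj δ γ₁) ≅ (clutchProj δ γ₀).comp (BasedFunctor.id _) := Iso.refl _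
  exact ⟨⟨T, BasedFunctor.id _, f₄, f₅, c⟩, rfl⟩

/-- Isomorphic clutching maps define isomorphic bundles. -/
theorem bundleEquivalent_of_iso (h : IsCFG 𝒳) (δ : ℝ) {γ₀ γ₁ : prod S1 𝒳 ⥤ᵇ 𝒳} (e : γ₀ ≅ γ₁) :
    BundleEquivalent δ γ₀ γ₁ :=
  bundleEquivalent_of_plus h δ (prodSnd _ _) (fun k => goodAt_prodSnd k)
    (fun q x hx => e.inv.app (pair (thetaPlot δ q) x hx))
    (fun q x hx => e.inv.isHomLift' (pair (thetaPlot δ q) x hx))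
    (fun {q _ x _} hx _ φ _ _ _ h₃ => (e.inv.naturality φ).trans
      (congrArg (e.inv.app (pair (thetaPlot δ q) x hx) ≫ ·) h₃.symm))

end Clutch

/-! ### Functors given by local representatives -/

section Charts

variable {𝒜 : BasedCategory.{v', u'} Mfd} {𝒳 : BasedCategory.{v, u} Mfd}

/-- A functor into a stack from compatible local values: objects have charts, which can be pulled
back, and locally an object has a chart; the functor has a value `E A ρ` on an object `A` with a
chart `ρ`, and the values on two charts of the same object are compared by a cocycle `t`. -/
theorem IsStack.exists_of_charts (h : IsStack 𝒳) (h' : IsCFG 𝒜) {Rep : 𝒜.obj → Type*}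
    (pull : ∀ {A B : 𝒜.obj}, (A ⟶ B) → Rep B → Rep A)
    (dense : ∀ A, ∃ (ι : Type) (U : ι → TopologicalSpace.Opens (𝒜.p.obj A)), IsCover U ∧
      ∀ {R : Mfd} (g : R ⟶ 𝒜.p.obj A), Small U g →
        ∃ (B : 𝒜.obj) (e : B ⟶ A), 𝒜.p.IsHomLift g e ∧ Nonempty (Rep B))
    (E : ∀ A, Rep A → 𝒳.obj)
    (map : ∀ {A B : 𝒜.obj} (φ : A ⟶ B) (ρ : Rep B), E A (pull φ ρ) ⟶ E B ρ)
    (map_lift : ∀ {A B : 𝒜.obj} (φ : A ⟶ B) (ρ : Rep B), 𝒳.p.IsHomLift (𝒜.p.map φ) (map φ ρ))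
    (t : ∀ A (ρ ρ' : Rep A), E A ρ ⟶ E A ρ')
    (t_lift : ∀ A (ρ ρ' : Rep A), 𝒳.p.IsHomLift (𝟙 (𝒜.p.obj A)) (t A ρ ρ'))
    (t_comp : ∀ A (ρ ρ' ρ'' : Rep A), t A ρ ρ' ≫ t A ρ' ρ'' = t A ρ ρ'')
    (nat : ∀ {A B : 𝒜.obj} (φ : A ⟶ B) (ρ ρ' : Rep B),
      t A (pull φ ρ) (pull φ ρ') ≫ map φ ρ' = map φ ρ ≫ t B ρ ρ')
    (map_id : ∀ A (ρ : Rep A), t A ρ (pull (𝟙 A) ρ) ≫ map (𝟙 A) ρ = 𝟙 _)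
    (map_comp : ∀ {A B C : 𝒜.obj} (φ : A ⟶ B) (ψ : B ⟶ C) (ρ : Rep C),
      t A (pull (φ ≫ ψ) ρ) (pull φ (pull ψ ρ)) ≫ map φ (pull ψ ρ) ≫ map ψ ρ = map (φ ≫ ψ) ρ) :
    ∃ (F : 𝒜 ⥤ᵇ 𝒳) (η : ∀ A (ρ : Rep A), F.obj A ⟶ E A ρ),
      (∀ A ρ, 𝒳.p.IsHomLift (𝟙 (𝒜.p.obj A)) (η A ρ)) ∧
      (∀ {A B : 𝒜.obj} (φ : A ⟶ B) (ρ : Rep B),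
        F.map φ ≫ η B ρ = η A (pull φ ρ) ≫ map φ ρ) ∧
      ∀ A (ρ ρ' : Rep A), η A ρ ≫ t A ρ ρ' = η A ρ' := by
  have h₀ := h.toIsCFG
  let J (w : Σ A, Rep A) : 𝒜.obj := w.1
  have t_self (A) (ρ : Rep A) : t A ρ ρ = 𝟙 _ := by
    have := h₀.isIso _ (t_lift A ρ ρ)
    rw [← cancel_mono (t A ρ ρ), t_comp, Category.id_comp]
  have hJ : IsDense J := fun A => by
    obtain ⟨ι, U, hU, H⟩ := dense A
    refine ⟨ι, U, hU, fun g hg => ?_⟩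
    obtain ⟨B, e, he, ⟨ρ⟩⟩ := H g hg
    exact ⟨⟨B, ρ⟩, e, he⟩
  obtain ⟨F, η, hη, hF⟩ := h.exists_extension h' hJ (fun w => E w.1 w.2)
    (fun {w w'} φ => t w.1 w.2 (pull φ w'.2) ≫ map φ w'.2)
    (fun {w w'} φ => isHomLift_comp_left (t_lift _ _ _) (map_lift φ w'.2))
    (fun w => map_id w.1 w.2)
    (fun {w w' w''} φ ψ => by
      show t w.1 w.2 (pull (φ ≫ ψ) w''.2) ≫ map (φ ≫ ψ) w''.2 =
        (t w.1 w.2 (pull φ w'.2) ≫ map φ w'.2) ≫ t w'.1 w'.2 (pull ψ w''.2) ≫ map ψ w''.2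
      have e : (t w.1 w.2 (pull φ w'.2) ≫ map φ w'.2) ≫ t w'.1 w'.2 (pull ψ w''.2) =
          t w.1 w.2 (pull φ (pull ψ w''.2)) ≫ map φ (pull ψ w''.2) := by
        rw [Category.assoc, ← nat, ← Category.assoc, t_comp]
      rw [← map_comp, ← Category.assoc, t_comp, ← Category.assoc (t w.1 w.2 _ ≫ _), e,
        Category.assoc])
  have hF' {w w' : Σ A, Rep A} (φ : w.1 ⟶ w'.1) :
      F.map φ ≫ η w' = η w ≫ t w.1 w.2 (pull φ w'.2) ≫ map φ w'.2 := hF (w := w) (w' := w') φ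
  refine ⟨F, fun A ρ => η ⟨A, ρ⟩, fun A ρ => hη ⟨A, ρ⟩, fun {A B} φ ρ => ?_, fun A ρ ρ' => ?_⟩
  · have := hF' (w := ⟨A, pull φ ρ⟩) (w' := ⟨B, ρ⟩) φ
    rw [this, t_self, Category.id_comp]
  · have e := hF' (w := ⟨A, ρ⟩) (w' := ⟨A, ρ'⟩) (𝟙 A)
    dsimp only at e
    rw [F.map_id, ← t_comp A ρ ρ', Category.assoc, map_id] at e
    exact ((Category.id_comp _).symm.trans (e.trans (by rw [Category.comp_id]))).symm

end Charts

/-! ### Homotopic clutching maps -/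

section Homotopy

variable {𝒳 : BasedCategory.{v, u} Mfd}

theorem isHomLift_of_map_eq {x y : 𝒳.obj} {f : 𝒳.p.obj x ⟶ 𝒳.p.obj y} {φ : x ⟶ y}
    (h : 𝒳.p.map φ = f) : 𝒳.p.IsHomLift f φ := h ▸ isHomLift_self φ

/-- The map `S¹ ⥤ [a, b] × S¹` with constant first component. -/
def insertParam {a b : ℝ} (s : ℝ) (hs : s ∈ Set.Icc a b) : S1 ⥤ᵇ prod (seg a b) S1 :=
  mkFunctor (fun f => pair (K := seg a b) (𝒳 := S1)
      ⟨f.dom, Mfd.const (N := Mfd.line) _ s, fun _ => hs⟩ f rfl)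
    (fun {f f'} φ => pairHom (K := seg a b) (𝒳 := S1) (A := ⟨⟨f.dom, _, _⟩, f, rfl⟩)
      (B := ⟨⟨f'.dom, _, _⟩, f', rfl⟩)
      (PlotHom.mk (a := ⟨f.dom, _, _⟩) (b := ⟨f'.dom, _, _⟩) φ.hom rfl) φ (isHomLift_self φ))
    (fun _ => rfl) (fun _ _ => rfl) (fun _ => isHomLift_of_map_eq rfl)

/-- The member at `s` of a family of maps `S¹ × 𝒳 ⥤ 𝒳` parametrized by `[a, b]`. -/
def atParam {a b : ℝ} (F : prod (prod (seg a b) S1) 𝒳 ⥤ᵇ 𝒳) (s : ℝ) (hs : s ∈ Set.Icc a b) :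
    prod S1 𝒳 ⥤ᵇ 𝒳 :=
  (prodMap (insertParam s hs) (BasedFunctor.id 𝒳)).comp F

/-- The argument of a map into the part of the sphere where `z` is neither `0` nor `∞`. -/
def argPlot {Z : Mfd} (f : Z ⟶ Mfd.sphere) (hf : ∀ z, rho (f.1 z) ≠ 0) : Z ⟶ Mfd.circle :=
  ⟨fun z => (⟨rho (f.1 z) / ‖rho (f.1 z)‖, mem_sphere_zero_iff_norm.2 (by
    rw [norm_div, Complex.norm_real, norm_norm, div_self (norm_ne_zero_iff.2 (hf z))])⟩ : Circle),
  by
    have := finrank_real_complex_fact'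
    have h : ContMDiff 𝓘(ℝ, Z.model) 𝓘(ℝ, ℂ) ∞
        fun z : Z => rho (f.1 z) / ‖rho (f.1 z)‖ := by
      intro x
      have h₁ : ContDiffAt ℝ ∞ (fun z : ℂ => z / ((‖z‖ : ℝ) : ℂ)) (rho (f.1 x)) := by
        have h₂ : ContDiffAt ℝ ∞ (fun z : ℂ => ((‖z‖ : ℝ) : ℂ)) (rho (f.1 x)) :=
          Complex.ofRealCLM.contDiff.contDiffAt.comp _ (contDiffAt_norm ℝ (hf x))
        simp only [div_eq_mul_inv]
        exact contDiffAt_id.mul (h₂.inv (by simpa using hf x))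
      exact h₁.contMDiffAt.comp x
        ((contMDiff_rho.comp f.2 : ContMDiff _ _ ∞ fun z : Z => rho (f.1 z)) x)
    exact h.codRestrict_sphere (n := 1) fun z => mem_sphere_zero_iff_norm.2 (by
      rw [norm_div, Complex.norm_real, norm_norm, div_self (norm_ne_zero_iff.2 (hf z))])⟩

/-- The equation of the sphere, with the first two coordinates as the complex number `rho x`. -/
theorem normSq_rho (x : Mfd.sphere) : ‖rho x‖ ^ 2 = 1 - x.1 2 ^ 2 := by
  have h₀ : ‖x.1‖ = 1 := mem_sphere_zero_iff_norm.1 x.2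
  have h₁ := EuclideanSpace.real_norm_sq_eq x.1
  rw [h₀, Fin.sum_univ_three] at h₁
  have h₂ : ‖rho x‖ ^ 2 = x.1 0 ^ 2 + x.1 1 ^ 2 := by
    rw [← Complex.normSq_eq_norm_sq, Complex.normSq_apply]
    simp [rho]
    ring
  linarith

/-- On the annulus the height is bounded away from `1`. -/
theorem height_lt_of_mem_ann {δ : ℝ} {x : Mfd.sphere} (hx : x ∈ ann δ) :
    x.1 2 < ((1 + δ) ^ 2 - 1) / ((1 + δ) ^ 2 + 1) := by
  obtain ⟨-, h₂⟩ := hx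
  replace h₂ : ‖rho x‖ < (1 + δ) * (1 - x.1 2) := h₂
  have h₃ := normSq_rho x
  have h₄ : ‖rho x‖ ^ 2 < ((1 + δ) * (1 - x.1 2)) ^ 2 :=
    pow_lt_pow_left₀ h₂ (norm_nonneg _) two_ne_zero
  have h₅ : 0 < 1 - x.1 2 := by
    have h₆ : x.1 2 ≠ 1 := by
      intro h
      rw [h] at h₂
      simp at h₂
      exact absurd h₂ (not_lt.2 (norm_nonneg _))
    have h₇ : x.1 2 ≤ 1 := by nlinarith [sq_nonneg ‖rho x‖]
    exact sub_pos.2 (lt_of_le_of_ne h₇ h₆)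
  rw [lt_div_iff₀ (by positivity)]
  nlinarith

/-- A smooth function on the sphere that is `s` near the centre of `D₊` and `t` on the annulus. -/
theorem exists_cutoff (δ : ℝ) {a b s t : ℝ} (hs : s ∈ Set.Icc a b) (ht : t ∈ Set.Icc a b) :
    ∃ (κ : Mfd.sphere ⟶ Mfd.line) (c : ℝ), c < 1 ∧ (∀ x, κ.1 x ∈ Set.Icc (α := ℝ) a b) ∧
      (∀ x : Mfd.sphere, c < x.1 2 → κ.1 x = s) ∧ ∀ x ∈ ann δ, κ.1 x = t := by
  obtain ⟨c, hc⟩ : ∃ c, c = ((1 + δ) ^ 2 - 1) / ((1 + δ) ^ 2 + 1) := ⟨_, rfl⟩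
  have hc₁ : c < 1 := by
    rw [hc, div_lt_one (by positivity)]
    linarith
  let c' : ℝ := (1 + c) / 2
  have hc' : 0 < c' - c := by simp only [c']; linarith
  have h : ContMDiff 𝓘(ℝ, Mfd.sphere.model) 𝓘(ℝ, EuclideanSpace ℝ (Fin 3)) ∞
      fun x : Mfd.sphere => x.1 := contMDiff_coe_sphere (n := 2)
  have h' : ContDiff ℝ ∞ fun y : EuclideanSpace ℝ (Fin 3) =>
      s + (t - s) * Real.smoothTransition ((c' - y 2) / (c' - c)) := by
    refine contDiff_const.add (contDiff_const.mul (Real.smoothTransition.contDiff.comp ?_))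
    exact (contDiff_const.sub (EuclideanSpace.proj (2 : Fin 3) : _ →L[ℝ] ℝ).contDiff).div_const _
  refine ⟨⟨fun x => (s + (t - s) * Real.smoothTransition ((c' - x.1 2) / (c' - c)) : ℝ),
    h'.contMDiff.comp h⟩, c', by simp only [c']; linarith, fun x => ?_, fun x hx => ?_,
    fun x hx => ?_⟩
  · obtain ⟨r, hr⟩ : ∃ r, r = Real.smoothTransition ((c' - x.1 2) / (c' - c)) := ⟨_, rfl⟩
    have h₁ : 0 ≤ r := hr ▸ Real.smoothTransition.nonneg _
    have h₂ : r ≤ 1 := hr ▸ Real.smoothTransition.le_one _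
    show s + (t - s) * Real.smoothTransition ((c' - x.1 2) / (c' - c)) ∈ Set.Icc a b
    rw [← hr]
    obtain ⟨h₃, h₄⟩ := hs
    obtain ⟨h₅, h₆⟩ := ht
    constructor <;> nlinarith
  · show s + (t - s) * Real.smoothTransition ((c' - x.1 2) / (c' - c)) = s
    rw [Real.smoothTransition.zero_of_nonpos
      (div_nonpos_of_nonpos_of_nonneg (by linarith) hc'.le)]
    ring
  · show s + (t - s) * Real.smoothTransition ((c' - x.1 2) / (c' - c)) = t
    rw [Real.smoothTransition.one_of_one_le]
    · ring
    · rw [one_le_div hc']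
      have := height_lt_of_mem_ann hx
      rw [← hc] at this
      linarith

/-- The argument is natural in the plot. -/
theorem comp_argPlot {Z Z' : Mfd} (k : Z ⟶ Z') {f : Z ⟶ Mfd.sphere} {f' : Z' ⟶ Mfd.sphere}
    (w : k ≫ f' = f) (hf : ∀ z, rho (f.1 z) ≠ 0) (hf' : ∀ z, rho (f'.1 z) ≠ 0) :
    k ≫ argPlot f' hf' = argPlot f hf := by
  subst w
  rfl

theorem comp_eq_comp_of_eq_id {C : Type*} [Category* C] {x y : C} {f f' : x ⟶ y}
    (hf : f = f') {e : y ⟶ y} {e' : x ⟶ x} (h : e = 𝟙 y) (h' : e' = 𝟙 x) : f ≫ e = e' ≫ f' := by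
  rw [h, h', Category.comp_id, Category.id_comp, hf]

/-- The clutching maps at two parameters of a smooth family of diffeomorphisms parametrized by
`[a, b] × S¹` define isomorphic bundles.  With a cutoff function `κ`, the automorphism of `D₊ × 𝒳`
is `F (κ, Θ) ∘ F (s, Θ)⁻¹` away from the centre of `D₊` and the identity near it. -/
theorem bundleEquivalent_atParam (h : IsStack 𝒳) (δ : ℝ) {a b : ℝ}
    (F : prod (prod (seg a b) S1) 𝒳 ⥤ᵇ 𝒳) (hF : ∀ k, GoodAt F k) {s t : ℝ}
    (hs : s ∈ Set.Icc a b) (ht : t ∈ Set.Icc a b) :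
    BundleEquivalent δ (atParam F s hs) (atParam F t ht) := by
  have h₀ := h.toIsCFG
  -- `κ` is `s` where the height exceeds `c`, and `t` on the annulus.
  obtain ⟨κ, c, hc, hκ, hκs, hκt⟩ := exists_cutoff δ hs ht
  obtain ⟨G, hG, ⟨ε, hε, hε'⟩, ⟨ζ, hζ, hζ'⟩⟩ := exists_inverse h₀ (F := atParam F s hs)
    fun k => GoodAt.baseChange h₀ (insertParam s hs) (hF _)
  -- `P₀`: the plot stays near the centre of `D₊`; `P₁`: it avoids the centre, where `Θ` is not
  -- defined.
  let P₀ (f : (sub Mfd.sphere (discPlus δ)).obj) : Prop := ∀ z, c < (f.map.1 z).1 2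
  let P₁ (f : (sub Mfd.sphere (discPlus δ)).obj) : Prop := ∀ z, rho (f.map.1 z) ≠ 0
  have hP₀ {f g : (sub Mfd.sphere (discPlus δ)).obj} (φ : f ⟶ g) (hg : P₀ g) : P₀ f :=
    fun z => by rw [← φ.w]; exact hg _
  have hP₁ {f g : (sub Mfd.sphere (discPlus δ)).obj} (φ : f ⟶ g) (hg : P₁ g) : P₁ f :=
    fun z => by rw [← φ.w]; exact hg _
  -- the argument and the cutoff function of a plot
  let Θ (f : (sub Mfd.sphere (discPlus δ)).obj) (hf : P₁ f) : S1.obj :=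
    ⟨f.dom, argPlot f.map hf, fun _ => trivial⟩
  let ΘM {f g : (sub Mfd.sphere (discPlus δ)).obj} (hf : P₁ f) (hg : P₁ g) (φ : f ⟶ g) :
      Θ f hf ⟶ Θ g hg :=
    PlotHom.mk (a := Θ f hf) (b := Θ g hg) φ.hom (comp_argPlot φ.hom φ.w hf hg)
  let T (f : (sub Mfd.sphere (discPlus δ)).obj) (hf : P₁ f) : (prod (seg a b) S1).obj :=
    pair (K := seg a b) (𝒳 := S1) ⟨f.dom, f.map ≫ κ, fun z => hκ _⟩ (Θ f hf) rfl
  let TM {f g : (sub Mfd.sphere (discPlus δ)).obj} (hf : P₁ f) (hg : P₁ g) (φ : f ⟶ g) :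
      T f hf ⟶ T g hg :=
    pairHom (K := seg a b) (𝒳 := S1) (A := T f hf) (B := T g hg)
      (PlotHom.mk (a := (T f hf).fst) (b := (T g hg).fst) φ.hom
        ((Category.assoc _ _ _).symm.trans (congrArg (· ≫ κ) φ.w))) (ΘM hf hg φ)
      (isHomLift_self (𝒳 := S1) (ΘM hf hg φ))
  -- `(Θ, x)` and `((κ, Θ), F (s, Θ)⁻¹ x)`
  let Q (A : (prod (sub Mfd.sphere (discPlus δ)) 𝒳).obj) (hA : P₁ A.fst) : (prod S1 𝒳).obj :=
    pair (Θ A.fst hA) A.snd A.eq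
  let QM {A B : (prod (sub Mfd.sphere (discPlus δ)) 𝒳).obj} (hA : P₁ A.fst) (hB : P₁ B.fst)
      (φ : A ⟶ B) : Q A hA ⟶ Q B hB := pairHom (ΘM hA hB φ.fst) φ.snd φ.lift
  let V (A : (prod (sub Mfd.sphere (discPlus δ)) 𝒳).obj) (hA : P₁ A.fst) :
      (prod (prod (seg a b) S1) 𝒳).obj := pair (T A.fst hA) (G.obj (Q A hA)) (G.w_obj _)
  let VM {A B : (prod (sub Mfd.sphere (discPlus δ)) 𝒳).obj} (hA : P₁ A.fst) (hB : P₁ B.fst)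
      (φ : A ⟶ B) : V A hA ⟶ V B hB := pairHom (TM hA hB φ.fst) (G.map (QM hA hB φ))
        (isHomLift_map G (isHomLift_self (QM hA hB φ)))
  have VM_id {A : (prod (sub Mfd.sphere (discPlus δ)) 𝒳).obj} (hA : P₁ A.fst) :
      VM hA hA (𝟙 A) = 𝟙 _ := pairHom_ext rfl (G.map_id _)
  have VM_comp {A B C : (prod (sub Mfd.sphere (discPlus δ)) 𝒳).obj} (hA : P₁ A.fst)
      (hB : P₁ B.fst) (hC : P₁ C.fst) (φ : A ⟶ B) (ψ : B ⟶ C) :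
      VM hA hC (φ ≫ ψ) = VM hA hB φ ≫ VM hB hC ψ :=
    pairHom_ext rfl (G.map_comp (QM hA hB φ) (QM hB hC ψ))
  have hVM {A B : (prod (sub Mfd.sphere (discPlus δ)) 𝒳).obj} (hA : P₁ A.fst) (hB : P₁ B.fst)
      (φ : A ⟶ B) : 𝒳.p.IsHomLift φ.fst.hom (F.map (VM hA hB φ)) :=
    isHomLift_map F (isHomLift_self (VM hA hB φ))
  -- arrows that change the first component to a constant function with the same values
  have exC (A : (prod (sub Mfd.sphere (discPlus δ)) 𝒳).obj) (h₁ : P₁ A.fst) (r : ℝ)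
      (hr : r ∈ Set.Icc a b) (e : ∀ z, κ.1 (A.fst.map.1 z) = r) {y x : 𝒳.obj}
      (hy : 𝒳.p.obj y = A.fst.dom) (hx : 𝒳.p.obj x = A.fst.dom) (n : y ⟶ x)
      (hn : 𝒳.p.IsHomLift (𝟙 A.fst.dom) n) : ∃ m : pair (T A.fst h₁) y hy ⟶
        (prodMap (insertParam r hr) (BasedFunctor.id 𝒳)).obj (pair (Θ A.fst h₁) x hx),
        m.fst.fst.hom = 𝟙 _ ∧ m.fst.snd = 𝟙 _ ∧ m.snd = n := by
    let m₀ : T A.fst h₁ ⟶ (insertParam r hr).obj (Θ A.fst h₁) :=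
      pairHom (K := seg a b) (𝒳 := S1) (A := T A.fst h₁)
        (B := (insertParam r hr).obj (Θ A.fst h₁))
        (PlotHom.mk (a := (T A.fst h₁).fst) (b := ((insertParam r hr).obj (Θ A.fst h₁)).fst)
          (𝟙 A.fst.dom) (Subtype.ext (funext fun z => (e z).symm))) (𝟙 (Θ A.fst h₁))
          (IsHomLift.id rfl)
    refine ⟨pairHom (A := pair (T A.fst h₁) y hy)
      (B := (prodMap (insertParam r hr) (BasedFunctor.id 𝒳)).obj (pair (Θ A.fst h₁) x hx))
      m₀ n hn, rfl, rfl, rfl⟩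
  -- near the centre of the disc the second expression is isomorphic to the identity
  have exτ (A : (prod (sub Mfd.sphere (discPlus δ)) 𝒳).obj) (h₀ : P₀ A.fst) (h₁ : P₁ A.fst) :
      ∃ m : V A h₁ ⟶ (prodMap (insertParam s hs) (BasedFunctor.id 𝒳)).obj
        (pair (Θ A.fst h₁) (G.obj (Q A h₁)) (G.w_obj _)),
        m.fst.fst.hom = 𝟙 _ ∧ m.fst.snd = 𝟙 _ ∧ m.snd = 𝟙 _ :=
    exC A h₁ s hs (fun z => hκs _ (h₀ z)) _ _ _ (IsHomLift.id (G.w_obj _))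
  choose m hm₁ hm₂ hm₃ using exτ
  obtain ⟨τ, hτ⟩ : ∃ τ : ∀ (A : (prod (sub Mfd.sphere (discPlus δ)) 𝒳).obj) (h₀ : P₀ A.fst)
      (h₁ : P₁ A.fst), F.obj (V A h₁) ⟶ A.snd, ∀ A h₀ h₁,
      τ A h₀ h₁ = CategoryStruct.comp (Z := A.snd) (F.map (m A h₀ h₁)) (ε (Q A h₁)) :=
    ⟨fun A h₀ h₁ => CategoryStruct.comp (Z := A.snd) (F.map (m A h₀ h₁)) (ε (Q A h₁)),
      fun _ _ _ => rfl⟩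
  have τ_lift (A h₀ h₁) : 𝒳.p.IsHomLift (𝟙 A.fst.dom) (τ A h₀ h₁) := by
    rw [hτ]
    refine isHomLift_comp_left (isHomLift_map F (isHomLift_of_fst (isHomLift_of_fst ?_)))
      (hε (Q A h₁))
    exact isHomLift_of_map_eq (hm₁ A h₀ h₁)
  have τ_nat {A B : (prod (sub Mfd.sphere (discPlus δ)) 𝒳).obj} (hA : P₀ A.fst) (hA' : P₁ A.fst)
      (hB : P₀ B.fst) (hB' : P₁ B.fst) (φ : A ⟶ B) :
      F.map (VM hA' hB' φ) ≫ τ B hB hB' = τ A hA hA' ≫ φ.snd := by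
    let θ : pair (Θ A.fst hA') (G.obj (Q A hA')) (G.w_obj _) ⟶
        pair (Θ B.fst hB') (G.obj (Q B hB')) (G.w_obj _) :=
      pairHom (ΘM hA' hB' φ.fst) (G.map (QM hA' hB' φ))
        (isHomLift_map G (isHomLift_self (QM hA' hB' φ)))
    have e₁ : F.map ((prodMap (insertParam s hs) (BasedFunctor.id 𝒳)).map θ) ≫ ε (Q B hB') =
        ε (Q A hA') ≫ φ.snd := hε' (QM hA' hB' φ) θ rfl rfl
    have e₂ : VM hA' hB' φ ≫ m B hB hB' =
        m A hA hA' ≫ (prodMap (insertParam s hs) (BasedFunctor.id 𝒳)).map θ :=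
      pairHom_ext (pairHom_ext (PlotHom.ext
        (comp_eq_comp_of_eq_id (f := φ.fst.hom) rfl (hm₁ B hB hB') (hm₁ A hA hA')))
        (comp_eq_comp_of_eq_id (f := ΘM hA' hB' φ.fst) rfl (hm₂ B hB hB') (hm₂ A hA hA')))
        (comp_eq_comp_of_eq_id (f := G.map (QM hA' hB' φ)) rfl (hm₃ B hB hB') (hm₃ A hA hA'))
    rw [hτ, hτ]
    refine (Category.assoc _ _ _).symm.trans (.trans ?_ (Category.assoc _ _ _).symm)
    rw [← F.map_comp, e₂, F.map_comp]
    refine (Category.assoc _ _ _).trans ?_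
    exact congrArg (F.map (m A hA hA') ≫ ·) e₁
  have τ_iso (A h₀' h₁) : IsIso (τ A h₀' h₁) := h₀.isIso _ (τ_lift A h₀' h₁)
  have τ_nat' {A B : (prod (sub Mfd.sphere (discPlus δ)) 𝒳).obj} (hA : P₀ A.fst) (hA' : P₁ A.fst)
      (hB : P₀ B.fst) (hB' : P₁ B.fst) (φ : A ⟶ B) :
      inv (τ A hA hA') ≫ F.map (VM hA' hB' φ) = φ.snd ≫ inv (τ B hB hB') := by
    rw [IsIso.inv_comp_eq, ← Category.assoc, IsIso.eq_comp_inv, τ_nat hA hA' hB hB']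
  have cover (f : (sub Mfd.sphere (discPlus δ)).obj) : ∃ (ι : Type)
      (U : ι → TopologicalSpace.Opens f.dom), IsCover U ∧
        ∀ (g : (sub Mfd.sphere (discPlus δ)).obj) (e : g ⟶ f), Small U e.hom → P₀ g ∨ P₁ g := by
    refine ⟨Bool, fun i => Mfd.preim f.map (bif i then ⟨{x | c < x.1 2},
        isOpen_lt continuous_const (continuous_coord 2)⟩ else ⟨{x | rho x ≠ 0},
        isOpen_ne_fun continuous_rho continuous_const⟩), fun z => ?_, ?_⟩
    · by_cases hz : rho (f.map.1 z) = 0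
      · refine ⟨true, ?_⟩
        show c < (f.map.1 z).1 2
        have h₁ : ‖rho (f.map.1 z)‖ < (1 + δ) * (1 + (f.map.1 z).1 2) := f.mem z
        have h₂ := normSq_rho (f.map.1 z)
        rw [hz, norm_zero] at h₁ h₂
        have h₃ : ((f.map.1 z).1 2 - 1) * ((f.map.1 z).1 2 + 1) = 0 := by linarith
        rcases mul_eq_zero.1 h₃ with h₄ | h₄
        · linarith
        · rw [add_comm 1 ((f.map.1 z).1 2), h₄, mul_zero] at h₁
          exact absurd h₁ (lt_irrefl _)
      · exact ⟨false, hz⟩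
    · rintro g e ⟨i, hi⟩
      cases i
      · exact .inr fun z => by rw [← e.w]; exact hi z
      · exact .inl fun z => by rw [← e.w]; exact hi z
  -- The automorphism `β`, glued from the identity on the plots near the centre and
  -- `F (κ, Θ) ∘ F (s, Θ)⁻¹` on the plots that avoid the centre.  On the overlap `κ = s`, and `τ`
  -- compares the two.
  obtain ⟨β, η, hη, hβ, -⟩ := h.exists_of_charts (𝒜 := prod (sub Mfd.sphere (discPlus δ)) 𝒳)
    (prod_isCFG (sub_isCFG _ _) h₀) (Rep := fun A => PSum (P₀ A.fst) (P₁ A.fst))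
    (fun φ ρ => match ρ with
      | .inl h => .inl (hP₀ φ.fst h)
      | .inr h => .inr (hP₁ φ.fst h))
    (fun A => by
      obtain ⟨ι, U, hU, H⟩ := cover A.fst
      refine ⟨ι, U, hU, fun {R} g hg => ?_⟩
      obtain ⟨B, e, he, -⟩ := pair_exists (sub_isCFG _ _) h₀ A g
      refine ⟨B, e, isHomLift_of_fst he, ?_⟩
      rcases H _ e.fst (small_map he hg) with h | h
      exacts [⟨.inl h⟩, ⟨.inr h⟩])
    (fun A ρ => match ρ with
      | .inl _ => A.snd
      | .inr h => F.obj (V A h))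
    (fun {A B} φ ρ => match ρ with
      | .inl _ => φ.snd
      | .inr h => F.map (VM (hP₁ φ.fst h) h φ))
    (fun {A B} φ ρ => match ρ with
      | .inl _ => φ.lift
      | .inr h => hVM _ _ φ)
    (fun A ρ ρ' => match ρ, ρ' with
      | .inl _, .inl _ => 𝟙 _
      | .inl h, .inr h' => inv (τ A h h')
      | .inr h', .inl h => τ A h h'
      | .inr _, .inr _ => 𝟙 _)
    (fun A ρ ρ' => match ρ, ρ' with
      | .inl _, .inl _ => IsHomLift.id A.eq
      | .inl h, .inr h' => by
        have := τ_lift A h h'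
        exact isHomLift_inverse (τ_lift A h h') (IsIso.hom_inv_id _)
      | .inr h', .inl h => τ_lift A h h'
      | .inr h', .inr _ => IsHomLift.id (F.w_obj (V A h')))
    (fun A ρ ρ' ρ'' => by
      rcases ρ with h | h <;> rcases ρ' with h' | h' <;> rcases ρ'' with h'' | h'' <;> simp)
    (fun {A B} φ ρ ρ' => by
      rcases ρ with h | h <;> rcases ρ' with h' | h'
      · exact (Category.id_comp _).trans (Category.comp_id _).symm
      · exact τ_nat' _ _ _ _ φ
      · exact (τ_nat _ _ _ _ φ).symm
      · exact (Category.id_comp _).trans (Category.comp_id _).symm)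
    (fun A ρ => by
      rcases ρ with h | h
      · exact Category.id_comp _
      · exact (Category.id_comp _).trans ((congrArg F.map (VM_id h)).trans (F.map_id _)))
    (fun {A B C} φ ψ ρ => by
      rcases ρ with h | h
      · exact Category.id_comp _
      · exact (Category.id_comp _).trans ((F.map_comp _ _).symm.trans (congrArg F.map
          (VM_comp (hP₁ φ.fst (hP₁ ψ.fst h)) (hP₁ ψ.fst h) h φ ψ).symm)))
  have good (k) : GoodAt β k := by
    obtain ⟨ι, U, hU, H⟩ := cover k
    refine GoodAt.of_local h (sub_isCFG _ _) hU fun k' e he => ?_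
    rcases H k' e he with hk | hk
    · exact GoodAt.of_isIso h₀ (G := prodSnd (sub Mfd.sphere (discPlus δ)) 𝒳) (l := k') rfl
        (fun x hx => η (pair k' x hx) (.inl hk)) (fun x hx => hη (pair k' x hx) (.inl hk))
        (fun {x x'} hx hx' φ φ' h₁ h₂ h₃ => (hβ φ (.inl hk)).trans
          (congrArg (η (pair k' x hx) (.inl hk) ≫ ·) h₃)) (goodAt_prodSnd k')
    · refine GoodAt.of_isIso h₀ (G := (graph ((prodMap (prodSnd (seg a b) S1)
        (BasedFunctor.id 𝒳)).comp G)).comp F) (l := T k' hk) rfl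
        (fun x hx => η (pair k' x hx) (.inr hk)) (fun x hx => hη (pair k' x hx) (.inr hk))
        (fun {x x'} hx hx' φ φ' h₁ h₂ h₃ => (hβ φ (.inr hk)).trans
          (congrArg (η (pair k' x hx) (.inr hk) ≫ ·) (congrArg F.map (pairHom_ext ?_ ?_))))
        (GoodAt.comp (GoodAt.baseChange h₀ (prodSnd (seg a b) S1) (hG _)) (hF _))
      · exact (congrArg (TM hk hk) h₁).trans (Eq.trans rfl h₂.symm)
      · exact congrArg G.map (pairHom_ext ((congrArg (ΘM hk hk) h₁).trans
          (congrArg ProdHom.snd h₂).symm) h₃)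
  -- comparison on the annulus
  have mem (q : (ofMfd (Mfd.sphere.restr (ann δ))).obj) : P₁ (plusOfAnn δ q) :=
    fun z => rho_ne_zero (q.map.1 z)
  let Fs : prod S1 𝒳 ⥤ᵇ 𝒳 := atParam F s hs
  let Ft : prod S1 𝒳 ⥤ᵇ 𝒳 := atParam F t ht
  let O (q : (ofMfd (Mfd.sphere.restr (ann δ))).obj) (x : 𝒳.obj) (hx : 𝒳.p.obj x = q.dom) :
      (prod (sub Mfd.sphere (discPlus δ)) 𝒳).obj :=
    pair (plusOfAnn δ q) (Fs.obj (pair (thetaPlot δ q) x hx)) (Fs.w_obj _)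
  -- On the annulus `κ = t`, so `β (F (s, Θ) x) = F (t, Θ) (F (s, Θ)⁻¹ (F (s, Θ) x))`, which is
  -- compared with `F (t, Θ) x` by `ζ`.
  have exW (q : (ofMfd (Mfd.sphere.restr (ann δ))).obj) (x : 𝒳.obj) (hx : 𝒳.p.obj x = q.dom) :=
    exC (O q x hx) (mem q) t ht (fun z => hκt _ (q.map.1 z).2) (G.w_obj (Q (O q x hx) (mem q))) hx
      (ζ (pair (thetaPlot δ q) x hx)) (hζ (pair (thetaPlot δ q) x hx))
  choose w hw₁ hw₂ hw₃ using exW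
  obtain ⟨ν, hν⟩ : ∃ ν : ∀ (q : (ofMfd (Mfd.sphere.restr (ann δ))).obj) (x : 𝒳.obj)
      (hx : 𝒳.p.obj x = q.dom), β.obj (O q x hx) ⟶ Ft.obj (pair (thetaPlot δ q) x hx),
      ∀ q x hx, ν q x hx = η (O q x hx) (.inr (mem q)) ≫ F.map (w q x hx) :=
    ⟨fun q x hx => η (O q x hx) (.inr (mem q)) ≫ F.map (w q x hx), fun _ _ _ => rfl⟩
  have ν_lift (q x hx) : 𝒳.p.IsHomLift (𝟙 q.dom) (ν q x hx) := by
    rw [hν]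
    refine isHomLift_comp_left (hη (O q x hx) (.inr (mem q)))
      (isHomLift_map F (isHomLift_of_fst (isHomLift_of_fst ?_)))
    exact isHomLift_of_map_eq (hw₁ q x hx)
  have ν_iso (q x hx) : IsIso (ν q x hx) := h₀.isIso _ (ν_lift q x hx)
  refine bundleEquivalent_of_plus h₀ δ β good (fun q x hx => inv (ν q x hx))
    (fun q x hx => isHomLift_inverse (ν_lift q x hx) (IsIso.hom_inv_id _))
    (fun {q q' x x'} hx hx' φ θ h₁ h₂ h₃ => ?_)
  have e : β.map θ ≫ ν q' x' hx' = ν q x hx ≫ Ft.map φ := by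
    have e₁ : β.map θ ≫ η (O q' x' hx') (.inr (mem q')) =
        η (O q x hx) (.inr (mem q)) ≫ F.map (VM (mem q) (mem q') θ) := hβ θ (.inr (mem q'))
    have e₂ : ΘM (mem q) (mem q') θ.fst = φ.fst := PlotHom.ext h₂
    have e₃ : G.map (QM (mem q) (mem q') θ) ≫ ζ (pair (thetaPlot δ q') x' hx') =
        ζ (pair (thetaPlot δ q) x hx) ≫ φ.snd := hζ' φ (QM (mem q) (mem q') θ) e₂ h₃
    have e₄ : VM (mem q) (mem q') θ ≫ w q' x' hx' =
        w q x hx ≫ (prodMap (insertParam t ht) (BasedFunctor.id 𝒳)).map φ := by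
      refine pairHom_ext (pairHom_ext (PlotHom.ext ?_) ?_) ?_
      · exact comp_eq_comp_of_eq_id (f := θ.fst.hom) h₂ (hw₁ q' x' hx') (hw₁ q x hx)
      · exact comp_eq_comp_of_eq_id (f := ΘM (mem q) (mem q') θ.fst) e₂ (hw₂ q' x' hx')
          (hw₂ q x hx)
      · exact (congrArg (G.map (QM (mem q) (mem q') θ) ≫ ·) (hw₃ q' x' hx')).trans
          (e₃.trans (congrArg (· ≫ φ.snd) (hw₃ q x hx)).symm)
    have e₅ : F.map (VM (mem q) (mem q') θ) ≫ F.map (w q' x' hx') =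
        F.map (w q x hx) ≫ Ft.map φ :=
      (F.map_comp _ _).symm.trans ((congrArg F.map e₄).trans (F.map_comp _ _))
    rw [hν, hν]
    exact (Category.assoc _ _ _).symm.trans ((congrArg (· ≫ F.map (w q' x' hx')) e₁).trans
      ((Category.assoc _ _ _).trans ((congrArg (η (O q x hx) (.inr (mem q)) ≫ ·) e₅).trans
        (Category.assoc _ _ _).symm)))
  refine (IsIso.comp_inv_eq (ν q' x' hx')).2 (.trans ?_ (Category.assoc _ _ _).symm)
  refine Eq.trans ?_ (congrArg (inv (ν q x hx) ≫ ·) e).symm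
  exact (IsIso.inv_hom_id_assoc (ν q x hx) (Ft.map φ)).symm

end Homotopy

/-! ### Charts of piecewise smooth loops -/

/-- The value of a smooth function as a real number. -/
def lineVal {Z : Mfd} (τ : Z ⟶ Mfd.line) (z : Z) : ℝ := τ.1 z

/-- The universal covering of the circle. -/
def expLine : Mfd.line ⟶ Mfd.circle :=
  ⟨fun t : ℝ => Circle.exp (2 * Real.pi * t), contMDiff_exp⟩

namespace PiecewiseLoop

variable {K : BasedCategory.{0, 1} Mfd} {𝒳 : BasedCategory.{v, u} Mfd} (P : PiecewiseLoop K 𝒳)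

/-- A smooth function on the base of `k` with values in one of the intervals of the partition. -/
structure Chart (k : K.obj) where
  idx : Fin (P.n + 1)
  par : K.p.obj k ⟶ Mfd.line
  mem : ∀ z, par.1 z ∈ Set.Icc (α := ℝ) (P.t idx.castSucc) (P.t idx.succ)

variable {P} {k k' k'' : K.obj}

/-- The object of the parameter stack of a piece that a chart defines. -/
abbrev Chart.plot (c : P.Chart k) :
    (prod K (seg (P.t c.idx.castSucc) (P.t c.idx.succ))).obj :=
  pair k (⟨K.p.obj k, c.par, c.mem⟩ : PlotObj Mfd.line _) rfl

/-- The value of the loop on a chart and an object of `𝒳`. -/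
abbrev Chart.val (c : P.Chart k) (x : 𝒳.obj) (hx : 𝒳.p.obj x = K.p.obj k) : 𝒳.obj :=
  (P.piece c.idx).obj (pair c.plot x hx)

/-- The chart `c` is the pullback of the chart `c'`. -/
structure IsPull (g : k ⟶ k') (c : P.Chart k) (c' : P.Chart k') : Prop where
  idx : c.idx = c'.idx
  par : K.p.map g ≫ c'.par = c.par

/-- The pullback of a chart. -/
def Chart.pull (g : k ⟶ k') (c : P.Chart k') : P.Chart k :=
  ⟨c.idx, K.p.map g ≫ c.par, fun _ => c.mem _⟩

theorem isPull_pull (g : k ⟶ k') (c : P.Chart k') : IsPull g (c.pull g) c := ⟨rfl, rfl⟩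

theorem IsPull.eq {g : k ⟶ k'} {c c₁ : P.Chart k} {c' : P.Chart k'} (h : IsPull g c c')
    (h₁ : IsPull g c₁ c') : c = c₁ := by
  obtain ⟨i, τ, hτ⟩ := c
  obtain ⟨j, τ', hτ'⟩ := c₁
  obtain ⟨rfl, rfl⟩ := h
  obtain ⟨h₂, rfl⟩ := h₁
  obtain rfl : j = _ := h₂
  rfl

theorem IsPull.comp {g : k ⟶ k'} {g' : k' ⟶ k''} {c : P.Chart k} {c' : P.Chart k'}
    {c'' : P.Chart k''} (h : IsPull g c c') (h' : IsPull g' c' c'') : IsPull (g ≫ g') c c'' :=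
  ⟨h.idx.trans h'.idx, by rw [K.p.map_comp, Category.assoc, h'.par, h.par]⟩

theorem isPull_id (c : P.Chart k) : IsPull (𝟙 k) c c :=
  ⟨rfl, by rw [K.p.map_id, Category.id_comp]⟩

/-- The arrow between the values of the loop on a chart and on its pullback. -/
def valMap {g : k ⟶ k'} : ∀ {c : P.Chart k} {c' : P.Chart k'} (_ : IsPull g c c') {x x' : 𝒳.obj}
    (hx : 𝒳.p.obj x = K.p.obj k) (hx' : 𝒳.p.obj x' = K.p.obj k') (u : x ⟶ x')
    (_ : 𝒳.p.IsHomLift (K.p.map g) u), c.val x hx ⟶ c'.val x' hx'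
  | ⟨i, τ, hτ⟩, ⟨_, τ', hτ'⟩, ⟨rfl, w⟩, x, x', hx, hx', u, hu =>
    (P.piece i).map (pairHom (A := pair (Chart.plot ⟨i, τ, hτ⟩) x hx)
      (B := pair (Chart.plot ⟨i, τ', hτ'⟩) x' hx')
      (pairHom (A := Chart.plot ⟨i, τ, hτ⟩) (B := Chart.plot ⟨i, τ', hτ'⟩) g
        (PlotHom.mk (a := ⟨K.p.obj k, τ, hτ⟩) (b := ⟨K.p.obj k', τ', hτ'⟩) (K.p.map g) w)
        (isHomLift_of_map_eq (𝒳 := seg _ _) rfl)) u hu)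

/-- The defining equation of `valMap` on charts with syntactically equal index. -/
theorem valMap_mk {g : k ⟶ k'} {i : Fin (P.n + 1)} {τ : K.p.obj k ⟶ Mfd.line}
    {τ' : K.p.obj k' ⟶ Mfd.line}
    (hτ : ∀ z, τ.1 z ∈ Set.Icc (α := ℝ) (P.t i.castSucc) (P.t i.succ))
    (hτ' : ∀ z, τ'.1 z ∈ Set.Icc (α := ℝ) (P.t i.castSucc) (P.t i.succ))
    (h : IsPull (P := P) g ⟨i, τ, hτ⟩ ⟨i, τ', hτ'⟩) {x x' : 𝒳.obj}
    (hx : 𝒳.p.obj x = K.p.obj k) (hx' : 𝒳.p.obj x' = K.p.obj k') (u : x ⟶ x')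
    (hu : 𝒳.p.IsHomLift (K.p.map g) u) : valMap h hx hx' u hu =
      (P.piece i).map (pairHom (A := pair (Chart.plot ⟨i, τ, hτ⟩) x hx)
      (B := pair (Chart.plot ⟨i, τ', hτ'⟩) x' hx')
      (pairHom (A := Chart.plot ⟨i, τ, hτ⟩) (B := Chart.plot ⟨i, τ', hτ'⟩) g
        (PlotHom.mk (a := ⟨K.p.obj k, τ, hτ⟩) (b := ⟨K.p.obj k', τ', hτ'⟩) (K.p.map g) h.par)
        (isHomLift_of_map_eq (𝒳 := seg _ _) rfl)) u hu) := by
  obtain ⟨h₁, h₂⟩ := h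
  rfl

theorem valMap_lift {g : k ⟶ k'} {c : P.Chart k} {c' : P.Chart k'} (h : IsPull g c c')
    {x x' : 𝒳.obj} (hx : 𝒳.p.obj x = K.p.obj k) (hx' : 𝒳.p.obj x' = K.p.obj k') (u : x ⟶ x')
    (hu : 𝒳.p.IsHomLift (K.p.map g) u) : 𝒳.p.IsHomLift (K.p.map g) (valMap h hx hx' u hu) := by
  obtain ⟨i, τ, hτ⟩ := c
  obtain ⟨j, τ', hτ'⟩ := c'
  obtain rfl : i = j := h.idx
  rw [valMap_mk]
  exact isHomLift_map (P.piece i) (isHomLift_of_fst (isHomLift_of_fst (isHomLift_self g)))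

theorem valMap_comp {g : k ⟶ k'} {g' : k' ⟶ k''} {c : P.Chart k} {c' : P.Chart k'}
    {c'' : P.Chart k''} (h : IsPull g c c') (h' : IsPull g' c' c'') (h'' : IsPull (g ≫ g') c c'')
    {x x' x'' : 𝒳.obj} (hx : 𝒳.p.obj x = K.p.obj k) (hx' : 𝒳.p.obj x' = K.p.obj k')
    (hx'' : 𝒳.p.obj x'' = K.p.obj k'') (u : x ⟶ x') (hu : 𝒳.p.IsHomLift (K.p.map g) u)
    (u' : x' ⟶ x'') (hu' : 𝒳.p.IsHomLift (K.p.map g') u') {u'' : x ⟶ x''}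
    (hu'' : 𝒳.p.IsHomLift (K.p.map (g ≫ g')) u'') (e : u ≫ u' = u'') :
    valMap h hx hx' u hu ≫ valMap h' hx' hx'' u' hu' = valMap h'' hx hx'' u'' hu'' := by
  subst e
  obtain ⟨i, τ, hτ⟩ := c
  obtain ⟨j, τ', hτ'⟩ := c'
  obtain ⟨l, τ'', hτ''⟩ := c''
  obtain rfl : i = j := h.idx
  obtain rfl : i = l := h'.idx
  rw [valMap_mk, valMap_mk, valMap_mk]
  exact ((P.piece i).map_comp _ _).symm.trans (congrArg (P.piece i).map
    (pairHom_ext (pairHom_ext rfl (PlotHom.ext (K.p.map_comp g g').symm)) rfl))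

theorem valMap_id {c : P.Chart k} (h : IsPull (𝟙 k) c c) {x : 𝒳.obj}
    (hx : 𝒳.p.obj x = K.p.obj k) (hu : 𝒳.p.IsHomLift (K.p.map (𝟙 k)) (𝟙 x)) :
    valMap h hx hx (𝟙 x) hu = 𝟙 _ := by
  obtain ⟨i, τ, hτ⟩ := c
  rw [valMap_mk]
  refine Eq.trans (congrArg (P.piece i).map ?_) ((P.piece i).map_id _)
  exact pairHom_ext (pairHom_ext rfl (PlotHom.ext (K.p.map_id k))) rfl

/-- The chart given by a constant function. -/
abbrev constChart (k : K.obj) (l : Fin (P.n + 1)) (τ : ℝ)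
    (h : τ ∈ Set.Icc (P.t l.castSucc) (P.t l.succ)) : P.Chart k :=
  ⟨l, Mfd.const (N := Mfd.line) _ τ, fun _ => h⟩

theorem isPull_const (g : k ⟶ k') (l : Fin (P.n + 1)) (τ : ℝ)
    (h : τ ∈ Set.Icc (P.t l.castSucc) (P.t l.succ)) :
    IsPull g (constChart k l τ h) (constChart k' l τ h) := ⟨rfl, rfl⟩

section Jump

variable {l m : Fin (P.n + 1)} {τ σ : ℝ} {h : τ ∈ Set.Icc (P.t l.castSucc) (P.t l.succ)}
  {h' : σ ∈ Set.Icc (P.t m.castSucc) (P.t m.succ)}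

/-- The arrow between the values on constant charts that a 2-isomorphism between the restrictions
of two pieces defines. -/
def jump (θ : evalAt (P.piece l) τ h ≅ evalAt (P.piece m) σ h') (k : K.obj) (x : 𝒳.obj)
    (hx : 𝒳.p.obj x = K.p.obj k) :
    (constChart k l τ h).val x hx ⟶ (constChart k m σ h').val x hx :=
  θ.hom.app (pair k x hx)

variable (θ : evalAt (P.piece l) τ h ≅ evalAt (P.piece m) σ h')

theorem jump_lift (x : 𝒳.obj) (hx : 𝒳.p.obj x = K.p.obj k) :
    𝒳.p.IsHomLift (𝟙 (K.p.obj k)) (jump θ k x hx) :=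
  θ.hom.isHomLift' (pair k x hx)

/-- Naturality of the 2-isomorphism `θ` in the parameter and in the object of `𝒳`. -/
theorem valMap_jump {g : k ⟶ k'} {x x' : 𝒳.obj} (hx : 𝒳.p.obj x = K.p.obj k)
    (hx' : 𝒳.p.obj x' = K.p.obj k') (u : x ⟶ x') (hu : 𝒳.p.IsHomLift (K.p.map g) u) :
    valMap (isPull_const g l τ h) hx hx' u hu ≫ jump θ k' x' hx' =
      jump θ k x hx ≫ valMap (isPull_const g m σ h') hx hx' u hu := by
  have e₁ := valMap_mk _ _ (isPull_const g l τ h) hx hx' u hu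
  have e₂ := valMap_mk _ _ (isPull_const g m σ h') hx hx' u hu
  exact (congrArg (· ≫ jump θ k' x' hx') e₁).trans
    ((θ.hom.naturality (pairHom (A := pair k x hx) (B := pair k' x' hx') g u hu)).trans
      (congrArg (jump θ k x hx ≫ ·) e₂).symm)

end Jump

/-- The last point of the interval of index `l`. -/
abbrev endChart (k : K.obj) (l : Fin (P.n + 1)) : P.Chart k :=
  constChart k l (P.t l.succ) ⟨(P.strictMono Fin.castSucc_lt_succ).le, le_rfl⟩

/-- The first point of the interval of index `l`. -/
abbrev startChart (k : K.obj) (l : Fin (P.n + 1)) : P.Chart k :=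
  constChart k l (P.t l.castSucc) ⟨le_rfl, (P.strictMono Fin.castSucc_lt_succ).le⟩

/-- The piece that follows a piece of the loop, and the 2-isomorphism between their ends. -/
def next (P : PiecewiseLoop K 𝒳) (l : Fin (P.n + 1)) : Σ m : Fin (P.n + 1),
    evalAt (P.piece l) (P.t l.succ) ⟨(P.strictMono Fin.castSucc_lt_succ).le, le_rfl⟩ ≅
      evalAt (P.piece m) (P.t m.castSucc)
        ⟨le_rfl, (P.strictMono Fin.castSucc_lt_succ).le⟩ :=
  Fin.lastCases (motive := fun l => Σ m : Fin (P.n + 1),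
    evalAt (P.piece l) (P.t l.succ) ⟨(P.strictMono Fin.castSucc_lt_succ).le, le_rfl⟩ ≅
      evalAt (P.piece m) (P.t m.castSucc)
        ⟨le_rfl, (P.strictMono Fin.castSucc_lt_succ).le⟩)
    ⟨0, P.close⟩ (fun l => ⟨l.succ, P.joint l⟩) l

theorem next_last : P.next (Fin.last P.n) = ⟨0, P.close⟩ := Fin.lastCases_last

theorem next_castSucc (l : Fin P.n) : P.next l.castSucc = ⟨l.succ, P.joint l⟩ :=
  Fin.lastCases_castSucc _

/-- The 2-isomorphism between a piece and its successor is one of the transitions of the loop. -/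
theorem transition_next (l : Fin (P.n + 1)) : P.Transition l _ _ _ _ _ (P.next l).2 := by
  induction l using Fin.lastCases with
  | last => rw [next_last]; exact .close
  | cast l => rw [next_castSucc]; exact .joint l

/-- The function `τ` is a lift of small oscillation of the plot `σ ∘ B.snd` of the circle. -/
structure IsLift (σ : Mfd.circle ⟶ Mfd.circle) (B : (prod K S1).obj)
    (τ : K.p.obj B.fst ⟶ Mfd.line) : Prop where
  exp : τ ≫ expLine = eqToHom B.eq.symm ≫ B.snd.map ≫ σ
  osc : ∀ z z', |lineVal τ z - lineVal τ z'| < 1 / 2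

/-- The plots of the circle underlying the objects of `K × S¹`, transported to the base of the first
component, are natural. -/
theorem map_comp_plot {B B' : (prod K S1).obj} (φ : B ⟶ B') :
    K.p.map φ.fst ≫ eqToHom B'.eq.symm ≫ B'.snd.map = eqToHom B.eq.symm ≫ B.snd.map := by
  have := φ.lift
  have e₁ := IsHomLift.fac' S1.p (K.p.map φ.fst) φ.snd
  have e₂ : φ.snd.hom = _ := e₁
  have e : K.p.map φ.fst ≫ eqToHom B'.eq.symm = eqToHom B.eq.symm ≫ φ.snd.hom := by
    rw [e₂]
    simp
  rw [← Category.assoc, e, Category.assoc]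
  exact congrArg (fun t => eqToHom B.eq.symm ≫ t) φ.snd.w

theorem IsLift.pull {σ : Mfd.circle ⟶ Mfd.circle} {B B' : (prod K S1).obj} (φ : B ⟶ B')
    {τ : K.p.obj B'.fst ⟶ Mfd.line} (h : IsLift σ B' τ) : IsLift σ B (K.p.map φ.fst ≫ τ) := by
  refine ⟨?_, fun z z' => h.osc ((K.p.map φ.fst).1 z) ((K.p.map φ.fst).1 z')⟩
  rw [Category.assoc, h.exp, ← Category.assoc (eqToHom B.eq.symm), ← map_comp_plot φ]
  simp only [Category.assoc]

theorem lineVal_mem (c : P.Chart k) (z) :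
    lineVal c.par z ∈ Set.Icc (P.t c.idx.castSucc) (P.t c.idx.succ) := c.mem z

/-- Charts have values in the unit interval. -/
theorem lineVal_mem_unit (c : P.Chart k) (z) : lineVal c.par z ∈ Set.Icc 0 1 := by
  obtain ⟨h₁, h₂⟩ := lineVal_mem c z
  have h₃ := P.strictMono.monotone (Fin.zero_le c.idx.castSucc)
  have h₄ := P.strictMono.monotone (Fin.le_last c.idx.succ)
  rw [P.t_zero] at h₃
  rw [P.t_last] at h₄
  exact ⟨h₃.trans h₁, h₂.trans h₄⟩

theorem chart_ext {c c' : P.Chart k} (h : c.idx = c'.idx)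
    (h' : ∀ z, lineVal c.par z = lineVal c'.par z) : c = c' := by
  obtain ⟨i, τ, hτ⟩ := c
  obtain ⟨j, τ', hτ'⟩ := c'
  obtain rfl : i = j := h
  obtain rfl : τ = τ' := Subtype.ext (funext h')
  rfl

theorem eq_endChart {c : P.Chart k} (h : ∀ z, lineVal c.par z = P.t c.idx.succ) :
    c = endChart k c.idx := chart_ext rfl h

theorem eq_startChart {c : P.Chart k} {m : Fin (P.n + 1)} (hm : m = c.idx)
    (h : ∀ z, lineVal c.par z = P.t c.idx.castSucc) :
    c = startChart k m := by
  subst hm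
  exact chart_ext rfl h

/-- Two charts with the same function agree or are the constant charts at a joint. -/
theorem chart_cases_of_eq [hne : Nonempty (K.p.obj k)] (c c' : P.Chart k)
    (h : ∀ z, lineVal c.par z = lineVal c'.par z) (hlt : c.idx < c'.idx) :
    ∃ l, c = endChart _ l ∧ c' = startChart _ (P.next l).1 := by
  have h₁ : c.idx.succ ≤ c'.idx.castSucc := by
    rw [Fin.le_def]
    simpa using Nat.succ_le_of_lt (Fin.lt_def.1 hlt)
  have h₂ := P.strictMono.monotone h₁
  have h₃ (z : K.p.obj k) : P.t c.idx.succ = P.t c'.idx.castSucc := by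
    have h₄ := (lineVal_mem c z).2
    have h₅ := (lineVal_mem c' z).1
    rw [h z] at h₄
    exact le_antisymm h₂ (h₅.trans h₄)
  obtain ⟨z₀⟩ := id hne
  have h₆ : c.idx.succ = c'.idx.castSucc := P.strictMono.injective (h₃ z₀)
  obtain ⟨j, hj⟩ : ∃ j : Fin P.n, c.idx = j.castSucc := by
    refine ⟨⟨c.idx, ?_⟩, rfl⟩
    have := c'.idx.2
    have : (c.idx : ℕ) < c'.idx := hlt
    omega
  have hj' : c'.idx = j.succ := by
    apply Fin.ext
    have := congrArg Fin.val h₆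
    rw [hj] at this
    simpa using this.symm
  refine ⟨c.idx, eq_endChart fun z => le_antisymm (lineVal_mem c z).2 ?_, eq_startChart ?_
    fun z => le_antisymm ?_ (lineVal_mem c' z).1⟩
  · rw [h z, h₃ z]
    exact (lineVal_mem c' z).1
  · rw [hj, next_castSucc, hj']
  · rw [← h z, ← h₃ z]
    exact (lineVal_mem c z).2

/-- Two charts whose functions differ by `1` are the constant charts at the end and at the beginning
of the loop. -/
theorem chart_cases_of_eq_add_one [hne : Nonempty (K.p.obj k)] (c c' : P.Chart k)
    (h : ∀ z, lineVal c.par z = lineVal c'.par z + 1) :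
    ∃ l, c = endChart _ l ∧ c' = startChart _ (P.next l).1 := by
  have h₁ (z) : lineVal c.par z = 1 := by
    have := (lineVal_mem_unit c z).2
    have := (lineVal_mem_unit c' z).1
    linarith [h z]
  have h₀ (z) : lineVal c'.par z = 0 := by linarith [h z, h₁ z]
  obtain ⟨z₀⟩ := id hne
  have hl : c.idx = Fin.last P.n := by
    have h₂ := (lineVal_mem c z₀).2
    rw [h₁, ← P.t_last, P.strictMono.le_iff_le, Fin.last_le_iff] at h₂
    exact Fin.succ_injective _ (h₂.trans (Fin.succ_last _).symm)
  have hl' : c'.idx = 0 := by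
    have h₂ := (lineVal_mem c' z₀).1
    rw [h₀, ← P.t_zero, P.strictMono.le_iff_le, Fin.le_zero_iff] at h₂
    exact Fin.castSucc_injective _ (h₂.trans Fin.castSucc_zero.symm)
  refine ⟨c.idx, eq_endChart fun z => ?_, eq_startChart ?_ fun z => ?_⟩
  · rw [h₁, hl, Fin.succ_last, P.t_last]
  · rw [hl, next_last, hl']
  · rw [h₀, hl', Fin.castSucc_zero, P.t_zero]

/-- Two charts of a nonempty plot that lift the same plot of the circle agree, or they are the two
constant charts at a joint. -/
theorem chart_cases {σ : Mfd.circle ⟶ Mfd.circle} {B : (prod K S1).obj}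
    [hne : Nonempty (K.p.obj B.fst)] (c c' : P.Chart B.fst) (h : IsLift σ B c.par)
    (h' : IsLift σ B c'.par) : c = c' ∨
      (∃ l, c = endChart _ l ∧ c' = startChart _ (P.next l).1) ∨
      ∃ l, c' = endChart _ l ∧ c = startChart _ (P.next l).1 := by
  have key (z) : ∃ m : ℤ, lineVal c.par z = lineVal c'.par z + m := by
    have e : Circle.exp (2 * Real.pi * lineVal c.par z) =
        Circle.exp (2 * Real.pi * lineVal c'.par z) :=
      congrFun (congrArg Subtype.val (h.exp.trans h'.exp.symm)) z
    obtain ⟨m, hm⟩ := Circle.exp_eq_exp.1 e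
    refine ⟨m, ?_⟩
    have := Real.pi_pos
    have : 2 * Real.pi * (lineVal c.par z - lineVal c'.par z - m) = 0 := by linarith
    rcases mul_eq_zero.1 this with h₀ | h₀ <;> linarith
  -- The lifts differ by an integer, which is constant as the oscillation of each lift is less than
  -- `1 / 2`.  Since both lifts have values in `[0, 1]`, the integer is `-1`, `0` or `1`.
  obtain ⟨z₀⟩ := id hne
  obtain ⟨m, hm⟩ := key z₀
  have key' (z) : lineVal c.par z = lineVal c'.par z + m := by
    obtain ⟨n, hn⟩ := key z
    have h₁ := abs_lt.1 (h.osc z z₀)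
    have h₂ := abs_lt.1 (h'.osc z z₀)
    have h₃ : (n : ℝ) < m + 1 := by linarith
    have h₄ : (m : ℝ) < n + 1 := by linarith
    have h₅ : n < m + 1 := by exact_mod_cast h₃
    have h₆ : m < n + 1 := by exact_mod_cast h₄
    obtain rfl : n = m := by omega
    exact hn
  have h₁ := lineVal_mem_unit c z₀
  have h₂ := lineVal_mem_unit c' z₀
  have h₃ : (m : ℝ) ≤ 1 := by linarith [h₁.2, h₂.1]
  have h₄ : (-1 : ℝ) ≤ m := by linarith [h₁.1, h₂.2]
  have h₅ : m ≤ 1 := by exact_mod_cast h₃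
  have h₆ : -1 ≤ m := by exact_mod_cast h₄
  obtain rfl | rfl | rfl : m = 1 ∨ m = 0 ∨ m = -1 := by omega
  · exact .inr (.inl (chart_cases_of_eq_add_one c c' fun z => by simpa using key' z))
  · have h₇ (z) : lineVal c.par z = lineVal c'.par z := by simpa using key' z
    rcases lt_trichotomy c.idx c'.idx with hlt | heq | hlt
    · exact .inr (.inl (chart_cases_of_eq c c' h₇ hlt))
    · exact .inl (chart_ext heq h₇)
    · exact .inr (.inr (chart_cases_of_eq c' c (fun z => (h₇ z).symm) hlt))
  · exact .inr (.inr (chart_cases_of_eq_add_one c' c fun z => by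
      have := key' z
      push_cast at this
      linarith))

end PiecewiseLoop

/-! ### Realizations of piecewise smooth loops -/

namespace PiecewiseLoop

variable {K : BasedCategory.{0, 1} Mfd} {𝒳 : BasedCategory.{v, u} Mfd} {P : PiecewiseLoop K 𝒳}
  {k k' : K.obj}

open Classical in
/-- Replaces the constant chart at the end of a piece by the constant chart at the beginning of the
next piece, together with the arrow between the values. -/
def normalize (c : P.Chart k) (x : 𝒳.obj) (hx : 𝒳.p.obj x = K.p.obj k) :
    Σ d : P.Chart k, c.val x hx ⟶ d.val x hx :=
  if h : c = endChart k c.idx then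
    ⟨startChart k (P.next c.idx).1,
      eqToHom (congrArg (fun c : P.Chart k => c.val x hx) h) ≫ jump (P.next c.idx).2 k x hx⟩
  else ⟨c, 𝟙 _⟩

theorem normalize_end (l : Fin (P.n + 1)) (x : 𝒳.obj) (hx : 𝒳.p.obj x = K.p.obj k) :
    normalize (endChart k l) x hx =
      ⟨startChart k (P.next l).1, jump (P.next l).2 k x hx⟩ := by
  unfold normalize
  rw [dif_pos rfl]
  exact congrArg (Sigma.mk _) (Category.id_comp _)

/-- On a nonempty base, the constant chart at the beginning of a piece is not the one at its end, as
the intervals of a partition are nondegenerate. -/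
theorem normalize_start [hne : Nonempty (K.p.obj k)] (l : Fin (P.n + 1)) (x : 𝒳.obj)
    (hx : 𝒳.p.obj x = K.p.obj k) :
    normalize (startChart k l) x hx = ⟨startChart k l, 𝟙 _⟩ := by
  unfold normalize
  rw [dif_neg]
  intro h
  obtain ⟨z⟩ := hne
  have e := congrArg (fun c : P.Chart k => lineVal c.par z) h
  exact (P.strictMono (Fin.castSucc_lt_succ (i := l))).ne e

theorem normalize_lift (c : P.Chart k) (x : 𝒳.obj) (hx : 𝒳.p.obj x = K.p.obj k) :
    𝒳.p.IsHomLift (𝟙 (K.p.obj k)) (normalize c x hx).2 := by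
  by_cases h : c = endChart k c.idx
  · obtain ⟨l, hl⟩ : ∃ l, l = c.idx := ⟨_, rfl⟩
    rw [← hl] at h
    subst h
    rw [normalize_end]
    exact jump_lift _ x hx
  · unfold normalize
    rw [dif_neg h]
    exact IsHomLift.id ((P.piece c.idx).w_obj _)

/-- By `chart_cases`, all charts that lift the same plot have the same normal form. -/
theorem normalize_fst_eq {σ : Mfd.circle ⟶ Mfd.circle} {B : (prod K S1).obj}
    [hne : Nonempty (K.p.obj B.fst)] {c c' : P.Chart B.fst} (h : IsLift σ B c.par)
    (h' : IsLift σ B c'.par) (x : 𝒳.obj) (hx : 𝒳.p.obj x = K.p.obj B.fst) :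
    (normalize c x hx).1 = (normalize c' x hx).1 := by
  obtain rfl | ⟨l, rfl, rfl⟩ | ⟨l, rfl, rfl⟩ := chart_cases c c' h h'
  · rfl
  · rw [normalize_end, normalize_start]
  · rw [normalize_end, normalize_start]

/-- The composition of the first arrow with the inverse of the second, after the targets are
identified, when the second is an identity; applied to the normal forms of two charts. -/
theorem comp_inv_of_sigma_eq {C : Type*} [Category C] {D : Type*} {V : D → C} {d : D} {a : C}
    {N : Σ d, a ⟶ V d} {N' : Σ e, V d ⟶ V e} {j : a ⟶ V d} (h : N = ⟨d, j⟩) (h' : N' = ⟨d, 𝟙 _⟩)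
    (e : V N.1 = V N'.1) [IsIso N'.2] : N.2 ≫ eqToHom e ≫ inv N'.2 = j := by
  subst h h'
  simp

/-- The charts of a plot that lift the given plot of the circle have values that are canonically
isomorphic; at a joint, the isomorphism is the 2-isomorphism of the loop. -/
theorem exists_comparison (h : IsStack 𝒳) (σ : Mfd.circle ⟶ Mfd.circle) (B : (prod K S1).obj)
    (x : 𝒳.obj) (hx : 𝒳.p.obj x = K.p.obj B.fst) :
    ∃ t : ∀ c c' : {c : P.Chart B.fst // IsLift σ B c.par}, c.1.val x hx ⟶ c'.1.val x hx,
      (∀ c c', 𝒳.p.IsHomLift (𝟙 (K.p.obj B.fst)) (t c c')) ∧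
      (∀ c c' c'', t c c' ≫ t c' c'' = t c c'') ∧
      ∀ l hl hm, t ⟨endChart B.fst l, hl⟩ ⟨startChart B.fst (P.next l).1, hm⟩ =
        jump (P.next l).2 B.fst x hx := by
  have h₀ := h.toIsCFG
  by_cases hne : Nonempty (K.p.obj B.fst)
  · have iso (c : P.Chart B.fst) : IsIso (normalize c x hx).2 := h₀.isIso _ (normalize_lift c x hx)
    have e (c c' : {c : P.Chart B.fst // IsLift σ B c.par}) :
        (normalize c.1 x hx).1.val x hx = (normalize c'.1 x hx).1.val x hx :=
      congrArg (fun c : P.Chart B.fst => c.val x hx) (normalize_fst_eq c.2 c'.2 x hx)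
    -- The comparison of two charts passes through their common normal form.
    refine ⟨fun c c' => (normalize c.1 x hx).2 ≫ eqToHom (e c c') ≫ inv (normalize c'.1 x hx).2,
      fun c c' => ?_, fun c c' c'' => by simp, fun l hl hm => ?_⟩
    · refine isHomLift_comp_left (normalize_lift _ _ _) (isHomLift_comp_left
        (IsHomLift.eqToHom_domain_lift_id _ ((P.piece _).w_obj _)) ?_)
      exact isHomLift_inverse (normalize_lift c'.1 x hx) (IsIso.hom_inv_id _)
    · refine comp_inv_of_sigma_eq (normalize_end l x hx) ?_ (e ⟨_, hl⟩ ⟨_, hm⟩)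
      have : Nonempty (K.p.obj B.fst) := hne
      exact normalize_start _ x hx
  -- Over the empty base the lift carries no information, but arrows exist and are unique.
  · have hE : IsEmpty (K.p.obj B.fst) := not_nonempty_iff.1 hne
    have ex (c c' : {c : P.Chart B.fst // IsLift σ B c.par}) :
        ∃ ψ : c.1.val x hx ⟶ c'.1.val x hx, 𝒳.p.IsHomLift (𝟙 (K.p.obj B.fst)) ψ :=
      h.exists_of_isEmpty ((P.piece _).w_obj _) ((P.piece _).w_obj _) _
    choose t ht using ex
    exact ⟨t, ht, fun c c' c'' => h.eq_of_isEmpty (isHomLift_comp_left (ht _ _) (ht _ _)) (ht _ _),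
      fun l hl hm => h.eq_of_isEmpty (ht _ _) (jump_lift _ x hx)⟩

/-- A commutative square stays commutative when two opposite sides are inverted. -/
theorem comp_eq_comp_of_inverse {C : Type*} [Category C] {x₁ x₂ y₁ y₂ : C} {a : x₁ ⟶ x₂}
    {a' : x₂ ⟶ x₁} {b : y₁ ⟶ y₂} {b' : y₂ ⟶ y₁} {v₁ : x₁ ⟶ y₁} {v₂ : x₂ ⟶ y₂}
    (ha : a' ≫ a = 𝟙 _) (hb : b ≫ b' = 𝟙 _) (e : a ≫ v₂ = v₁ ≫ b) : a' ≫ v₁ = v₂ ≫ b' := by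
  rw [← Category.comp_id v₁, ← hb, ← Category.assoc v₁, ← e, Category.assoc, ← Category.assoc,
    ha, Category.id_comp]

/-- Locally, the plots `σ ∘ f` of the circle have lifts into the pieces of the loop. -/
def HasCharts (σ : Mfd.circle ⟶ Mfd.circle) (P : PiecewiseLoop K 𝒳) : Prop :=
  ∀ B : (prod K S1).obj, ∃ (ι : Type) (U : ι → TopologicalSpace.Opens (K.p.obj B.fst)),
    IsCover U ∧ ∀ (B' : (prod K S1).obj) (e : B' ⟶ B), Small U (K.p.map e.fst) →
      ∃ c : P.Chart B'.fst, IsLift σ B' c.par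

/-- The map `g : K × S¹ × 𝒳 ⥤ 𝒳` realizes the composite of the piecewise smooth loop `P` with `σ`:
on each plot with a chart, the value of `g` is identified with the value of the loop on the chart,
naturally and compatibly with the 2-isomorphisms of the loop. -/
def Realizes (σ : Mfd.circle ⟶ Mfd.circle) (P : PiecewiseLoop K 𝒳)
    (g : prod (prod K S1) 𝒳 ⥤ᵇ 𝒳) : Prop :=
  ∃ α : ∀ (A : (prod (prod K S1) 𝒳).obj) (c : P.Chart A.fst.fst), IsLift σ A.fst c.par →
      (g.obj A ⟶ c.val A.snd A.eq),
    (∀ A c hc, 𝒳.p.IsHomLift (𝟙 (K.p.obj A.fst.fst)) (α A c hc)) ∧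
    (∀ {A B : (prod (prod K S1) 𝒳).obj} (φ : A ⟶ B) c c' hc hc' (hp : IsPull φ.fst.fst c c'),
      g.map φ ≫ α B c' hc' = α A c hc ≫ valMap hp A.eq B.eq φ.snd φ.lift) ∧
    ∀ {l τ h m τ' h' θ}, P.Transition l τ h m τ' h' θ → ∀ A hc hc',
      α A (constChart A.fst.fst l τ h) hc ≫ jump θ A.fst.fst A.snd A.eq =
        α A (constChart A.fst.fst m τ' h') hc'

/-- Every piecewise smooth loop has a realization, for a suitable map of the circle. -/
theorem exists_realizes (h : IsStack 𝒳) (hK : IsCFG K) {σ : Mfd.circle ⟶ Mfd.circle}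
    (hσ : HasCharts σ P) : ∃ g : prod (prod K S1) 𝒳 ⥤ᵇ 𝒳, Realizes σ P g := by
  have h₀ := h.toIsCFG
  have hA := prod_isCFG (prod_isCFG hK (sub_isCFG Mfd.circle Set.univ)) h₀
  have ex (A : (prod (prod K S1) 𝒳).obj) := exists_comparison (P := P) h σ A.fst A.snd A.eq
  choose t t_lift t_comp t_jump using ex
  have t_self (A) (c : {c : P.Chart A.fst.fst // IsLift σ A.fst c.par}) : t A c c = 𝟙 _ := by
    have := h₀.isIso _ (t_lift A c c)
    rw [← cancel_mono (t A c c), t_comp, Category.id_comp]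
  have t_eq {A : (prod (prod K S1) 𝒳).obj} {c c' : P.Chart A.fst.fst} (hc hc') (e : c = c') :
      ∀ (y : 𝒳.obj) (v : c'.val A.snd A.eq ⟶ y) (v' : c.val A.snd A.eq ⟶ y), HEq v v' →
        t A ⟨c, hc⟩ ⟨c', hc'⟩ ≫ v = v' := by
    subst e
    rintro y v v' ⟨⟩
    rw [t_self, Category.id_comp]
  have val_eq {A B : (prod (prod K S1) 𝒳).obj} (φ : A ⟶ B) {c₁ c₂ : P.Chart A.fst.fst}
      {c' : P.Chart B.fst.fst} (h₁ : IsPull φ.fst.fst c₁ c') (h₂ : IsPull φ.fst.fst c₂ c') :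
      HEq (valMap h₁ A.eq B.eq φ.snd φ.lift) (valMap h₂ A.eq B.eq φ.snd φ.lift) := by
    obtain rfl := h₁.eq h₂
    rfl
  have nat {A B : (prod (prod K S1) 𝒳).obj} (φ : A ⟶ B)
      (ρ ρ' : {c : P.Chart B.fst.fst // IsLift σ B.fst c.par}) :
      t A ⟨ρ.1.pull φ.fst.fst, ρ.2.pull φ.fst⟩ ⟨ρ'.1.pull φ.fst.fst, ρ'.2.pull φ.fst⟩ ≫
        valMap (isPull_pull φ.fst.fst ρ'.1) A.eq B.eq φ.snd φ.lift =
      valMap (isPull_pull φ.fst.fst ρ.1) A.eq B.eq φ.snd φ.lift ≫ t B ρ ρ' := by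
    by_cases hne : Nonempty (K.p.obj A.fst.fst)
    · obtain ⟨z⟩ := id hne
      have hne' : Nonempty (K.p.obj B.fst.fst) := ⟨(K.p.map φ.fst.fst).1 z⟩
      obtain ⟨c, hc⟩ := ρ
      obtain ⟨c', hc'⟩ := ρ'
      -- At a joint both charts are constant, and pullback commutes with the 2-isomorphism.
      have nat_jump (l hl hm) : t A ⟨(endChart B.fst.fst l).pull φ.fst.fst, IsLift.pull φ.fst hl⟩
            ⟨(startChart B.fst.fst (P.next l).1).pull φ.fst.fst, IsLift.pull φ.fst hm⟩ ≫
          valMap (isPull_pull φ.fst.fst _) A.eq B.eq φ.snd φ.lift =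
          valMap (isPull_pull φ.fst.fst _) A.eq B.eq φ.snd φ.lift ≫
            t B ⟨endChart B.fst.fst l, hl⟩ ⟨startChart B.fst.fst (P.next l).1, hm⟩ := by
        refine (congrArg (· ≫ valMap (isPull_pull φ.fst.fst _) A.eq B.eq φ.snd φ.lift)
          (t_jump A l (IsLift.pull φ.fst hl) (IsLift.pull φ.fst hm))).trans ?_
        rw [t_jump]
        exact (valMap_jump (P.next l).2 A.eq B.eq φ.snd φ.lift).symm
      obtain rfl | ⟨l, rfl, rfl⟩ | ⟨l, rfl, rfl⟩ := chart_cases c c' hc hc'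
      · rw [t_self, t_self, Category.id_comp, Category.comp_id]
      · exact nat_jump l _ _
      · exact comp_eq_comp_of_inverse ((t_comp A _ _ _).trans (t_self A _))
          ((t_comp B _ _ _).trans (t_self B _)) (nat_jump l hc' hc)
    · have hE : IsEmpty (K.p.obj A.fst.fst) := not_nonempty_iff.1 hne
      exact h.eq_of_isEmpty
        (isHomLift_comp_left (f := K.p.map φ.fst.fst) (t_lift A _ _)
          (valMap_lift (isPull_pull _ ρ'.1) A.eq B.eq φ.snd φ.lift))
        (isHomLift_comp_right (f := K.p.map φ.fst.fst)
          (valMap_lift (isPull_pull _ ρ.1) A.eq B.eq φ.snd φ.lift) (t_lift B _ _))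
  obtain ⟨g, η, hη, hη', ht⟩ := h.exists_of_charts hA
    (Rep := fun A : (prod (prod K S1) 𝒳).obj =>
      {c : P.Chart A.fst.fst // IsLift σ A.fst c.par})
    (fun {A B} φ ρ => ⟨ρ.1.pull φ.fst.fst, ρ.2.pull φ.fst⟩)
    (fun A => by
      obtain ⟨ι, U, hU, H⟩ := hσ A.fst
      refine ⟨ι, U, hU, fun {R} g hg => ?_⟩
      obtain ⟨B, e, he⟩ := hA.exists_lift A g
      have : Small U (K.p.map e.fst.fst) := small_map (𝒜 := prod (prod K S1) 𝒳) he hg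
      obtain ⟨c, hc⟩ := H B.fst e.fst this
      exact ⟨B, e, he, ⟨⟨c, hc⟩⟩⟩)
    (fun A ρ => ρ.1.val A.snd A.eq)
    (fun {A B} φ ρ => valMap (isPull_pull φ.fst.fst ρ.1) A.eq B.eq φ.snd φ.lift)
    (fun {A B} φ ρ => valMap_lift (isPull_pull φ.fst.fst ρ.1) A.eq B.eq φ.snd φ.lift)
    t t_lift t_comp nat
    (fun A ρ => t_eq _ _ ((isPull_id ρ.1).eq (isPull_pull _ ρ.1)) _ _ _
      ((val_eq (𝟙 A) (isPull_pull _ ρ.1) (isPull_id ρ.1)).trans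
        (heq_of_eq (valMap_id (isPull_id ρ.1) A.eq (ProdHom.lift (𝟙 A))))))
    (fun {A B C} φ ψ ρ => t_eq _ _ ((isPull_pull _ ρ.1).eq
        ((isPull_pull _ _).comp (isPull_pull _ ρ.1))) _ _ _
      ((heq_of_eq (valMap_comp (isPull_pull _ _) (isPull_pull _ ρ.1)
          ((isPull_pull _ _).comp (isPull_pull _ ρ.1)) A.eq B.eq C.eq φ.snd φ.lift ψ.snd ψ.lift
          (ProdHom.lift (φ ≫ ψ)) rfl)).trans
        (val_eq (φ ≫ ψ) ((isPull_pull _ _).comp (isPull_pull _ ρ.1)) (isPull_pull _ ρ.1))))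
  refine ⟨g, fun A c hc => η A ⟨c, hc⟩, fun A c hc => hη A ⟨c, hc⟩,
    fun {A B} φ c c' hc hc' hp => ?_, fun {l τ hl m τ' hm θ} hθ A hc hc' => ?_⟩
  · obtain rfl : c'.pull φ.fst.fst = c := (isPull_pull φ.fst.fst c').eq hp
    exact hη' φ ⟨c', hc'⟩
  · have key (l hl) : ∀ m θ hm, P.next l = ⟨m, θ⟩ →
        η A ⟨endChart A.fst.fst l, hl⟩ ≫ jump θ A.fst.fst A.snd A.eq =
          η A ⟨startChart A.fst.fst m, hm⟩ := by
      intro m θ hm e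
      obtain ⟨rfl, he⟩ := Sigma.mk.inj_iff.1 e
      obtain rfl := eq_of_heq he
      exact (congrArg (η A ⟨endChart A.fst.fst l, hl⟩ ≫ ·) (t_jump A l hl hm)).symm.trans
        (ht A _ _)
    cases hθ with
    | refl => exact Category.comp_id _
    | joint l => exact key _ _ _ _ _ (next_castSucc l)
    | close => exact key _ _ _ _ _ next_last

end PiecewiseLoop

namespace PiecewiseLoop

variable {K : BasedCategory.{0, 1} Mfd} {𝒳 : BasedCategory.{v, u} Mfd} {P P' : PiecewiseLoop K 𝒳}
  {σ : Mfd.circle ⟶ Mfd.circle} {g g' : prod (prod K S1) 𝒳 ⥤ᵇ 𝒳}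

/-- Realizations of loops of diffeomorphisms are families of diffeomorphisms. -/
theorem Realizes.goodAt (h : IsStack 𝒳) (hK : IsCFG K) (hσ : HasCharts σ P) (hP : P.IsDiffeo)
    (hg : Realizes σ P g) (B : (prod K S1).obj) : GoodAt g B := by
  have h₀ := h.toIsCFG
  obtain ⟨α, hα, nat, -⟩ := hg
  obtain ⟨ι, U, hU, H⟩ := hσ B
  refine GoodAt.of_local h (prod_isCFG hK (sub_isCFG Mfd.circle Set.univ)) hU fun B' e he => ?_
  obtain ⟨c, hc⟩ := H B' e he
  refine GoodAt.of_isIso h₀ (G := P.piece c.idx) (l := c.plot) rfl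
    (fun x hx => α (pair B' x hx) c hc) (fun x hx => hα (pair B' x hx) c hc)
    (fun {x x'} hx hx' φ φ' h₁ h₂ h₃ => ?_) ((isDiffeoFamily_iff h₀).1 (hP c.idx) c.plot)
  have h₄ : φ.fst.fst = 𝟙 B'.fst := congrArg (fun t : B' ⟶ B' => t.fst) h₁
  have hp : IsPull φ.fst.fst c c := by rw [h₄]; exact isPull_id c
  refine (nat φ c c hc hc hp).trans (congrArg (α (pair B' x hx) c hc ≫ ·) ?_)
  obtain ⟨i, τ, hτ⟩ := c
  refine (valMap_mk hτ hτ hp hx hx' φ.snd φ.lift).trans (congrArg (P.piece i).map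
    (pairHom_ext (pairHom_ext ?_ (PlotHom.ext ?_)) h₃))
  · rw [h₂]
    exact h₄
  · rw [h₂]
    exact (congrArg (fun t => K.p.map t) h₄).trans (K.p.map_id _)

/-- Two realizations of the same loop are isomorphic. -/
theorem Realizes.nonempty_iso (h : IsStack 𝒳) (hK : IsCFG K) (hσ : HasCharts σ P)
    (hg : Realizes σ P g) (hg' : Realizes σ P g') : Nonempty (g ≅ g') := by
  have h₀ := h.toIsCFG
  obtain ⟨α, hα, nat, trans⟩ := hg
  obtain ⟨α', hα', nat', trans'⟩ := hg'
  have hA := prod_isCFG (prod_isCFG hK (sub_isCFG Mfd.circle Set.univ)) h₀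
  have iso (A c hc) : IsIso (α' A c hc) := h₀.isIso _ (hα' A c hc)
  let J (w : Σ A : (prod (prod K S1) 𝒳).obj, {c : P.Chart A.fst.fst // IsLift σ A.fst c.par}) :
    (prod (prod K S1) 𝒳).obj := w.1
  have hJ : IsDense J := fun A => by
    obtain ⟨ι, U, hU, H⟩ := hσ A.fst
    refine ⟨ι, U, hU, fun {R} g hg => ?_⟩
    obtain ⟨B, e, he⟩ := hA.exists_lift A g
    have : Small U (K.p.map e.fst.fst) := small_map (𝒜 := prod (prod K S1) 𝒳) he hg
    obtain ⟨c, hc⟩ := H B.fst e.fst this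
    exact ⟨⟨B, ⟨c, hc⟩⟩, e, he⟩
  have lift (A c hc) : 𝒳.p.IsHomLift (𝟙 (K.p.obj A.fst.fst)) (α A c hc ≫ inv (α' A c hc)) :=
    isHomLift_comp_left (hα A c hc) (isHomLift_inverse (hα' A c hc) (IsIso.hom_inv_id _))
  -- the comparison does not depend on the chart
  have indep (A : (prod (prod K S1) 𝒳).obj) (c c' : P.Chart A.fst.fst) (hc hc') :
      α A c hc ≫ inv (α' A c hc) = α A c' hc' ≫ inv (α' A c' hc') := by
    by_cases hne : Nonempty (K.p.obj A.fst.fst)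
    · have key (l hl hm) : α A (endChart A.fst.fst l) hl ≫ inv (α' A (endChart A.fst.fst l) hl) =
          α A (startChart A.fst.fst (P.next l).1) hm ≫
            inv (α' A (startChart A.fst.fst (P.next l).1) hm) := by
        rw [IsIso.eq_comp_inv, ← trans' (transition_next l) A hl hm, Category.assoc,
          IsIso.inv_hom_id_assoc, trans (transition_next l) A hl hm]
      obtain rfl | ⟨l, rfl, rfl⟩ | ⟨l, rfl, rfl⟩ := chart_cases c c' hc hc'
      · rfl
      · exact key l _ _
      · exact (key l _ _).symm
    · have hE : IsEmpty (K.p.obj A.fst.fst) := not_nonempty_iff.1 hne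
      exact h.eq_of_isEmpty (lift A c hc) (lift A c' hc')
  have main {A B : (prod (prod K S1) 𝒳).obj} (φ : A ⟶ B) (c : P.Chart A.fst.fst)
      (c' : P.Chart B.fst.fst) (hc hc') : g.map φ ≫ α B c' hc' ≫ inv (α' B c' hc') =
        (α A c hc ≫ inv (α' A c hc)) ≫ g'.map φ := by
    have hp := isPull_pull φ.fst.fst c'
    rw [indep A c (c'.pull φ.fst.fst) hc (hc'.pull φ.fst), ← Category.assoc,
      nat φ _ c' (hc'.pull φ.fst) hc' hp, IsIso.comp_inv_eq, Category.assoc, Category.assoc,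
      nat' φ _ c' (hc'.pull φ.fst) hc' hp, IsIso.inv_hom_id_assoc]
  exact h.nonempty_iso_of_dense hA hJ (fun w => α w.1 w.2.1 w.2.2 ≫ inv (α' w.1 w.2.1 w.2.2))
    (fun w => lift w.1 w.2.1 w.2.2) fun {w w'} φ => main φ w.2.1 w'.2.1 w.2.2 w'.2.2

/-- Transport of the last arrow of a composite to the other side along a section. -/
theorem comp_eq_comp_of_section {C : Type*} [Category C] {v w x y z : C} {a : v ⟶ w} {b : w ⟶ x}
    {d : x ⟶ y} {e : y ⟶ z} {e' : z ⟶ y} {f : v ⟶ z} (h : a ≫ b ≫ d ≫ e = f)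
    (he : e ≫ e' = 𝟙 y) : (a ≫ b) ≫ d = f ≫ e' := by
  rw [← h]
  simp [he]

/-- A realization of a loop realizes every refinement of the loop. -/
theorem Realizes.of_refines (hg : Realizes σ P g) (hP : P'.Refines P) : Realizes σ P' g := by
  obtain ⟨α, hα, nat, trans⟩ := hg
  obtain ⟨r, hr, β, hβ⟩ := hP
  -- A chart of the refinement is a chart of the loop, with the index of the coarser interval.
  let coarse {k : K.obj} (c : P'.Chart k) : P.Chart k := ⟨r c.idx, c.par, fun z => hr _ (c.mem z)⟩
  let b {k : K.obj} (c : P'.Chart k) (x : 𝒳.obj) (hx : 𝒳.p.obj x = K.p.obj k) :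
    (coarse c).val x hx ⟶ c.val x hx := (β c.idx).inv.app (pair c.plot x hx)
  refine ⟨fun A c hc => α A (coarse c) hc ≫ b c A.snd A.eq, fun A c hc => ?_,
    fun {A B} φ c c' hc hc' hp => ?_, fun {l τ hl m τ' hm θ} hθ A hc hc' => ?_⟩
  · exact isHomLift_comp_left (hα A (coarse c) hc)
      ((β c.idx).inv.isHomLift' (pair c.plot A.snd A.eq))
  · have hp' : IsPull φ.fst.fst (coarse c) (coarse c') := ⟨congrArg r hp.idx, hp.par⟩
    have e := nat φ (coarse c) (coarse c') hc hc' hp'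
    have e' : valMap hp' A.eq B.eq φ.snd φ.lift ≫ b c' B.snd B.eq =
        b c A.snd A.eq ≫ valMap hp A.eq B.eq φ.snd φ.lift := by
      obtain ⟨i, τ, hτ⟩ := c
      obtain ⟨j, τ', hτ'⟩ := c'
      obtain rfl : i = j := hp.idx
      refine (congrArg (· ≫ b _ B.snd B.eq) (valMap_mk _ _ hp' A.eq B.eq φ.snd φ.lift)).trans
        (.trans ?_ (congrArg (b _ A.snd A.eq ≫ ·) (valMap_mk _ _ hp A.eq B.eq φ.snd φ.lift)).symm)
      exact (β i).inv.naturality (pairHom (A := pair (Chart.plot ⟨i, τ, hτ⟩) A.snd A.eq)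
        (B := pair (Chart.plot ⟨i, τ', hτ'⟩) B.snd B.eq)
        (pairHom (A := Chart.plot ⟨i, τ, hτ⟩) (B := Chart.plot ⟨i, τ', hτ'⟩) φ.fst.fst
          (PlotHom.mk (a := ⟨K.p.obj A.fst.fst, τ, hτ⟩) (b := ⟨K.p.obj B.fst.fst, τ', hτ'⟩)
            (K.p.map φ.fst.fst) hp.par)
          (isHomLift_of_map_eq (𝒳 := seg _ _) rfl)) φ.snd φ.lift)
    rw [← Category.assoc, e, Category.assoc, e', Category.assoc]
  · have e := trans (hβ _ _ _ _ _ _ _ hθ) A hc hc'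
    have e₁ : jump ((evalIso (β l) τ hl).symm ≪≫ θ ≪≫ evalIso (β m) τ' hm) A.fst.fst A.snd A.eq =
        b (constChart A.fst.fst l τ hl) A.snd A.eq ≫ jump θ A.fst.fst A.snd A.eq ≫
          (β m).hom.app (pair (constChart A.fst.fst m τ' hm).plot A.snd A.eq) := rfl
    have e₂ : (β m).hom.app (pair (constChart A.fst.fst m τ' hm).plot A.snd A.eq) ≫
        b (constChart A.fst.fst m τ' hm) A.snd A.eq = 𝟙 _ :=
      congrArg (fun α : P'.piece m ⟶ P'.piece m =>
        α.app (pair (constChart A.fst.fst m τ' hm).plot A.snd A.eq)) (β m).hom_inv_id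
    rw [e₁] at e
    exact comp_eq_comp_of_section e e₂

end PiecewiseLoop

namespace PiecewiseLoop

variable {𝒳 : BasedCategory.{v, u} Mfd} {σ : Mfd.circle ⟶ Mfd.circle}

/-- The realization of a member of a family of loops is the member of the realization. -/
theorem Realizes.member {a b : ℝ} {Γ : PiecewiseLoop (seg a b) 𝒳}
    {G : prod (prod (seg a b) S1) 𝒳 ⥤ᵇ 𝒳} (hG : Realizes σ Γ G) {s : ℝ} (hs : s ∈ Set.Icc a b) :
    Realizes σ (Γ.member s hs) ((prodMap (prodMap (ptMap Mfd.line _ s hs) (BasedFunctor.id S1))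
      (BasedFunctor.id 𝒳)).comp G) := by
  obtain ⟨α, hα, nat, trans⟩ := hG
  let U := prodMap (prodMap (ptMap Mfd.line _ s hs) (BasedFunctor.id S1)) (BasedFunctor.id 𝒳)
  let C {Z : pt.obj} (c : (Γ.member s hs).Chart Z) :
    Γ.Chart ((ptMap Mfd.line _ s hs).obj Z) := ⟨c.idx, c.par, c.mem⟩
  have hC {A : (prod (prod pt S1) 𝒳).obj} {c : (Γ.member s hs).Chart A.fst.fst}
      (hc : IsLift σ A.fst c.par) : IsLift σ (U.obj A).fst (C c).par := ⟨hc.exp, hc.osc⟩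
  refine ⟨fun A c hc => α (U.obj A) (C c) (hC hc), fun A c hc => hα (U.obj A) (C c) (hC hc),
    fun {A B} φ c c' hc hc' hp => ?_, fun {l τ hl m τ' hm θ} hθ A hc hc' => ?_⟩
  · refine (nat (U.map φ) (C c) (C c') (hC hc) (hC hc') ⟨hp.idx, hp.par⟩).trans ?_
    obtain ⟨i, τ, hτ⟩ := c
    obtain ⟨j, τ', hτ'⟩ := c'
    obtain rfl : i = j := hp.idx
    refine congrArg (α (U.obj A) _ (hC hc) ≫ ·) ?_
    exact (valMap_mk (P := Γ) (g := (U.map φ).fst.fst) _ _ ⟨rfl, hp.par⟩ (U.obj A).eq (U.obj B).eq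
      (U.map φ).snd (U.map φ).lift).trans
      (valMap_mk (P := Γ.member s hs) (g := φ.fst.fst) _ _ hp A.eq B.eq φ.snd φ.lift).symm
  · cases hθ with
    | refl => exact Category.comp_id _
    | joint l => exact trans (Transition.joint (γ := Γ) l) (U.obj A) (hC hc) (hC hc')
    | close => exact trans (Transition.close (γ := Γ)) (U.obj A) (hC hc) (hC hc')

/-- The map `S¹ ⥤ pt × S¹`. -/
def ofPt : S1 ⥤ᵇ prod pt S1 :=
  mkFunctor (fun f => pair (K := pt) (𝒳 := S1) f.dom f rfl)
    (fun {f f'} φ => pairHom (K := pt) (𝒳 := S1) (A := ⟨f.dom, f, rfl⟩) (B := ⟨f'.dom, f', rfl⟩)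
      φ.hom φ (isHomLift_self φ))
    (fun _ => rfl) (fun _ _ => rfl) (fun _ => isHomLift_of_map_eq rfl)

/-- The composite of a loop with a map of the circle, with a trivial parameter. -/
def reparam (σ : Mfd.circle ⟶ Mfd.circle) (F : prod S1 𝒳 ⥤ᵇ 𝒳) : prod (prod pt S1) 𝒳 ⥤ᵇ 𝒳 :=
  (prodMap ((prodSnd pt S1).comp (ofMfdMap σ)) (BasedFunctor.id 𝒳)).comp F

/-- The components of the identity of two restrictions of `F` to equal points of the circle are
values of `F` on arrows that are the identity in the base. -/
theorem eqToHom_evalCircle (F : prod S1 𝒳 ⥤ᵇ 𝒳) {y y' : Mfd.circle} (e : y = y')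
    (e' : (prodMap (ptMap Mfd.circle Set.univ y trivial) (BasedFunctor.id 𝒳)).comp F =
      (prodMap (ptMap Mfd.circle Set.univ y' trivial) (BasedFunctor.id 𝒳)).comp F)
    (A : (prod pt 𝒳).obj) :
    (eqToIso e').hom.app A = F.map (pairHom
      (A := pair (K := S1) ⟨A.fst, Mfd.const A.fst y, fun _ => trivial⟩ A.snd A.eq)
      (B := pair (K := S1) ⟨A.fst, Mfd.const A.fst y', fun _ => trivial⟩ A.snd A.eq)
      (PlotHom.mk (a := ⟨A.fst, Mfd.const A.fst y, fun _ => trivial⟩)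
        (b := ⟨A.fst, Mfd.const A.fst y', fun _ => trivial⟩) (𝟙 A.fst) (by rw [e]; rfl))
      (𝟙 A.snd) (IsHomLift.id A.eq)) := by
  subst e
  exact (F.map_id (pair (K := S1) ⟨A.fst, Mfd.const A.fst y, fun _ => trivial⟩ A.snd A.eq)).symm

/-- Pasting of two commutative squares, the second of which is given with another expression `w'`
for its last side. -/
theorem comp_chain {C : Type*} [Category C] {x₁ x₂ x₃ y₁ y₂ y₃ : C} {u : x₁ ⟶ y₁} {a : x₁ ⟶ x₂}
    {b : y₁ ⟶ y₂} {v : x₂ ⟶ y₂} {k : x₂ ⟶ x₃} {l : y₂ ⟶ y₃} {w w' : x₃ ⟶ y₃} {p q : x₁ ⟶ y₂}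
    (h₁ : p = u ≫ b) (h₂ : q = a ≫ v) (h₃ : p = q) (h₄ : v ≫ l = k ≫ w) (h₅ : k ≫ w' = k ≫ w) :
    u ≫ b ≫ l = (a ≫ k) ≫ w' := by
  rw [← Category.assoc, ← h₁, h₃, h₂, Category.assoc, h₄, Category.assoc, h₅]

/-- Composition of three arrows after cancellation of a section. -/
theorem comp_chain_of_section {C : Type*} [Category C] {v w x y z : C} {a : v ⟶ w} {k : w ⟶ x}
    {k' : x ⟶ w} {t t' : w ⟶ y} {k'' : y ⟶ z} {a' : v ⟶ y} (h : k ≫ k' = 𝟙 w) (ht : t = t')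
    (h' : a ≫ t' = a') : (a ≫ k) ≫ k' ≫ t ≫ k'' = a' ≫ k'' := by
  rw [← h', ht, Category.assoc, ← Category.assoc k, h, Category.id_comp, Category.assoc]

section ToPiecewise

variable (A : (prod (prod pt S1) 𝒳).obj) (τ : pt.p.obj A.fst.fst ⟶ Mfd.line)

/-- The object `(e^{2πiτ}, x)` of `S¹ × 𝒳`. -/
abbrev expObj : (prod S1 𝒳).obj :=
  pair (K := S1) (𝒳 := 𝒳) ⟨pt.p.obj A.fst.fst, τ ≫ expLine, fun _ => trivial⟩ A.snd A.eq

/-- The object `(σ ∘ f, x)` of `S¹ × 𝒳`. -/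
abbrev reparamObj (σ : Mfd.circle ⟶ Mfd.circle) : (prod S1 𝒳).obj :=
  (prodMap ((prodSnd pt S1).comp (ofMfdMap σ)) (BasedFunctor.id 𝒳)).obj A

variable {A τ}

/-- The arrow between `(σ ∘ f, x)` and `(e^{2πiτ}, x)` for a lift `τ` of `σ ∘ f`. -/
def liftHom (hτ : IsLift σ A.fst τ) : reparamObj A σ ⟶ expObj A τ :=
  pairHom (A := reparamObj A σ) (B := expObj A τ)
    (PlotHom.mk (a := (reparamObj A σ).fst) (b := (expObj A τ).fst) (eqToHom A.fst.eq) (by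
      show eqToHom A.fst.eq ≫ τ ≫ expLine = A.fst.snd.map ≫ σ
      rw [hτ.exp]
      simp)) (𝟙 A.snd)
    (IsHomLift.id_lift_eqToHom_domain A.fst.eq (A.eq.trans A.fst.eq.symm))

theorem liftHom_lift (hτ : IsLift σ A.fst τ) :
    (prod S1 𝒳).p.IsHomLift (𝟙 (pt.p.obj A.fst.fst)) (liftHom hτ) := by
  refine IsHomLift.of_fac' (p := (prod S1 𝒳).p) (a := reparamObj A σ) (b := expObj A τ)
    (𝟙 (pt.p.obj A.fst.fst)) (liftHom hτ) A.fst.eq rfl ?_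
  rw [eqToHom_refl, Category.comp_id, Category.comp_id]
  rfl

/-- Naturality of `liftHom`. -/
theorem map_comp_liftHom {A' : (prod (prod pt S1) 𝒳).obj} {τ' : pt.p.obj A'.fst.fst ⟶ Mfd.line}
    (hτ : IsLift σ A.fst τ) (hτ' : IsLift σ A'.fst τ') (φ : A ⟶ A')
    (e : φ.fst.fst ≫ τ' = τ) :
    (prodMap ((prodSnd pt S1).comp (ofMfdMap σ)) (BasedFunctor.id 𝒳)).map φ ≫ liftHom hτ' =
      liftHom hτ ≫ pairHom (A := expObj A τ) (B := expObj A' τ')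
        (PlotHom.mk (a := (expObj A τ).fst) (b := (expObj A' τ').fst) φ.fst.fst
          (by rw [← e]; rfl)) φ.snd φ.lift := by
  refine pairHom_ext (PlotHom.ext ?_) ((Category.comp_id _).trans (Category.id_comp _).symm)
  show φ.fst.snd.hom ≫ eqToHom A'.fst.eq = eqToHom A.fst.eq ≫ φ.fst.fst
  have e₁ := φ.fst.lift
  have e₂ := IsHomLift.fac' S1.p (pt.p.map φ.fst.fst) φ.fst.snd
  have e₃ : φ.fst.snd.hom = _ := e₂
  rw [e₃]
  simp
  rfl

theorem liftHom_comp {τ' : pt.p.obj A.fst.fst ⟶ Mfd.line}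
    (hτ : IsLift σ A.fst τ) (hτ' : IsLift σ A.fst τ') (e) :
    liftHom hτ ≫ pairHom (A := expObj A τ) (B := expObj A τ')
      (PlotHom.mk (a := (expObj A τ).fst) (b := (expObj A τ').fst) (𝟙 _) e) (𝟙 A.snd)
        (IsHomLift.id A.eq) = liftHom hτ' :=
  pairHom_ext (PlotHom.ext (Category.comp_id _)) (Category.comp_id _)

end ToPiecewise

/-- A smooth loop, composed with `σ`, realizes the corresponding piecewise smooth loop. -/
theorem realizes_toPiecewise (γ : SmoothLoop 𝒳) :
    Realizes σ γ.toPiecewise (reparam σ γ.circle) := by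
  let S {A : (prod (prod pt S1) 𝒳).obj} (c : γ.toPiecewise.Chart A.fst.fst) :
      (prod (seg 0 1) 𝒳).obj :=
    pair (K := seg 0 1) ⟨pt.p.obj A.fst.fst, c.par, fun z => lineVal_mem_unit c z⟩ A.snd A.eq
  let κ {A : (prod (prod pt S1) 𝒳).obj} (c : γ.toPiecewise.Chart A.fst.fst) :
      γ.circle.obj (expObj A c.par) ⟶ c.val A.snd A.eq := γ.comparison.inv.app (S c)
  refine ⟨fun A c hc => γ.circle.map (liftHom hc) ≫ κ c, fun A c hc => ?_,
    fun {A B} φ c c' hc hc' hp => ?_, fun {l τ hl m τ' hm θ} hθ A hc hc' => ?_⟩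
  · exact isHomLift_comp_left (isHomLift_map γ.circle (liftHom_lift hc))
      (γ.comparison.inv.isHomLift' (S c))
  · have e := map_comp_liftHom hc hc' φ hp.par
    let ψ : S c ⟶ S c' := pairHom (A := S c) (B := S c')
      (PlotHom.mk (a := (S c).fst) (b := (S c').fst) φ.fst.fst hp.par) φ.snd φ.lift
    have e₁ := γ.comparison.inv.naturality ψ
    have e₂ : κ c ≫ valMap hp A.eq B.eq φ.snd φ.lift = κ c ≫ γ.path.map ψ := by
      obtain ⟨i, τ, hτ⟩ := c
      obtain ⟨j, τ', hτ'⟩ := c'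
      obtain rfl : i = j := hp.idx
      exact congrArg (κ _ ≫ ·) (valMap_mk _ _ hp A.eq B.eq φ.snd φ.lift)
    exact comp_chain (γ.circle.map_comp _ _) (γ.circle.map_comp _ _) (congrArg γ.circle.map e) e₁ e₂
  · cases hθ with
    | refl => exact Category.comp_id _
    | joint l => exact l.elim0
    | close =>
      have e₁ : Circle.exp (2 * Real.pi * (![0, 1] : Fin 2 → ℝ) (Fin.last 1)) =
          Circle.exp (2 * Real.pi * (![0, 1] : Fin 2 → ℝ) 0) := by simp
      have e₂ := eqToHom_evalCircle γ.circle e₁ (by simp only [e₁]) (pair A.fst.fst A.snd A.eq)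
      have e₃ := (γ.circle.map_comp _ _).symm.trans (congrArg γ.circle.map (liftHom_comp hc hc'
        (Subtype.ext (funext fun _ => e₁.symm))))
      have e₄ (c : γ.toPiecewise.Chart A.fst.fst) : κ c ≫ γ.comparison.hom.app (S c) = 𝟙 _ :=
        congrArg (fun α : (prodMap expMap (BasedFunctor.id 𝒳)).comp γ.circle ⟶
          (prodMap expMap (BasedFunctor.id 𝒳)).comp γ.circle => α.app (S c))
            γ.comparison.inv_hom_id
      exact comp_chain_of_section (e₄ _) e₂ e₃

end PiecewiseLoop

/-! ### Reparametrizations adapted to a partition -/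

/-- The map `σ` of the circle has local lifts to the interval `[0, 1]` that are on one side of each
point of `T`. -/
def Adapted (σ : Mfd.circle ⟶ Mfd.circle) (T : Set ℝ) : Prop :=
  ∀ z : Mfd.circle, ∃ (U : TopologicalSpace.Opens Mfd.circle) (τ : Mfd.circle → ℝ), z ∈ U ∧
    (∀ w ∈ U, ContMDiffAt 𝓘(ℝ, Mfd.circle.model) 𝓘(ℝ, ℝ) ∞ τ w) ∧
    (∀ w ∈ U, Circle.exp (2 * Real.pi * τ w) = σ.1 w) ∧ (∀ w ∈ U, τ w ∈ Set.Icc 0 1) ∧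
    (∀ w ∈ U, ∀ w' ∈ U, |τ w - τ w'| < 1 / 2) ∧
    ∀ b ∈ T, (∀ w ∈ U, τ w ≤ b) ∨ ∀ w ∈ U, b ≤ τ w

theorem Adapted.mono {σ : Mfd.circle ⟶ Mfd.circle} {T T' : Set ℝ} (h : Adapted σ T)
    (hT : T' ⊆ T) : Adapted σ T' := fun z => by
  obtain ⟨U, τ, h₁, h₂, h₃, h₄, h₅, h₆⟩ := h z
  exact ⟨U, τ, h₁, h₂, h₃, h₄, h₅, fun b hb => h₆ b (hT hb)⟩

namespace PiecewiseLoop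

variable {K : BasedCategory.{0, 1} Mfd} {𝒳 : BasedCategory.{v, u} Mfd} {P P' : PiecewiseLoop K 𝒳}
  {σ : Mfd.circle ⟶ Mfd.circle}

/-- Functions that are on one side of each point of the partition have values in one interval. -/
theorem exists_interval (P : PiecewiseLoop K 𝒳) {Z : Type*} (τ : Z → ℝ)
    (h₀ : ∀ z, τ z ∈ Set.Icc 0 1) (h : ∀ i, (∀ z, τ z ≤ P.t i) ∨ ∀ z, P.t i ≤ τ z) :
    ∃ l : Fin (P.n + 1), ∀ z, τ z ∈ Set.Icc (P.t l.castSucc) (P.t l.succ) := by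
  classical
  -- The last interval whose left end is a lower bound of `τ`.
  obtain ⟨l, hl, hmax⟩ := (Finset.univ.filter fun l : Fin (P.n + 1) =>
    ∀ z, P.t l.castSucc ≤ τ z).exists_maximal ⟨0, by
      simp only [Finset.mem_filter, Finset.mem_univ, true_and]
      intro z
      rw [Fin.castSucc_zero, P.t_zero]
      exact (h₀ z).1⟩
  simp only [Finset.mem_filter, Finset.mem_univ, true_and] at hl hmax
  refine ⟨l, fun z => ⟨hl z, ?_⟩⟩
  induction l using Fin.lastCases with
  | last =>
    rw [Fin.succ_last, P.t_last]
    exact (h₀ z).2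
  | cast j =>
    rcases h j.castSucc.succ with h₁ | h₁
    · exact h₁ z
    · have := hmax (y := j.succ) (fun z => by rw [← Fin.succ_castSucc]; exact h₁ z)
        (Fin.castSucc_lt_succ (i := j)).le
      exact absurd this (not_le.2 (Fin.castSucc_lt_succ (i := j)))

/-- If `σ` is adapted to the partition points of `P`, its local lifts are charts of `P`. -/
theorem hasCharts_of_adapted (hσ : Adapted σ (Set.range P.t)) : HasCharts σ P := fun B => by
  choose U τ mem smooth exp unit osc side using hσ
  refine ⟨Mfd.circle, fun w => Mfd.preim (eqToHom B.eq.symm ≫ B.snd.map) (U w),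
    fun z => ⟨(eqToHom B.eq.symm ≫ B.snd.map).1 z, mem _⟩, fun B' e ⟨w, hw⟩ => ?_⟩
  obtain ⟨f, hf⟩ : ∃ f : K.p.obj B'.fst ⟶ Mfd.circle, f = eqToHom B'.eq.symm ≫ B'.snd.map :=
    ⟨_, rfl⟩
  have hfU (z) : f.1 z ∈ U w := by
    rw [hf, ← map_comp_plot e]
    exact hw z
  let ρ : K.p.obj B'.fst ⟶ Mfd.line :=
    ⟨fun z => τ w (f.1 z), fun z => (smooth w _ (hfU z)).comp z (f.2 z)⟩
  obtain ⟨l, hl⟩ := P.exists_interval (fun z => τ w (f.1 z)) (fun z => unit w _ (hfU z))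
    (fun i => (side w _ ⟨i, rfl⟩).imp (fun h z => h _ (hfU z)) (fun h z => h _ (hfU z)))
  refine ⟨⟨l, ρ, hl⟩, ?_, fun z z' => osc w _ (hfU z) _ (hfU z')⟩
  rw [← Category.assoc, ← hf]
  exact Subtype.ext (funext fun z => exp w _ (hfU z))

/-- Naturally related loops have isomorphic realizations. -/
theorem NaturallyRelated.exists_iso (h : IsStack 𝒳) (hK : IsCFG K) (hP : NaturallyRelated P P') :
    ∃ T : Set ℝ, T.Finite ∧ ∀ σ, Adapted σ T → ∀ g g', Realizes σ P g → Realizes σ P' g' →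
      Nonempty (g ≅ g') := by
  induction hP with
  | rel P P' hP =>
    refine ⟨Set.range P.t, Set.finite_range _, fun σ hσ g g' hg hg' => ?_⟩
    exact hg.nonempty_iso h hK (hasCharts_of_adapted hσ) (hg'.of_refines hP.2.2)
  | refl P =>
    refine ⟨Set.range P.t, Set.finite_range _, fun σ hσ g g' hg hg' => ?_⟩
    exact hg.nonempty_iso h hK (hasCharts_of_adapted hσ) hg'
  | symm P P' _ ih =>
    obtain ⟨T, hT, H⟩ := ih
    exact ⟨T, hT, fun σ hσ g g' hg hg' => (H σ hσ g' g hg' hg).map Iso.symm⟩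
  | trans P P' P'' _ _ ih ih' =>
    obtain ⟨T, hT, H⟩ := ih
    obtain ⟨T', hT', H'⟩ := ih'
    -- `σ` has to be adapted to the loop in the middle as well, so that this loop has a realization.
    refine ⟨T ∪ T' ∪ Set.range P'.t, (hT.union hT').union (Set.finite_range _),
      fun σ hσ g g'' hg hg'' => ?_⟩
    obtain ⟨g', hg'⟩ := exists_realizes h hK (hasCharts_of_adapted
      (hσ.mono (Set.subset_union_right : Set.range P'.t ⊆ _)))
    obtain ⟨e⟩ := H σ (hσ.mono (Set.subset_union_left.trans Set.subset_union_left)) g g' hg hg'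
    obtain ⟨e'⟩ := H' σ (hσ.mono (Set.subset_union_right.trans Set.subset_union_left)) g' g''
      hg' hg''
    exact ⟨e ≪≫ e'⟩

end PiecewiseLoop

/-! ### Maps of the circle that are constant near finitely many points -/

section Collapse

/-- A smooth function that is `0` for `x ≤ c₀` and `1` for `x ≥ c₁`. -/
def cutoff (c₀ c₁ x : ℝ) : ℝ := Real.smoothTransition ((x - c₀) / (c₁ - c₀))

theorem cutoff_mem (c₀ c₁ x : ℝ) : cutoff c₀ c₁ x ∈ Set.Icc 0 1 :=
  ⟨Real.smoothTransition.nonneg _, Real.smoothTransition.le_one _⟩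

theorem cutoff_zero {c₀ c₁ x : ℝ} (h : c₀ < c₁) (hx : x ≤ c₀) : cutoff c₀ c₁ x = 0 :=
  Real.smoothTransition.zero_of_nonpos
    (div_nonpos_of_nonpos_of_nonneg (by linarith) (by linarith))

theorem cutoff_one {c₀ c₁ x : ℝ} (h : c₀ < c₁) (hx : c₁ ≤ x) : cutoff c₀ c₁ x = 1 :=
  Real.smoothTransition.one_of_one_le ((one_le_div (by linarith)).2 (by linarith))

theorem contDiff_cutoff (c₀ c₁ : ℝ) : ContDiff ℝ ∞ (cutoff c₀ c₁) :=
  Real.smoothTransition.contDiff.comp ((contDiff_id.sub contDiff_const).div_const _)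

/-- The points of the finite set `S` are the centres of disjoint arcs. -/
structure Separated (S : Finset Circle) (c₀ c₁ : ℝ) : Prop where
  nonneg : 0 ≤ c₀
  lt : c₀ < c₁
  lt_one : c₁ < 1
  eq : ∀ s ∈ S, ∀ s' ∈ S, ∀ z : Circle, c₀ < ((z / s : Circle) : ℂ).re →
    c₀ < ((z / s' : Circle) : ℂ).re → s = s'

/-- The real part of `z / s` measures the chordal distance of `z` and `s`, so the condition
`c < Re (z / s)` describes an arc with centre `s`. -/
theorem re_div_eq (z s : Circle) : ((z / s : Circle) : ℂ).re = 1 - dist z s ^ 2 / 2 := by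
  have h₁ : dist z s = ‖((z / s : Circle) : ℂ) - 1‖ := by
    have : ((z / s : Circle) : ℂ) - 1 = ((z : ℂ) - s) / s := by
      rw [Circle.coe_div, sub_div, div_self (Circle.coe_ne_zero s)]
    rw [this, norm_div, Circle.norm_coe, div_one, ← dist_eq_norm]
    rfl
  have h₂ : ‖((z / s : Circle) : ℂ)‖ = 1 := Circle.norm_coe _
  have h₃ : ((z / s : Circle) : ℂ).re ^ 2 + ((z / s : Circle) : ℂ).im ^ 2 = 1 := by
    rw [← one_pow 2, ← h₂, ← Complex.normSq_eq_norm_sq, Complex.normSq_apply]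
    ring
  rw [h₁, ← Complex.normSq_eq_norm_sq, Complex.normSq_apply, Complex.sub_re, Complex.sub_im,
    Complex.one_re, Complex.one_im]
  linarith

/-- If `c` is close enough to `1`, the arcs `Re (z / s) > c` around the points of a finite set are
disjoint. -/
theorem exists_separated (S : Finset Circle) : ∃ c₀ c₁, Separated S c₀ c₁ := by
  have h : ∀ᶠ c : ℝ in nhdsWithin 1 (Set.Iio 1), ∀ s ∈ S, ∀ s' ∈ S, s ≠ s' →
      1 - dist s s' ^ 2 / 8 < c := by
    refine (Filter.eventually_all_finset S).2 fun s _ => (Filter.eventually_all_finset S).2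
      fun s' _ => ?_
    by_cases e : s = s'
    · simp [e]
    · have : 0 < dist s s' := dist_pos.2 e
      filter_upwards [nhdsWithin_le_nhds (lt_mem_nhds
        (show 1 - dist s s' ^ 2 / 8 < 1 by nlinarith))] with c hc _ using hc
  have h' : ∀ᶠ c : ℝ in nhdsWithin 1 (Set.Iio 1), 0 < c :=
    nhdsWithin_le_nhds (lt_mem_nhds zero_lt_one)
  have h'' : ∀ᶠ c : ℝ in nhdsWithin 1 (Set.Iio 1), c < 1 := self_mem_nhdsWithin
  obtain ⟨c, hc, h₀, h₁⟩ := (h.and (h'.and h'')).exists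
  refine ⟨c, (1 + c) / 2, h₀.le, by linarith, by linarith, fun s hs s' hs' z hz hz' => ?_⟩
  by_contra e
  have h₂ := hc s hs s' hs' e
  rw [re_div_eq] at hz hz'
  have h₃ := dist_triangle_left s s' z
  have h₄ := dist_nonneg (x := z) (y := s)
  have h₅ := dist_nonneg (x := z) (y := s')
  have h₆ := dist_nonneg (x := s) (y := s')
  have h₇ : dist s s' ^ 2 ≤ (dist z s + dist z s') ^ 2 := pow_le_pow_left₀ h₆ h₃ 2
  -- With `ε = 1 - c`, both distances have square less than `2ε`, hence the square of their sum is
  -- less than `8ε`, which contradicts the choice of `c`.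
  nlinarith [sq_nonneg (dist z s - dist z s')]

/-- In the arcs around the points of `S`, the component orthogonal to the centre of the arc is
decreased by a multiple of `κ`. -/
def collapse (S : Finset Circle) (c₀ c₁ κ : ℝ) (z : ℂ) : ℂ :=
  z - κ * ∑ s ∈ S, (cutoff c₀ c₁ (z * ((s⁻¹ : Circle) : ℂ)).re *
    (z * ((s⁻¹ : Circle) : ℂ)).im : ℝ) * (Complex.I * s)

theorem contDiff_collapse (S : Finset Circle) (c₀ c₁ : ℝ) :
    ContDiff ℝ ∞ fun p : ℝ × ℂ => collapse S c₀ c₁ p.1 p.2 := by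
  have h₁ (s : Circle) : ContDiff ℝ ∞ fun p : ℝ × ℂ => (p.2 * ((s⁻¹ : Circle) : ℂ)).re :=
    Complex.reCLM.contDiff.comp (contDiff_snd.mul contDiff_const)
  have h₂ (s : Circle) : ContDiff ℝ ∞ fun p : ℝ × ℂ => (p.2 * ((s⁻¹ : Circle) : ℂ)).im :=
    Complex.imCLM.contDiff.comp (contDiff_snd.mul contDiff_const)
  refine contDiff_snd.sub ((Complex.ofRealCLM.contDiff.comp contDiff_fst).mul
    (ContDiff.sum fun s _ => ContDiff.mul ?_ contDiff_const))
  exact Complex.ofRealCLM.contDiff.comp (((contDiff_cutoff c₀ c₁).comp (h₁ s)).mul (h₂ s))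

variable {S : Finset Circle} {c₀ c₁ κ : ℝ}

/-- In the arc around `s ∈ S`, only the summand of `s` is nonzero: in the coordinates with `s` as
first basis vector, the second coordinate is multiplied by `1 - κ * cutoff c₀ c₁ _`. -/
theorem collapse_of_mem (hS : Separated S c₀ c₁) {s : Circle} (hs : s ∈ S) {z : Circle}
    (hz : c₀ < ((z / s : Circle) : ℂ).re) : collapse S c₀ c₁ κ z =
      s * ⟨((z / s : Circle) : ℂ).re, (1 - κ * cutoff c₀ c₁ ((z / s : Circle) : ℂ).re) *
        ((z / s : Circle) : ℂ).im⟩ := by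
  have e (s : Circle) : (z : ℂ) * ((s⁻¹ : Circle) : ℂ) = ((z / s : Circle) : ℂ) := by
    rw [div_eq_mul_inv, Circle.coe_mul]
  unfold collapse
  rw [Finset.sum_eq_single_of_mem s hs]
  · rw [e]
    have : (z : ℂ) = s * ((z / s : Circle) : ℂ) := by
      rw [← Circle.coe_mul, mul_div_cancel]
    conv_lhs => rw [this]
    obtain ⟨w, hw⟩ : ∃ w, w = ((z / s : Circle) : ℂ) := ⟨_, rfl⟩
    rw [← hw]
    obtain ⟨x, y⟩ := w
    have h₁ : (⟨x, y⟩ : ℂ) = x + y * Complex.I := Complex.mk_eq_add_mul_I x y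
    have h₂ := Complex.mk_eq_add_mul_I x ((1 - κ * cutoff c₀ c₁ x) * y)
    dsimp only
    rw [h₁, h₂]
    push_cast
    ring
  · intro s' hs' hne
    rw [e, cutoff_zero hS.lt (not_lt.1 fun h => hne (hS.eq s' hs' s hs z h hz))]
    simp

theorem collapse_of_forall_le (hS : Separated S c₀ c₁) {z : Circle}
    (hz : ∀ s ∈ S, ((z / s : Circle) : ℂ).re ≤ c₀) : collapse S c₀ c₁ κ z = z := by
  unfold collapse
  rw [Finset.sum_eq_zero]
  · simp
  · intro s hs
    rw [← Circle.coe_mul, ← div_eq_mul_inv, cutoff_zero hS.lt (hz s hs)]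
    simp

/-- In an arc the component in direction of the centre is unchanged and positive, and outside of the
arcs the point does not move. -/
theorem collapse_ne_zero (hS : Separated S c₀ c₁) (z : Circle) : collapse S c₀ c₁ κ z ≠ 0 := by
  by_cases h : ∃ s ∈ S, c₀ < ((z / s : Circle) : ℂ).re
  · obtain ⟨s, hs, hz⟩ := h
    rw [collapse_of_mem hS hs hz]
    refine mul_ne_zero (Circle.coe_ne_zero s) fun h => ?_
    have := congrArg Complex.re h
    have := hS.nonneg
    simp_all
    linarith
  · push Not at h
    rw [collapse_of_forall_le hS h]
    exact Circle.coe_ne_zero z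

/-- The point of the circle that `collapse` defines. -/
def collapseCircle (hS : Separated S c₀ c₁) (κ : ℝ) (z : Circle) : Circle :=
  ⟨collapse S c₀ c₁ κ z / ‖collapse S c₀ c₁ κ z‖, mem_sphere_zero_iff_norm.2 (by
    rw [norm_div, Complex.norm_real, norm_norm,
      div_self (norm_ne_zero_iff.2 (collapse_ne_zero hS z))])⟩

/-- Outside of the arcs, the map is the identity. -/
theorem collapseCircle_of_forall_le (hS : Separated S c₀ c₁) {z : Circle}
    (hz : ∀ s ∈ S, ((z / s : Circle) : ℂ).re ≤ c₀) : collapseCircle hS κ z = z := by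
  apply Circle.ext
  show collapse S c₀ c₁ κ z / ‖collapse S c₀ c₁ κ z‖ = (z : ℂ)
  rw [collapse_of_forall_le hS hz, Circle.norm_coe, Complex.ofReal_one, div_one]

/-- Coordinates of the collapsed point in the arc around `s`.  The number `r` is the norm of
`collapse S c₀ c₁ κ z`; it is at most `1`, so that the real part does not decrease and points do not
leave the arc. -/
theorem collapseCircle_div_of_mem (hS : Separated S c₀ c₁) {s : Circle} (hs : s ∈ S) {z : Circle}
    (hz : c₀ < ((z / s : Circle) : ℂ).re) (hκ : κ ∈ Set.Icc 0 1) : ∃ r : ℝ, 0 < r ∧ r ≤ 1 ∧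
      ((collapseCircle hS κ z / s : Circle) : ℂ).re = ((z / s : Circle) : ℂ).re / r ∧
      ((collapseCircle hS κ z / s : Circle) : ℂ).im =
        (1 - κ * cutoff c₀ c₁ ((z / s : Circle) : ℂ).re) * ((z / s : Circle) : ℂ).im / r := by
  obtain ⟨x, hx⟩ : ∃ x, x = ((z / s : Circle) : ℂ).re := ⟨_, rfl⟩
  obtain ⟨y, hy⟩ : ∃ y, y = ((z / s : Circle) : ℂ).im := ⟨_, rfl⟩
  obtain ⟨q, hq⟩ : ∃ q, q = 1 - κ * cutoff c₀ c₁ x := ⟨_, rfl⟩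
  have hq₀ : 0 ≤ q ∧ q ≤ 1 := by
    have h₁ := cutoff_mem c₀ c₁ x
    have h₂ := mul_nonneg hκ.1 h₁.1
    have h₃ := mul_le_one₀ hκ.2 h₁.1 h₁.2
    constructor <;> linarith
  have e := collapse_of_mem (κ := κ) hS hs hz
  rw [← hx, ← hy, ← hq] at e ⊢
  rw [← hx] at hz
  have hxy : x ^ 2 + y ^ 2 = 1 := by
    have h₁ : ‖((z / s : Circle) : ℂ)‖ = 1 := Circle.norm_coe _
    rw [hx, hy, ← one_pow 2, ← h₁, ← Complex.normSq_eq_norm_sq, Complex.normSq_apply]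
    ring
  have hr : ‖(⟨x, q * y⟩ : ℂ)‖ ^ 2 = x ^ 2 + q ^ 2 * y ^ 2 := by
    rw [← Complex.normSq_eq_norm_sq, Complex.normSq_apply]
    ring
  have key : ((collapseCircle hS κ z / s : Circle) : ℂ) =
      (⟨x, q * y⟩ : ℂ) / (‖(⟨x, q * y⟩ : ℂ)‖ : ℝ) := by
    rw [Circle.coe_div]
    show collapse S c₀ c₁ κ z / (‖collapse S c₀ c₁ κ z‖ : ℝ) / (s : ℂ) = _
    rw [e, norm_mul, Circle.norm_coe, one_mul, mul_div_assoc,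
      mul_div_cancel_left₀ _ (Circle.coe_ne_zero s)]
  refine ⟨‖(⟨x, q * y⟩ : ℂ)‖, norm_pos_iff.2 fun h => ?_, ?_, ?_, ?_⟩
  · have h₁ : x = 0 := congrArg Complex.re h
    have := hS.nonneg
    linarith
  · refine (sq_le_sq₀ (norm_nonneg _) zero_le_one).1 ?_
    rw [hr, one_pow, ← hxy]
    have : q ^ 2 ≤ 1 := pow_le_one₀ hq₀.1 hq₀.2
    nlinarith [sq_nonneg y]
  · rw [key, Complex.div_ofReal_re]
  · rw [key, Complex.div_ofReal_im]

theorem collapseCircle_zero (hS : Separated S c₀ c₁) (z : Circle) :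
    collapseCircle hS 0 z = z := by
  have : collapse S c₀ c₁ 0 z = z := by simp [collapse]
  apply Circle.ext
  show collapse S c₀ c₁ 0 z / ‖collapse S c₀ c₁ 0 z‖ = (z : ℂ)
  rw [this, Circle.norm_coe, Complex.ofReal_one, div_one]

/-- Near the points of `S`, the map is constant. -/
theorem collapseCircle_one_of_le (hS : Separated S c₀ c₁) {s : Circle} (hs : s ∈ S) {z : Circle}
    (hz : c₁ ≤ ((z / s : Circle) : ℂ).re) : collapseCircle hS 1 z = s := by
  obtain ⟨r, hr, -, h₁, h₂⟩ := collapseCircle_div_of_mem (κ := 1) hS hs (hS.lt.trans_le hz)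
    ⟨zero_le_one, le_rfl⟩
  rw [cutoff_one hS.lt hz, one_mul, sub_self, zero_mul, zero_div] at h₂
  have h₃ : ‖((collapseCircle hS 1 z / s : Circle) : ℂ)‖ ^ 2 = 1 := by
    rw [Circle.norm_coe, one_pow]
  rw [← Complex.normSq_eq_norm_sq, Complex.normSq_apply, h₂] at h₃
  have h₄ : 0 ≤ ((collapseCircle hS 1 z / s : Circle) : ℂ).re := by
    rw [h₁]
    have := hS.nonneg
    have := hS.lt
    exact div_nonneg (by linarith) hr.le
  have h₅ : ((collapseCircle hS 1 z / s : Circle) : ℂ).re = 1 := by nlinarith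
  refine div_eq_one.1 (Circle.ext (Complex.ext h₅ ?_))
  rw [h₂, Circle.coe_one, Complex.one_im]

/-- A point that is mapped to a point `s` of `S` lies in the arc around `s`. -/
theorem re_div_of_collapseCircle_eq (hS : Separated S c₀ c₁) {s : Circle} (hs : s ∈ S)
    {z : Circle} (hz : collapseCircle hS 1 z = s) : c₀ < ((z / s : Circle) : ℂ).re := by
  have self (s : Circle) : c₀ < ((s / s : Circle) : ℂ).re := by
    rw [div_self']
    exact hS.lt.trans hS.lt_one
  by_cases h : ∃ s' ∈ S, c₀ < ((z / s' : Circle) : ℂ).re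
  · obtain ⟨s', hs', hz'⟩ := h
    obtain ⟨r, hr, hr', h₁, -⟩ := collapseCircle_div_of_mem (κ := 1) hS hs' hz'
      ⟨zero_le_one, le_rfl⟩
    have h₂ : c₀ < ((s / s' : Circle) : ℂ).re := by
      rw [← hz, h₁]
      refine hz'.trans_le ((le_div_iff₀ hr).2 ?_)
      have := hS.nonneg
      nlinarith
    rwa [hS.eq s hs s' hs' s (self s) h₂]
  · push Not at h
    rw [collapseCircle_of_forall_le hS h] at hz
    rw [hz]
    exact self s

/-- The value of a smooth map to the circle as a complex number of absolute value `1`. -/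
def circleVal {Z : Mfd} (f : Z ⟶ Mfd.circle) (z : Z) : Circle := f.1 z

/-- The collapsed plot of the circle. -/
def collapsePlot (hS : Separated S c₀ c₁) {Z : Mfd} (κ : Z ⟶ Mfd.line) (f : Z ⟶ Mfd.circle) :
    Z ⟶ Mfd.circle :=
  ⟨fun z => collapseCircle hS (lineVal κ z) (circleVal f z), by
    have := finrank_real_complex_fact'
    have hf : ContMDiff 𝓘(ℝ, Z.model) 𝓘(ℝ, ℂ) ∞ fun z : Z => (circleVal f z : ℂ) :=
      (contMDiff_coe_sphere (n := 1)).comp f.2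
    have hc : ContMDiff 𝓘(ℝ, Z.model) 𝓘(ℝ, ℂ) ∞
        fun z : Z => collapse S c₀ c₁ (lineVal κ z) (circleVal f z : ℂ) :=
      (contDiff_collapse S c₀ c₁).contMDiff.comp (ContMDiff.prodMk_space κ.2 hf)
    have h : ContMDiff 𝓘(ℝ, Z.model) 𝓘(ℝ, ℂ) ∞
        fun z : Z => collapse S c₀ c₁ (lineVal κ z) (circleVal f z : ℂ) /
          ‖collapse S c₀ c₁ (lineVal κ z) (circleVal f z : ℂ)‖ := by
      intro x
      have h₁ : ContDiffAt ℝ ∞ (fun z : ℂ => z / ((‖z‖ : ℝ) : ℂ))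
          (collapse S c₀ c₁ (lineVal κ x) (circleVal f x : ℂ)) := by
        have hx := collapse_ne_zero (κ := lineVal κ x) hS (circleVal f x)
        have h₂ : ContDiffAt ℝ ∞ (fun z : ℂ => ((‖z‖ : ℝ) : ℂ))
            (collapse S c₀ c₁ (lineVal κ x) (circleVal f x : ℂ)) :=
          Complex.ofRealCLM.contDiff.contDiffAt.comp _ (contDiffAt_norm ℝ hx)
        simp only [div_eq_mul_inv]
        exact contDiffAt_id.mul (h₂.inv (by simpa using hx))
      exact h₁.contMDiffAt.comp x (hc x)
    exact h.codRestrict_sphere (n := 1)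
      fun z => (collapseCircle hS (lineVal κ z) (circleVal f z)).2⟩

end Collapse

section Sided

theorem arg_nonpos_of_im {z : ℂ} (h : z.im ≤ 0) (hz : z ∈ Complex.slitPlane) : z.arg ≤ 0 := by
  rcases h.lt_or_eq with h | h
  · exact (Complex.arg_neg_iff.2 h).le
  · have : 0 < z.re := (Complex.mem_slitPlane_iff.1 hz).resolve_right (not_not.2 h)
    exact (Complex.arg_eq_zero_iff.2 ⟨this.le, h⟩).le

/-- Every point of the circle is `e^{2πit}` for some `t ∈ [0, 1)`. -/
theorem exists_exp_eq (u : Circle) : ∃ t : ℝ, 0 ≤ t ∧ t < 1 ∧ Circle.exp (2 * Real.pi * t) = u := by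
  obtain ⟨x, rfl⟩ := Circle.exp_surjective u
  refine ⟨Int.fract (x / (2 * Real.pi)), Int.fract_nonneg _, Int.fract_lt_one _, ?_⟩
  refine Circle.exp_eq_exp.2 ⟨-⌊x / (2 * Real.pi)⌋, ?_⟩
  have := Real.pi_ne_zero
  rw [Int.fract]
  push_cast
  field_simp
  ring

theorem contMDiff_circleVal_div {Z : Mfd} (σ : Z ⟶ Mfd.circle) (u : Circle) :
    ContMDiff 𝓘(ℝ, Z.model) 𝓘(ℝ, ℂ) ∞ fun z => ((circleVal σ z / u : Circle) : ℂ) := by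
  have := finrank_real_complex_fact'
  have h₁ : ContMDiff 𝓘(ℝ, Z.model) 𝓘(ℝ, ℂ) ∞ fun z => (circleVal σ z : ℂ) :=
    (contMDiff_coe_sphere (n := 1)).comp σ.2
  have h₂ : ContDiff ℝ ∞ fun z : ℂ => z / u := contDiff_id.div_const _
  simp only [Circle.coe_div]
  exact h₂.contMDiff.comp h₁

/-- The map `σ` is adapted to `T` if near every point that is mapped to `e^{2πib}`, where `b` is an
element of `T` or an end point of the interval, its values are on one side of this point. -/
theorem adapted_of_sided (σ : Mfd.circle ⟶ Mfd.circle) {T : Set ℝ} (hT : T.Finite)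
    (h₀ : 0 ∈ T) (h : ∀ b ∈ T, ∀ z₀, circleVal σ z₀ = Circle.exp (2 * Real.pi * b) →
      (∀ᶠ z in nhds z₀, 0 ≤ ((circleVal σ z / circleVal σ z₀ : Circle) : ℂ).im) ∨
      ∀ᶠ z in nhds z₀, ((circleVal σ z / circleVal σ z₀ : Circle) : ℂ).im ≤ 0) :
    Adapted σ T := by
  intro z₀
  have hpi := Real.pi_pos
  obtain ⟨w, hw⟩ : ∃ w : Mfd.circle → ℂ,
    ∀ z, w z = ((circleVal σ z / circleVal σ z₀ : Circle) : ℂ) := ⟨_, fun _ => rfl⟩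
  have hwd : ContMDiff 𝓘(ℝ, Mfd.circle.model) 𝓘(ℝ, ℂ) ∞ w := by
    rw [funext hw]
    exact contMDiff_circleVal_div σ _
  have hw₀ : w z₀ = 1 := by rw [hw, div_self', Circle.coe_one]
  replace h (b) (hb : b ∈ T) (hz : circleVal σ z₀ = Circle.exp (2 * Real.pi * b)) :
      (∀ᶠ z in nhds z₀, 0 ≤ (w z).im) ∨ ∀ᶠ z in nhds z₀, (w z).im ≤ 0 :=
    (h b hb z₀ hz).imp (fun H => H.mono fun z hz => (hw z).symm ▸ hz)
      (fun H => H.mono fun z hz => (hw z).symm ▸ hz)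
  have hslit : ∀ᶠ z in nhds z₀, w z ∈ Complex.slitPlane :=
    hwd.continuous.continuousAt.eventually_mem (Complex.isOpen_slitPlane.mem_nhds
      (by rw [hw₀]; exact Complex.one_mem_slitPlane))
  obtain ⟨a, ha⟩ : ∃ a : Mfd.circle → ℝ, ∀ z, a z = (w z).arg / (2 * Real.pi) :=
    ⟨_, fun _ => rfl⟩
  have had {z} (hz : w z ∈ Complex.slitPlane) :
      ContMDiffAt 𝓘(ℝ, Mfd.circle.model) 𝓘(ℝ, ℝ) ∞ a z := by
    have h₁ : ContDiffAt ℝ ∞ (fun z : ℂ => z.arg / (2 * Real.pi)) (w z) := by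
      have h₂ : ContDiffAt ℝ ∞ Complex.log (w z) := (Complex.contDiffAt_log hz).restrict_scalars ℝ
      have h₃ : ContDiffAt ℝ ∞ Complex.arg (w z) := by
        rw [show Complex.arg = fun z => (Complex.log z).im from
          funext fun z => (Complex.log_im z).symm]
        exact Complex.imCLM.contDiff.contDiffAt.comp _ h₂
      exact h₃.div_const _
    rw [funext ha]
    exact h₁.contMDiffAt.comp z (hwd z)
  have ha₀ : a z₀ = 0 := by rw [ha, hw₀, Complex.arg_one, zero_div]
  have hac : Filter.Tendsto a (nhds z₀) (nhds 0) := by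
    have := (had hslit.self_of_nhds).continuousAt
    rwa [ContinuousAt, ha₀] at this
  have up (H : ∀ᶠ z in nhds z₀, 0 ≤ (w z).im) : ∀ᶠ z in nhds z₀, 0 ≤ a z := H.mono fun z hz => by
    rw [ha]
    exact div_nonneg (Complex.arg_nonneg_iff.2 hz) (by positivity)
  have down (H : ∀ᶠ z in nhds z₀, (w z).im ≤ 0) : ∀ᶠ z in nhds z₀, a z ≤ 0 :=
    (H.and hslit).mono fun z hz => by
      rw [ha]
      exact div_nonpos_of_nonpos_of_nonneg (arg_nonpos_of_im hz.1 hz.2) (by positivity)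
  -- the point `0 = 1` of the circle is approached from above or from below
  obtain ⟨t, ht₀, ht₁, ht, htu, htd⟩ : ∃ t : ℝ, 0 ≤ t ∧ t ≤ 1 ∧
      Circle.exp (2 * Real.pi * t) = circleVal σ z₀ ∧ (t = 0 → ∀ᶠ z in nhds z₀, 0 ≤ a z) ∧
      (t = 1 → ∀ᶠ z in nhds z₀, a z ≤ 0) := by
    obtain ⟨t, h₁, h₂, h₃⟩ := exists_exp_eq (circleVal σ z₀)
    by_cases h₄ : t = 0
    · subst h₄
      rcases h 0 h₀ h₃.symm with H | H
      · exact ⟨0, le_rfl, zero_le_one, h₃, fun _ => up H, fun h => by simp at h⟩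
      · refine ⟨1, zero_le_one, le_rfl, ?_, fun h => by simp at h, fun _ => down H⟩
        rw [← h₃]
        simp
    · exact ⟨t, h₁, h₂.le, h₃, fun h => absurd h h₄, fun h => absurd h h₂.ne⟩
  have lt (b : ℝ) (hb : t < b) : ∀ᶠ z in nhds z₀, t + a z < b := by
    filter_upwards [hac.eventually_lt_const (sub_pos.2 hb)] with z hz
    linarith
  have gt (b : ℝ) (hb : b < t) : ∀ᶠ z in nhds z₀, b < t + a z := by
    filter_upwards [hac.eventually_const_lt (sub_neg.2 hb)] with z hz
    linarith
  have side (b) (hb : b ∈ T) : (∀ᶠ z in nhds z₀, t + a z ≤ b) ∨ ∀ᶠ z in nhds z₀, b ≤ t + a z := by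
    rcases lt_trichotomy t b with h₁ | rfl | h₁
    · exact .inl ((lt b h₁).mono fun z hz => hz.le)
    · rcases h t hb ht.symm with H | H
      · exact .inr ((up H).mono fun z hz => by linarith)
      · exact .inl ((down H).mono fun z hz => by linarith)
    · exact .inr ((gt b h₁).mono fun z hz => hz.le)
  have side' : ∀ᶠ z in nhds z₀, ∀ b ∈ T, ((∀ᶠ z in nhds z₀, t + a z ≤ b) → t + a z ≤ b) ∧
      ((¬ ∀ᶠ z in nhds z₀, t + a z ≤ b) → b ≤ t + a z) := by
    refine (Filter.eventually_all_finite hT).2 fun b hb => ?_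
    by_cases H : ∀ᶠ z in nhds z₀, t + a z ≤ b
    · exact H.mono fun z hz => ⟨fun _ => hz, fun h => absurd H h⟩
    · exact ((side b hb).resolve_left H).mono fun z hz => ⟨fun h => absurd h H, fun _ => hz⟩
  have unit₀ : ∀ᶠ z in nhds z₀, 0 ≤ t + a z := by
    rcases ht₀.lt_or_eq with h₁ | h₁
    · exact (gt 0 h₁).mono fun z hz => hz.le
    · exact (htu h₁.symm).mono fun z hz => by linarith
  have unit₁ : ∀ᶠ z in nhds z₀, t + a z ≤ 1 := by
    rcases ht₁.lt_or_eq with h₁ | h₁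
    · exact (lt 1 h₁).mono fun z hz => hz.le
    · exact (htd h₁).mono fun z hz => by linarith
  have osc : ∀ᶠ z in nhds z₀, |a z| < 1 / 4 := by
    have := hac.abs
    rw [abs_zero] at this
    exact this.eventually_lt_const (by norm_num)
  obtain ⟨U, hU, hUo, hz₀⟩ := eventually_nhds_iff.1
    (hslit.and (side'.and (unit₀.and (unit₁.and osc))))
  refine ⟨⟨U, hUo⟩, fun z => t + a z, hz₀, fun z hz => ?_, fun z hz => ?_, fun z hz => ?_,
    fun z hz z' hz' => ?_, fun b hb => ?_⟩
  · exact contMDiffAt_const.add (had (hU z hz).1)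
  · have h₁ : 2 * Real.pi * (t + a z) = 2 * Real.pi * t + (w z).arg := by
      rw [ha]
      field_simp
    rw [h₁, Circle.exp_add, ht, hw, Circle.exp_arg, mul_div_cancel]
    rfl
  · exact ⟨(hU z hz).2.2.1, (hU z hz).2.2.2.1⟩
  · have h₁ := abs_lt.1 (hU z hz).2.2.2.2
    have h₂ := abs_lt.1 (hU z' hz').2.2.2.2
    rw [abs_lt]
    constructor <;> linarith
  · by_cases H : ∀ᶠ z in nhds z₀, t + a z ≤ b
    · exact .inl fun z hz => ((hU z hz).2.1 b hb).1 H
    · exact .inr fun z hz => ((hU z hz).2.1 b hb).2 H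

variable {S : Finset Circle} {c₀ c₁ : ℝ}

/-- The map of the circle that is constant near the points of `S`. -/
abbrev collapseMap (hS : Separated S c₀ c₁) : Mfd.circle ⟶ Mfd.circle :=
  collapsePlot hS (Mfd.const (N := Mfd.line) _ (1 : ℝ)) (𝟙 Mfd.circle)

/-- Near a point that is mapped to `s ∈ S`, the values of the collapsing map are on one side of `s`:
if the point is not `s`, it is on one side of `s` itself, which the map preserves, and near `s` the
map is constant. -/
theorem collapseMap_sided (hS : Separated S c₀ c₁) {s : Circle} (hs : s ∈ S) {z₀ : Circle}
    (hz₀ : collapseCircle hS 1 z₀ = s) :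
    (∀ᶠ z in nhds z₀, 0 ≤ ((collapseCircle hS 1 z / s : Circle) : ℂ).im) ∨
      ∀ᶠ z in nhds z₀, ((collapseCircle hS 1 z / s : Circle) : ℂ).im ≤ 0 := by
  have hd : Continuous fun z : Circle => ((z / s : Circle) : ℂ) :=
    continuous_subtype_val.comp (continuous_id.div' continuous_const)
  have hre := Complex.continuous_re.comp hd
  have him := Complex.continuous_im.comp hd
  have h₀ := re_div_of_collapseCircle_eq hS hs hz₀
  have near₀ : ∀ᶠ z in nhds z₀, c₀ < ((z / s : Circle) : ℂ).re :=
    hre.continuousAt.eventually_const_lt h₀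
  have im_eq (z : Circle) (hz : c₀ < ((z / s : Circle) : ℂ).re) : ∃ q : ℝ, 0 ≤ q ∧
      ((collapseCircle hS 1 z / s : Circle) : ℂ).im = q * ((z / s : Circle) : ℂ).im := by
    obtain ⟨r, hr, -, -, h₁⟩ := collapseCircle_div_of_mem (κ := 1) hS hs hz
      ⟨zero_le_one, le_rfl⟩
    have h₂ := cutoff_mem c₀ c₁ ((z / s : Circle) : ℂ).re
    refine ⟨(1 - 1 * cutoff c₀ c₁ ((z / s : Circle) : ℂ).re) / r,
      div_nonneg (by linarith [h₂.2]) hr.le, h₁.trans (by ring)⟩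
  rcases lt_trichotomy ((z₀ / s : Circle) : ℂ).im 0 with h₁ | h₁ | h₁
  · refine .inr ?_
    filter_upwards [near₀, him.continuousAt.eventually_lt_const h₁] with z hz hz'
    obtain ⟨q, hq, e⟩ := im_eq z hz
    rw [e]
    exact mul_nonpos_of_nonneg_of_nonpos hq (le_of_lt hz')
  · refine .inl ?_
    have h₂ : c₁ < ((z₀ / s : Circle) : ℂ).re := by
      have h₃ : ‖((z₀ / s : Circle) : ℂ)‖ ^ 2 = 1 := by rw [Circle.norm_coe, one_pow]
      rw [← Complex.normSq_eq_norm_sq, Complex.normSq_apply, h₁] at h₃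
      have := hS.nonneg
      have h₄ : ((z₀ / s : Circle) : ℂ).re = 1 := by nlinarith
      rw [h₄]
      exact hS.lt_one
    filter_upwards [hre.continuousAt.eventually_const_lt h₂] with z hz
    rw [collapseCircle_one_of_le hS hs (le_of_lt hz), div_self', Circle.coe_one, Complex.one_im]
  · refine .inl ?_
    filter_upwards [near₀, him.continuousAt.eventually_const_lt h₁] with z hz hz'
    obtain ⟨q, hq, e⟩ := im_eq z hz
    rw [e]
    exact mul_nonneg hq (le_of_lt hz')

/-- For every finite set `T`, the map that is constant near `1` and near the points `e^{2πib}`, for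
`b ∈ T`, is adapted to `T`. -/
theorem exists_adapted {T : Set ℝ} (hT : T.Finite) : ∃ (S : Finset Circle) (c₀ c₁ : ℝ)
    (hS : Separated S c₀ c₁), Adapted (collapseMap hS) T := by
  classical
  have hT' : (insert 0 T).Finite := hT.insert 0
  obtain ⟨c₀, c₁, hS⟩ := exists_separated
    (hT'.toFinset.image fun b => Circle.exp (2 * Real.pi * b))
  refine ⟨_, c₀, c₁, hS, (adapted_of_sided (T := insert 0 T) _ hT' (Set.mem_insert _ _)
    fun b hb z₀ hz₀ => ?_).mono (Set.subset_insert _ _)⟩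
  exact collapseMap_sided hS (hz₀ ▸ Finset.mem_image_of_mem _ (hT'.mem_toFinset.2 hb)) rfl

end Sided

/-! ### Homotopic loops define isomorphic bundles -/

section Main

variable {𝒳 : BasedCategory.{v, u} Mfd} {S : Finset Circle} {c₀ c₁ : ℝ}

/-- The homotopy from the identity of the circle to the map that is constant near the points
of `S`. -/
def collapseFunctor (hS : Separated S c₀ c₁) : prod (seg 0 1) S1 ⥤ᵇ S1 :=
  mkFunctor (fun A => (⟨A.fst.dom, collapsePlot hS A.fst.map (eqToHom A.eq.symm ≫ A.snd.map),
      fun _ => trivial⟩ : PlotObj Mfd.circle _))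
    (fun {A B} φ => PlotHom.mk (a := ⟨A.fst.dom, _, _⟩) (b := ⟨B.fst.dom, _, _⟩) φ.fst.hom (by
      rw [← PiecewiseLoop.map_comp_plot (K := seg 0 1) φ, ← φ.fst.w]
      rfl))
    (fun _ => rfl) (fun _ _ => rfl) (fun _ => isHomLift_of_map_eq rfl)

/-- Functors to the stack of a manifold that are given by the same maps are isomorphic. -/
theorem nonempty_iso_ofMfd {𝒜 : BasedCategory.{v', u'} Mfd} {N : Mfd} {F F' : 𝒜 ⥤ᵇ ofMfd N}
    (e : ∀ a, (ofMfd N).p.obj (F.obj a) = (ofMfd N).p.obj (F'.obj a))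
    (e' : ∀ a, eqToHom (e a) ≫ (F'.obj a).map = (F.obj a).map) : Nonempty (F ≅ F') := by
  refine ⟨((sub_isCFG N Set.univ).nonempty_iso
    (fun a => PlotHom.mk (a := F.obj a) (b := F'.obj a) (eqToHom (e a)) (e' a)) (fun a => ?_)
    (fun {a b} φ => ?_)).choose⟩
  · refine IsHomLift.of_fac' (p := (ofMfd N).p) (a := F.obj a) (b := F'.obj a) _ _
      (F.w_obj a) (F'.w_obj a) ?_
    rw [Category.id_comp, eqToHom_trans]
  · have h₁ := isHomLift_map F (isHomLift_self φ)
    have h₂ := isHomLift_map F' (isHomLift_self φ)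
    have e₁ := IsHomLift.fac' (ofMfd N).p (𝒜.p.map φ) (F.map φ)
    have e₂ := IsHomLift.fac' (ofMfd N).p (𝒜.p.map φ) (F'.map φ)
    refine PlotHom.ext ?_
    show (ofMfd N).p.map (F.map φ) ≫ eqToHom (e b) = eqToHom (e a) ≫ (ofMfd N).p.map (F'.map φ)
    rw [e₁, e₂]
    simp

/-- Isomorphic reparametrizations of a family give isomorphic families. -/
theorem nonempty_prodMap_iso (h : IsCFG 𝒳) {K : BasedCategory.{v'', u''} Mfd}
    {L : BasedCategory.{v', u'} Mfd} {F F' : L ⥤ᵇ K} (e : F ≅ F') (Γ : prod K 𝒳 ⥤ᵇ 𝒳) :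
    Nonempty ((prodMap F (BasedFunctor.id 𝒳)).comp Γ ≅
      (prodMap F' (BasedFunctor.id 𝒳)).comp Γ) := by
  have lift (A : (prod L 𝒳).obj) : 𝒳.p.IsHomLift (K.p.map (e.hom.app A.fst)) (𝟙 A.snd) := by
    have h₁ := e.hom.isHomLift' A.fst
    have h₂ := IsHomLift.fac' K.p (𝟙 (L.p.obj A.fst)) (e.hom.app A.fst)
    rw [h₂, Category.id_comp, eqToHom_trans]
    exact IsHomLift.id_lift_eqToHom_domain _ (A.eq.trans (F.w_obj A.fst).symm)
  let η (A : (prod L 𝒳).obj) : (prodMap F (BasedFunctor.id 𝒳)).obj A ⟶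
      (prodMap F' (BasedFunctor.id 𝒳)).obj A :=
    pairHom (A := (prodMap F (BasedFunctor.id 𝒳)).obj A)
      (B := (prodMap F' (BasedFunctor.id 𝒳)).obj A) (e.hom.app A.fst) (𝟙 A.snd) (lift A)
  refine ⟨(h.nonempty_iso (𝒳 := prod L 𝒳) (fun A => Γ.map (η A)) (fun A => ?_)
    (fun {A B} φ => ?_)).choose⟩
  · exact isHomLift_map Γ (isHomLift_of_fst (e.hom.isHomLift' A.fst))
  · refine (Γ.map_comp _ _).symm.trans ((congrArg Γ.map ?_).trans (Γ.map_comp _ _))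
    exact pairHom_ext (e.hom.naturality φ.fst) ((Category.comp_id _).trans
      (Category.id_comp _).symm)

/-- The homotopy from a smooth loop to its collapsed reparametrization is a family of
diffeomorphisms. -/
theorem goodAt_reparam (h : IsCFG 𝒳) (γ : SmoothLoop 𝒳) (hS : Separated S c₀ c₁) (k) :
    GoodAt ((prodMap (collapseFunctor hS) (BasedFunctor.id 𝒳)).comp γ.circle) k :=
  GoodAt.baseChange h _ ((isDiffeoFamily_iff h).1 γ.isDiffeo _)

/-- The bundle of a loop and of its composite with the map of the circle that is homotopic to the
identity are isomorphic. -/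
theorem bundleEquivalent_collapse (h : IsStack 𝒳) (δ : ℝ) (γ : SmoothLoop 𝒳)
    (hS : Separated S c₀ c₁) :
    BundleEquivalent δ γ.circle
      ((prodMap (ofMfdMap (collapseMap hS)) (BasedFunctor.id 𝒳)).comp γ.circle) ∧
    BundleEquivalent δ ((prodMap (ofMfdMap (collapseMap hS)) (BasedFunctor.id 𝒳)).comp γ.circle)
      γ.circle := by
  have h₀ := h.toIsCFG
  let F := (prodMap (collapseFunctor hS) (BasedFunctor.id 𝒳)).comp γ.circle
  have hF := goodAt_reparam h₀ γ hS
  have m₀ : (0 : ℝ) ∈ Set.Icc (0 : ℝ) 1 := ⟨le_rfl, zero_le_one⟩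
  have m₁ : (1 : ℝ) ∈ Set.Icc (0 : ℝ) 1 := ⟨zero_le_one, le_rfl⟩
  obtain ⟨e₀⟩ : Nonempty (atParam F 0 m₀ ≅ γ.circle) := by
    obtain ⟨e⟩ := nonempty_iso_ofMfd
      (F := (insertParam (0 : ℝ) m₀).comp (collapseFunctor hS)) (F' := BasedFunctor.id S1)
      (fun a => rfl) (fun a => Subtype.ext (funext fun z =>
        (collapseCircle_zero hS (circleVal a.map z)).symm))
    exact nonempty_prodMap_iso h₀ e γ.circle
  obtain ⟨e₁⟩ : Nonempty (atParam F 1 m₁ ≅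
      (prodMap (ofMfdMap (collapseMap hS)) (BasedFunctor.id 𝒳)).comp γ.circle) := by
    obtain ⟨e⟩ := nonempty_iso_ofMfd
      (F := (insertParam (1 : ℝ) m₁).comp (collapseFunctor hS)) (F' := ofMfdMap (collapseMap hS))
      (fun a => rfl) (fun a => rfl)
    exact nonempty_prodMap_iso h₀ e γ.circle
  exact ⟨((bundleEquivalent_of_iso h₀ δ e₀.symm).trans
    (bundleEquivalent_atParam h δ F hF m₀ m₁)).trans (bundleEquivalent_of_iso h₀ δ e₁),
    ((bundleEquivalent_of_iso h₀ δ e₁.symm).trans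
    (bundleEquivalent_atParam h δ F hF m₁ m₀)).trans (bundleEquivalent_of_iso h₀ δ e₀)⟩

open PiecewiseLoop in
/-- Homotopy equivalent smooth loops define isomorphic bundles. -/
theorem bundleEquivalent_of_homotopyEquivalent (h : IsStack 𝒳) (δ : ℝ) {γ₀ γ₁ : SmoothLoop 𝒳}
    (hγ : γ₀.HomotopyEquivalent γ₁) : BundleEquivalent δ γ₀.circle γ₁.circle := by
  have h₀ := h.toIsCFG
  obtain ⟨N, s, hs, Γ, -, -, hd, hrel, hstart, hend⟩ := hγ
  choose T hT HT using fun k => (hrel k).exists_iso h pt_isCFG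
  obtain ⟨T₀, hT₀, HT₀⟩ := hstart.exists_iso h pt_isCFG
  obtain ⟨T₁, hT₁, HT₁⟩ := hend.exists_iso h pt_isCFG
  -- one map of the circle that is adapted to all partitions involved
  obtain ⟨S, c₀, c₁, hS, hσ⟩ := exists_adapted
    (T := (T₀ ∪ T₁) ∪ ((⋃ k, T k) ∪ ⋃ k, Set.range (Γ k).t))
    ((hT₀.union hT₁).union ((Set.finite_iUnion hT).union
      (Set.finite_iUnion fun k => Set.finite_range _)))
  obtain ⟨σ, rfl⟩ : ∃ σ, σ = collapseMap hS := ⟨_, rfl⟩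
  have charts (k) : HasCharts (collapseMap hS) (Γ k) := hasCharts_of_adapted (hσ.mono
    ((Set.subset_iUnion (fun k => Set.range (Γ k).t) k).trans
      (Set.subset_union_right.trans Set.subset_union_right)))
  have sK (a b : ℝ) : IsCFG (seg a b) := sub_isCFG _ _
  choose G hG using fun k => exists_realizes h (sK _ _) (charts k)
  have good (k) := (hG k).goodAt h (sK _ _) (charts k) (hd k)
  have at_iso {g g' : prod (prod pt S1) 𝒳 ⥤ᵇ 𝒳} (e : Nonempty (g ≅ g')) :
      BundleEquivalent δ ((prodMap ofPt (BasedFunctor.id 𝒳)).comp g)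
        ((prodMap ofPt (BasedFunctor.id 𝒳)).comp g') :=
    bundleEquivalent_of_iso h₀ δ (isoWhiskerLeft _ e.some)
  have le (k : Fin (N + 1)) : s k.castSucc ≤ s k.succ := (hs Fin.castSucc_lt_succ).le
  -- Alternate between moving along `[s k, s (k + 1)]` and exchanging realizations of naturally
  -- related loops at `s k`.
  have step (k : Fin (N + 1)) : BundleEquivalent δ γ₀.circle
      (atParam (G k) (s k.succ) ⟨le k, le_rfl⟩) := by
    induction k using Fin.induction with
    | zero =>
      refine ((bundleEquivalent_collapse h δ γ₀ hS).1.trans ?_).trans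
        (bundleEquivalent_atParam h δ (G 0) (good 0) ⟨le_rfl, le 0⟩ _)
      exact at_iso ((HT₀ _ (hσ.mono (Set.subset_union_left.trans Set.subset_union_left)) _ _
        ((hG 0).member _) (realizes_toPiecewise γ₀)).map Iso.symm)
    | succ k ih =>
      refine (ih.trans ?_).trans
        (bundleEquivalent_atParam h δ (G k.succ) (good k.succ) ⟨le_rfl, le k.succ⟩ _)
      exact at_iso (HT k _ (hσ.mono ((Set.subset_iUnion T k).trans
        (Set.subset_union_left.trans Set.subset_union_right))) _ _
        ((hG k.castSucc).member _) ((hG k.succ).member _))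
  refine ((step (Fin.last N)).trans ?_).trans (bundleEquivalent_collapse h δ γ₁ hS).2
  exact at_iso (HT₁ _ (hσ.mono (Set.subset_union_right.trans Set.subset_union_left)) _ _
    ((hG (Fin.last N)).member _) (realizes_toPiecewise γ₁))

end Main

end Stk

end

theorem mainTheorem5 (𝒳 : BasedCategory.{v, u} Mfd) (h𝒳 : Stk.IsOrbifold 𝒳) (δ : ℝ) (hδ : 0 < δ)
    (γ₀ γ₁ : Stk.SmoothLoop 𝒳) (h : γ₀.HomotopyEquivalent γ₁) :
    ∃ Φ : Stk.BundleIso (Stk.clutchProj δ γ₀.circle) (Stk.clutchProj δ γ₁.circle),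
      Φ.base = BasedFunctor.id (Stk.ofMfd Mfd.sphere) :=
  Stk.bundleEquivalent_of_homotopyEquivalent h𝒳.toIsStack δ h
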